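/- **Setting.** Let $(\mathbb X,d)$ be a complete, locally compact metric space in which any two points have a midpoint. For a set $A\subseteq\mathbb X$ let $B_a(A)=\{d(\cdot,A)<a\}$, $D_a(A)=\{d(\cdot,A)\le a\}$ (both empty for $A=\emptyset$), $S_a(x)=\{d(\cdot,x)=a\}$. A set is *strongly convex* if any two of its points are joined by a unique shortest path, which lies in the set and depends continuously on the end points. Assume that all sufficiently small balls at every point of $\mathbb X$ are strongly convex. Let $\mathrm{conv}(x)$ be the supremum of all $\delta$ such that $B_\eta(x)$ is strongly convex for all $0<\eta\le\delta$, and $\mathrm{conv}(P)=\inf_{p\in P}\mathrm{conv}(p)$. Homology has coefficients in $\mathbb Z$; $H(Y,A)$ stands for the homology groups of all degrees, and isomorphisms are meant in every degree. Let $K\subseteq\mathbb X$ be compact and a retract of a neighborhood of itself. Let $\mathcal S$ be a tame homology stratification of $K$: a locally finite family of pairwise disjoint locally closed sets (strata) with union $K$ such that $X\cap\overline Y\ne\emptyset\Rightarrow X\subseteq\overline Y$ for $X,Y\in\mathcal S$; each stratum is a finite dimensional homology manifold; the groups $H_\ell(K,K-\{x\})$ are finitely generated; and for $x\in X\in\mathcal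 S$ and all sufficiently small $r>0$ the inclusion induced maps $H_\ell(K,K-B_r(x))\to H_\ell(K,K-\{x\})$ and $H_\ell(K,K-B_r(x))\to H_\ell(K,K-B_\rho(y))\to H_\ell(K,K-\{y\})$ are isomorphisms whenever $y\in B_r(x)\cap X$, $0<\rho<r-d(x,y)$. Put $X\le Y$ if $X\subseteq\overline Y$; the height of a stratum $X$ is the largest $k$ for which there is a chain $X_0<\dots<X_k=X$. **Seemliness.** For $x\in K$ write $F(a,b)=H(D_a(K),D_a(K)-B_b(x))$ if $a>0$ or $b>0$, and $F(0,0)=H(K,K-\{x\})$. For $\varepsilon\ge0$ let $A_x(\varepsilon)$ be the set of triples $(R,r,\alpha)$ with $R\ge r>\alpha\ge\varepsilon$ such that: for all $\rho\in(0,R]$ the ball $D_\rho(x)$ is a topological ball (and $S_\rho(x)$ is transverse to all strata, if $\mathbb X$ is a smooth Riemannian manifold and $\mathcal S$ is a Whitney stratification); the inclusion induced maps $F(0,R)\to F(0,\rho)\to F(0,0)$ are isomorphisms for all $\rho\in(0,R]$; and with $i_*:F(0,R)\to F(\varepsilon,R)$, $j_*:F(\varepsilon,R)\to F(\alpha,r)$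 the map $j_*i_*$ is an isomorphism onto $\mathrm{im}\,j_*$. For $L\subseteq K$ put $A_L(\varepsilon)=\bigcap_{x\in L}A_x(\varepsilon)$, the intersection being taken inside $\{R\ge r>\alpha\ge\varepsilon\}$, and $A_L(\varepsilon\,|\,\alpha=\alpha')=\{(R,r):(R,r,\alpha')\in A_L(\varepsilon)\}$. The family $A_L$ is *weakly seemly* if there are $\varepsilon_L>0$ and $\alpha^l_L\le\alpha^u_L:[0,\varepsilon_L]\to\mathbb R_+$ such that $\alpha_L^l$ is non-decreasing with $\alpha_L^l(\varepsilon)\to0=\alpha_L^l(0)$ and $\alpha_L^u$ is non-increasing with $\alpha_L^u(\varepsilon)\to\alpha_L^u(0)$ as $\varepsilon\to0$; $A_L(\varepsilon\,|\,\alpha=\alpha')\ne\emptyset$ for all $\alpha'\in[\alpha_L^l(\varepsilon),\alpha_L^u(\varepsilon)]$; and the supremum over these $\alpha'$ of the Hausdorff distance of $A_L(0\,|\,\alpha=\alpha')$ and $A_L(\varepsilon\,|\,\alpha=\alpha')$ tends to $0$ as $\varepsilon\to0$. $K$ is *weakly locally homologically seemly* if for every $X\in\mathcal S$ the family $A_{X-B_w(\overline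 X-X)}$ is weakly seemly for all sufficiently small $w>0$. Given such functions, put $A_L([0,\varepsilon]\,|\,\alpha\le\beta)=\bigcap_{\varepsilon'\in[0,\varepsilon]}\bigcap_{\alpha'\in[\alpha^l_L(\varepsilon'),\beta]}A_L(\varepsilon'\,|\,\alpha=\alpha')$; let $\bar R_L(\varepsilon,\beta)$ be the supremum of the $R$ and $\bar r_L(\varepsilon,\beta)$ the infimum of the $r$ over all $(R,r)$ in this set; let $\Delta_L(\varepsilon,\beta,\delta)$ be the interior of the triangle with vertices $(\bar r_L+\delta,\bar r_L),(\bar R_L,\bar r_L),(\bar R_L,\bar R_L-\delta)$, i.e. the set of $(R,r)$ with $\bar r_L<r$, $R<\bar R_L$, $r+\delta<R$; let $\bar\delta_L(\varepsilon,\beta)=\inf\{\delta>0:\Delta_L(\varepsilon,\beta,\delta)\subseteq A_L([0,\varepsilon]\,|\,\alpha\le\beta)\}$ and $\tau_L=\bar R_L-\bar r_L-\bar\delta_L$ (with $\inf\emptyset=\infty$, $\sup\emptyset=-\infty$). For $f,g$ let $E_L(f,g)$ be the set of $\varepsilon\ge0$ such that $g(0,\varepsilon)$ and $\varepsilon'=\alpha^l_L(g(0,\varepsilon))$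 lie in $[0,\varepsilon_L]$ and $\tau_L(\varepsilon',g(\varepsilon',\varepsilon))>f(0,\varepsilon)+f(\varepsilon',\varepsilon)$. For a vector $\mathbf w=(w_Y)$ of non-negative reals, indexed by the strata $Y$ whose height is not maximal, let $K^{\mathbf w}$ be the union over all strata $X$ of $X-\bigcup_{Y}B_{w_Y}(Y)$, where $Y$ runs over the strata of height less than that of $X$. For every $\mathbf w$ such that $A_{K^{\mathbf w}}$ is weakly seemly fix functions $\alpha^l_{K^{\mathbf w}},\alpha^u_{K^{\mathbf w}}$ as above, and let $\Omega(\varepsilon,f,g)$ be the set of those $\mathbf w$ for which $\varepsilon\in E_{K^{\mathbf w}}(f,g)$. **Samples.** Let $\varepsilon>0$ and let $P\subset\mathbb X$ be a finite set at Hausdorff distance less than $\varepsilon$ from $K$. Let $t=0$ if $P\subseteq K$ (noise free), $t=1$ otherwise; $s=\sqrt2$ if $\mathbb X$ is a Euclidean space, $s=2$ otherwise. For $c\in\{1,s\}$ put $g_c(a,b)=ca+(c+t)b$ and $f_c(a,b)=g_c(a,b)+g_1(a,b)$. For $Q\subseteq P$ let $\mathcal C_a(Q)$ be the Čech complex (simplices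 $\sigma\subseteq Q$ with $\bigcap_{q\in\sigma}D_a(q)\ne\emptyset$) and $\mathcal R_a(Q)$ the Vietoris–Rips complex (simplices all of whose edges are in $\mathcal C_a(Q)$). For $p\in P$ let $C(a,b)=H(\mathcal C_a(P),\mathcal C_a(P-B_b(p)))$ and $V(a,b)=H(\mathcal R_a(P),\mathcal R_a(P-B_b(p)))$. **Theorem.** Suppose that $K$ is weakly locally homologically seemly, let $c\in\{1,s\}$, let $\mathbf w\in\Omega(\varepsilon,f_c,g_c)$, and assume $c(\varepsilon'+\varepsilon)<\mathrm{conv}(P)$, where $\varepsilon'=\alpha^l_{K^{\mathbf w}}(g_c(0,\varepsilon))$. Denote $\beta=g_c(\varepsilon',\varepsilon)$ and $\gamma=f_c(0,\varepsilon)+f_c(\varepsilon',\varepsilon)$. Take any $(R',r')\in\Delta_{K^{\mathbf w}}(\varepsilon',\beta,\bar\delta_{K^{\mathbf w}}(\varepsilon',\beta)+\gamma)$ and let $R=R'-g_1(0,\varepsilon)$, $r=r'+g_c(\varepsilon',\varepsilon)$. Let $x\in K^{\mathbf w}$ and $p\in P$ be such that $d(x,p)<\varepsilon$ if the sample is not noise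 free, and $x$ is a point of $K$ closest to $p$ if it is. Then $\varepsilon\le\varepsilon'+\varepsilon$, $r\le R$, and for the inclusion induced maps $$\mathrm{im}\big(C(\varepsilon,R)\to C(\varepsilon'+\varepsilon,r)\big)\cong H(K,K-\{x\})\ \text{ if } c=1,\qquad \mathrm{im}\big(V(\varepsilon,R)\to V(\varepsilon'+\varepsilon,r)\big)\cong H(K,K-\{x\})\ \text{ if } c=s.$$ -/

import Mathlib

open CategoryTheory Limits Metric Set Filter Topology
open scoped ENNReal NNReal

universe u

noncomputable section

namespace LocalHomology

/-! ## Relative homology with integer coefficients -/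

/-- The group `ℤ`, as an object of the category of `ℤ`-modules in universe `u`. -/
abbrev coeffZ : ModuleCat.{u} ℤ := ModuleCat.of ℤ (ULift.{u} ℤ)

/-- Relative homology of a pair of topological spaces: the homology of the quotient of singular
chain complexes. -/
def singularRel (l : ℕ) : Arrow TopCat.{u} ⥤ ModuleCat.{u} ℤ :=
  ((AlgebraicTopology.singularChainComplexFunctor (ModuleCat.{u} ℤ)).obj coeffZ).mapArrow ⋙
    coker _ ⋙ HomologicalComplex.homologyFunctor _ _ l

/-- Relative homology of a pair of simplicial sets: the homology of the quotient of the simplicial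
chain complexes. -/
def simplicialRel (l : ℕ) : Arrow SSet.{u} ⥤ ModuleCat.{u} ℤ :=
  ((SSet.chainComplexFunctor (ModuleCat.{u} ℤ)).obj coeffZ).mapArrow ⋙
    coker _ ⋙ HomologicalComplex.homologyFunctor _ _ l

section Pairs

variable {X : Type u} [TopologicalSpace X]

/-- The inclusion of one subspace in another. -/
def inclTop {A B : Set X} (h : A ⊆ B) : TopCat.of A ⟶ TopCat.of B :=
  TopCat.ofHom ⟨Set.inclusion h, continuous_inclusion h⟩

/-- The pair `(Y, Y - U)` of subspaces of `X`. -/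
def pair (Y U : Set X) : Arrow TopCat.{u} :=
  Arrow.mk (inclTop (sdiff_subset : Y \ U ⊆ Y))

/-- The inclusion `(Y, Y - U) ⟶ (Y', Y' - U')`, for `Y ⊆ Y'` and `U' ⊆ U`. -/
def pairIncl {Y Y' U U' : Set X} (hY : Y ⊆ Y') (hU : U' ⊆ U) : pair Y U ⟶ pair Y' U' :=
  Arrow.homMk (u := inclTop (sdiff_subset_sdiff hY hU)) (v := inclTop hY) rfl

/-- `H_l(Y, Y - U)`. -/
abbrev HRel (l : ℕ) (Y U : Set X) : ModuleCat.{u} ℤ := (singularRel l).obj (pair Y U)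

/-- The inclusion induced homomorphism `H_l(Y, Y - U) ⟶ H_l(Y', Y' - U')`. -/
abbrev HRelMap (l : ℕ) {Y Y' U U' : Set X} (hY : Y ⊆ Y') (hU : U' ⊆ U) :
    HRel l Y U ⟶ HRel l Y' U' :=
  (singularRel l).map (pairIncl hY hU)

end Pairs

section Simplicial

variable {V : Type u}

open Classical in
/-- The simplicial set of an abstract simplicial complex: its `n`-simplices are all the ordered
tuples `(v₀, …, vₙ)` (repetitions allowed) whose vertices span a simplex of the complex. Its
chain complex is the ordered simplicial chain complex. -/
def orderedSSet (C : PreAbstractSimplicialComplex V) : SSet.{u} where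
  obj n := { f : Fin (n.unop.len + 1) → V // Finset.univ.image f ∈ C.faces }
  map θ := ↾fun f => ⟨fun i => f.1 (θ.unop.toOrderHom i),
    (C.isRelLowerSet_faces f.2).2 (by
      intro v hv
      simp only [Finset.mem_image, Finset.mem_univ, true_and] at hv ⊢
      obtain ⟨i, rfl⟩ := hv
      exact ⟨_, rfl⟩) (by simp)⟩

/-- The inclusion of the simplicial set of a subcomplex. -/
def orderedIncl {C D : PreAbstractSimplicialComplex V} (h : C ≤ D) :
    orderedSSet C ⟶ orderedSSet D where
  app n := ↾fun f => ⟨f.1, h f.2⟩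

/-- `H_l(C, C₀)` for a subcomplex `C₀` of an abstract simplicial complex `C`. -/
abbrev simplicialH (l : ℕ) {C₀ C : PreAbstractSimplicialComplex V} (h : C₀ ≤ C) :
    ModuleCat.{u} ℤ :=
  (simplicialRel l).obj (Arrow.mk (orderedIncl h))

/-- The homomorphism `H_l(C, C₀) ⟶ H_l(D, D₀)` induced by inclusions `C ≤ D` and `C₀ ≤ D₀`. -/
abbrev simplicialHMap (l : ℕ) {C₀ C D₀ D : PreAbstractSimplicialComplex V} (hC : C₀ ≤ C)
    (hD : D₀ ≤ D) (h₀ : C₀ ≤ D₀) (h : C ≤ D) : simplicialH l hC ⟶ simplicialH l hD :=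
  (simplicialRel l).map (Arrow.homMk (u := orderedIncl h₀) (v := orderedIncl h) rfl)

end Simplicial

/-! ## Čech and Vietoris-Rips complexes -/

section Complexes

variable {X : Type u} [MetricSpace X]

/-- The Čech complex at scale `a` over `Q`. -/
def cech (a : ℝ) (Q : Set X) : PreAbstractSimplicialComplex X where
  faces := { σ | σ.Nonempty ∧ (σ : Set X) ⊆ Q ∧ (⋂ x ∈ σ, closedBall x a).Nonempty }
  isRelLowerSet_faces := by
    rintro σ ⟨hne, hQ, z, hz⟩
    refine ⟨hne, fun τ hτ hτne => ⟨hτne, fun x hx => hQ (hτ hx), z, ?_⟩⟩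
    simp only [mem_iInter] at hz ⊢
    exact fun x hx => hz x (hτ hx)

open Classical in
/-- The Vietoris-Rips complex at scale `a` over `Q`: the simplices all of whose edges (and
vertices) are in the Čech complex at scale `a`. -/
def rips (a : ℝ) (Q : Set X) : PreAbstractSimplicialComplex X where
  faces := { σ | σ.Nonempty ∧ (σ : Set X) ⊆ Q ∧ ∀ x ∈ σ, ∀ y ∈ σ, {x, y} ∈ (cech a Q).faces }
  isRelLowerSet_faces := by
    rintro σ ⟨hne, hQ, hσ⟩
    exact ⟨hne, fun τ hτ hτne => ⟨hτne, fun x hx => hQ (hτ hx),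
      fun x hx y hy => hσ x (hτ hx) y (hτ hy)⟩⟩

/-- The two kinds of simplicial complexes that are used for recovery. -/
inductive ComplexKind
  | cech
  | rips

/-- The complex of the given kind at scale `a` over `Q`. -/
def ComplexKind.complex (k : ComplexKind) (a : ℝ) (Q : Set X) : PreAbstractSimplicialComplex X :=
  match k with
  | .cech => LocalHomology.cech a Q
  | .rips => LocalHomology.rips a Q

theorem cech_mono {a a' : ℝ} {Q Q' : Set X} (ha : a ≤ a') (hQ : Q ⊆ Q') :
    LocalHomology.cech a Q ≤ LocalHomology.cech a' Q' := by
  rintro σ ⟨hne, h, z, hz⟩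
  refine ⟨hne, h.trans hQ, z, ?_⟩
  simp only [mem_iInter] at hz ⊢
  exact fun x hx => closedBall_subset_closedBall ha (hz x hx)

theorem ComplexKind.complex_mono (k : ComplexKind) {a a' : ℝ} {Q Q' : Set X} (ha : a ≤ a')
    (hQ : Q ⊆ Q') : k.complex a Q ≤ k.complex a' Q' := by
  cases k
  · exact cech_mono ha hQ
  · rintro σ ⟨hne, h, hσ⟩
    exact ⟨hne, h.trans hQ, fun x hx y hy => cech_mono ha hQ (hσ x hx y hy)⟩

/-- `H_l(L_a(P), L_a(P - B_b(p)))`, where `L` is the Čech or the Vietoris-Rips complex. -/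
abbrev complexH (k : ComplexKind) (l : ℕ) (P : Set X) (p : X) (a b : ℝ) : ModuleCat.{u} ℤ :=
  simplicialH l (k.complex_mono (le_refl a) (sdiff_subset : P \ ball p b ⊆ P))

/-- The inclusion induced homomorphism
`H_l(L_a(P), L_a(P - B_b(p))) ⟶ H_l(L_a'(P), L_a'(P - B_b'(p)))`, for `a ≤ a'` and `b' ≤ b`. -/
abbrev complexHMap (k : ComplexKind) (l : ℕ) (P : Set X) (p : X) {a b a' b' : ℝ}
    (ha : a ≤ a') (hb : b' ≤ b) : complexH k l P p a b ⟶ complexH k l P p a' b' :=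
  simplicialHMap l _ _
    (k.complex_mono ha (sdiff_subset_sdiff_right (ball_subset_ball hb)))
    (k.complex_mono ha subset_rfl)

end Complexes

/-! ## The ambient space -/

section Ambient

variable {X : Type u} [MetricSpace X]

/-- `γ`, restricted to `[0,1]`, is a shortest path from `x` to `y`, parametrized proportionally to
arc length. (In a complete metric space with midpoints the length of a shortest path is the
distance of its end points.) -/
def IsShortestPath (γ : ℝ → X) (x y : X) : Prop :=
  γ 0 = x ∧ γ 1 = y ∧
    ∀ s ∈ Icc (0 : ℝ) 1, ∀ t ∈ Icc (0 : ℝ) 1, dist (γ s) (γ t) = |s - t| * dist x y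

/-- Any two points of `A` are connected by a unique shortest path, which lies in `A` and depends
continuously on the end points. -/
def StronglyConvex (A : Set X) : Prop :=
  ∃ Γ : X → X → ℝ → X,
    ContinuousOn (fun q : X × X × ℝ => Γ q.1 q.2.1 q.2.2) (A ×ˢ A ×ˢ Icc (0 : ℝ) 1) ∧
    ∀ x ∈ A, ∀ y ∈ A, IsShortestPath (Γ x y) x y ∧ (∀ t ∈ Icc (0 : ℝ) 1, Γ x y t ∈ A) ∧
      ∀ γ, IsShortestPath γ x y → ∀ t ∈ Icc (0 : ℝ) 1, γ t = Γ x y t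

variable (X) in
/-- All sufficiently small balls at any point are strongly convex. -/
def LocallyStronglyConvex : Prop :=
  ∀ x : X, ∃ d > 0, ∀ e ∈ Ioc 0 d, StronglyConvex (ball x e)

/-- The convexity radius at `x`: the supremum of all `d` such that the balls at `x` of radius at
most `d` are strongly convex. -/
def convRadius (x : X) : ℝ≥0∞ :=
  ⨆ (d : ℝ) (_ : ∀ e ∈ Ioc 0 d, StronglyConvex (ball x e)), ENNReal.ofReal d

/-- The convexity radius of a set. -/
def convRadiusSet (P : Set X) : ℝ≥0∞ := ⨅ p ∈ P, convRadius p

/-- `K` is a retract of one of its neighborhoods. -/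
def IsNeighborhoodRetract (K : Set X) : Prop :=
  ∃ U ∈ 𝓝ˢ K, ∃ π : X → X, ContinuousOn π U ∧ MapsTo π U K ∧ ∀ x ∈ K, π x = x

/-- `P` is a (noisy) `ε`-sample of `K`. -/
def IsSample (K P : Set X) (ε : ℝ) : Prop :=
  P.Finite ∧ hausdorffEDist K P < ENNReal.ofReal ε

open Classical in
/-- The constant `t`: `0` for a noise free sample, and `1` otherwise. -/
def noise (K P : Set X) : ℝ := if P ⊆ K then 0 else 1

/-- The point `x` of `K` corresponds to the sample point `p`: it is a closest point to `p` if the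
sample is noise free, and is at distance less than `ε` from `p` otherwise. -/
def Corresponds (K P : Set X) (ε : ℝ) (x p : X) : Prop :=
  (P ⊆ K → ∀ z ∈ K, dist p x ≤ dist p z) ∧ (¬ P ⊆ K → dist x p < ε)

variable (X) in
/-- `X` is (isometric to) a Euclidean space. -/
def IsEuclidean : Prop := ∃ n : ℕ, Nonempty (X ≃ᵢ EuclideanSpace ℝ (Fin n))

variable (X) in
open Classical in
/-- The constant `s`. -/
def ripsConst : ℝ := if IsEuclidean X then √2 else 2

variable (X) in
/-- The constant `c`: `1` for Čech complexes, and `s` for Vietoris-Rips complexes. -/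
def ComplexKind.const (k : ComplexKind) : ℝ :=
  match k with
  | .cech => 1
  | .rips => ripsConst X

end Ambient

/-- `g_c(a,b) = ca + (c+t)b`. -/
def gFun (t c a b : ℝ) : ℝ := c * a + (c + t) * b

/-- `f_c(a,b) = g_c(a,b) + g_1(a,b)`. -/
def fFun (t c a b : ℝ) : ℝ := gFun t c a b + gFun t 1 a b

/-! ## Stratifications -/

section Strat

variable {X : Type u} [MetricSpace X]

/-- `S` is a stratification of `K`. -/
structure IsStratification (K : Set X) (S : Set (Set X)) : Prop where
  locallyFinite : LocallyFinite (fun Y : S => (Y : Set X))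
  pairwiseDisjoint : S.PairwiseDisjoint id
  locallyClosed : ∀ Y ∈ S, IsLocallyClosed Y
  sUnion_eq : ⋃₀ S = K
  frontier_condition : ∀ Y ∈ S, ∀ Z ∈ S, (Y ∩ closure Z).Nonempty → Y ⊆ closure Z

/-- `Y` is a finite dimensional homology manifold. -/
def IsHomologyManifold (Y : Set X) : Prop :=
  ∃ d : ℕ, ∀ x ∈ Y, Nonempty (HRel d Y {x} ≃ₗ[ℤ] ℤ) ∧ ∀ l, l ≠ d → Subsingleton (HRel l Y {x})

/-- `S` is a (tame) homology stratification of `K`. -/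
structure IsHomologyStratification (K : Set X) (S : Set (Set X)) : Prop
    extends IsStratification K S where
  homologyManifold : ∀ Y ∈ S, IsHomologyManifold Y
  locally_constant : ∀ Y ∈ S, ∀ x ∈ Y, ∃ r₀ > 0, ∀ r, (hr : r ∈ Ioo 0 r₀) → ∀ l,
    IsIso (HRelMap l (subset_refl K) (singleton_subset_iff.2 (mem_ball_self hr.1) :
      {x} ⊆ ball x r)) ∧
    ∀ y ∈ ball x r ∩ Y, ∀ ρ, (hρ : ρ ∈ Ioo 0 (r - dist x y)) →
      IsIso (HRelMap l (subset_refl K) (ball_subset_ball' (by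
        have := hρ.2; rw [dist_comm] at this; linarith) : ball y ρ ⊆ ball x r)) ∧
      IsIso (HRelMap l (subset_refl K) (singleton_subset_iff.2 (mem_ball_self hρ.1) :
        {y} ⊆ ball y ρ))
  finite_generation : ∀ x ∈ K, ∀ l, Module.Finite ℤ (HRel l K {x})

/-- The strata of `S`, ordered by `Y ≤ Z` if `Y ⊆ closure Z`. -/
def Stratum (S : Set (Set X)) : Type u := { Y : Set X // Y ∈ S }

instance (S : Set (Set X)) : Preorder (Stratum S) where
  le Y Z := Y.1 ⊆ closure Z.1
  le_refl _ := subset_closure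
  le_trans _ _ _ h h' := h.trans (closure_minimal h' isClosed_closure)

/-- The height of a stratum: one less than the size of the longest chain of strata with this
maximal element. -/
def stratumHeight {S : Set (Set X)} (Y : Stratum S) : ℕ∞ := Order.height Y

/-- The strata whose height is not maximal. -/
def LowerStratum (S : Set (Set X)) : Type u :=
  { Y : Stratum S // ∃ Z : Stratum S, stratumHeight Y < stratumHeight Z }

/-- The set `K^w`, the union over all strata `Y` of the sets
`Y^w = Y - ⋃ B_{w_Z}(Z)`, where `Z` runs over the strata of height less than that of `Y`. -/
def shrunk (S : Set (Set X)) (w : LowerStratum S → ℝ≥0) : Set X :=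
  ⋃ Y : Stratum S, Y.1 \
    ⋃ (Z : LowerStratum S) (_ : stratumHeight Z.1 < stratumHeight Y), thickening (w Z) Z.1.1

/-- The set `Y^w = Y - B_w(∂Y)`, where `∂Y = closure Y - Y`. -/
def awayFromBoundary (Y : Set X) (w : ℝ) : Set X := Y \ thickening w (closure Y \ Y)

end Strat

/-! ## Whitney stratifications -/

section Whitney

open scoped Bundle Manifold ContDiff

variable (X : Type u) [MetricSpace X]

/-- The structure of a smooth Riemannian manifold on `X` that induces the given metric. -/
structure RiemannianStructure where
  dim : ℕ
  charted : ChartedSpace (EuclideanSpace ℝ (Fin dim)) X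
  smooth : IsManifold (𝓡 dim) ∞ X
  bundle : Bundle.RiemannianBundle (fun x : X => TangentSpace (𝓡 dim) x)
  smooth_metric : IsContMDiffRiemannianBundle (𝓡 dim) ∞ (EuclideanSpace ℝ (Fin dim))
    (fun x : X => TangentSpace (𝓡 dim) x)
  isRiemannian : IsRiemannianManifold (𝓡 dim) X

variable {X}

namespace RiemannianStructure

variable (M : RiemannianStructure X)

/-- `Y` is a smooth embedded submanifold of dimension `d`. -/
def IsSubmanifold (d : ℕ) (Y : Set X) : Prop :=
  letI := M.charted
  ∀ x ∈ Y, ∃ φ ∈ IsManifold.maximalAtlas (𝓡 M.dim) ∞ X, x ∈ φ.source ∧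
    ∃ L : Submodule ℝ (EuclideanSpace ℝ (Fin M.dim)), Module.finrank ℝ L = d ∧
      φ '' (Y ∩ φ.source) = φ.target ∩ { v | v - φ x ∈ L }

/-- The tangent space at `x` of a submanifold `Y`, read in the preferred chart at `y`. (The tangent
cone of a submanifold of a Euclidean space is its tangent space.) -/
def tangent (y : X) (Y : Set X) (x : X) : Submodule ℝ (EuclideanSpace ℝ (Fin M.dim)) :=
  letI := M.charted
  let φ := chartAt (EuclideanSpace ℝ (Fin M.dim)) y
  Submodule.span ℝ (tangentConeAt ℝ (φ '' (Y ∩ φ.source)) (φ x))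

/-- `Y` and `Z` are submanifolds that intersect transversally. -/
def Transverse (Y Z : Set X) : Prop :=
  (∃ d, M.IsSubmanifold d Y) ∧ (∃ d, M.IsSubmanifold d Z) ∧
    ∀ x ∈ Y ∩ Z, M.tangent x Y x ⊔ M.tangent x Z x = ⊤

/-- Every element of the stratification `S` is a smooth submanifold, and Whitney's conditions hold
for all pairs of strata. Convergence of subspaces is convergence of orthogonal projections. -/
def IsWhitney (S : Set (Set X)) : Prop :=
  letI := M.charted
  (∀ Y ∈ S, ∃ d, M.IsSubmanifold d Y) ∧
  ∀ Y ∈ S, ∀ Z ∈ S, Y ≠ Z → Y ⊆ closure Z → ∀ y ∈ Y, ∀ (a b : ℕ → X),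
    (∀ i, a i ∈ Z) → (∀ i, b i ∈ Y) → Tendsto a atTop (𝓝 y) → Tendsto b atTop (𝓝 y) →
    ∀ T L : Submodule ℝ (EuclideanSpace ℝ (Fin M.dim)),
      Tendsto (fun i => (M.tangent y Z (a i)).starProjection) atTop (𝓝 T.starProjection) →
      Tendsto (fun i => (Submodule.span ℝ
        {chartAt (EuclideanSpace ℝ (Fin M.dim)) y (a i) -
          chartAt (EuclideanSpace ℝ (Fin M.dim)) y (b i)}).starProjection)
        atTop (𝓝 L.starProjection) →
      M.tangent y Y y ≤ T ∧ L ≤ T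

end RiemannianStructure

end Whitney

/-! ## Seemliness -/

section Seemly

variable {X : Type u} [MetricSpace X]

/-- A topological space homeomorphic to a closed ball of a Euclidean space. -/
def IsTopologicalBall (D : Set X) : Prop :=
  ∃ n : ℕ, Nonempty (D ≃ₜ closedBall (0 : EuclideanSpace ℝ (Fin n)) 1)

/-- The homological condition on the scales `(R, r, α)`. With `D_a` the closed `a`-neighborhood of
`K` and `F(a,b) = H(D_a, D_a - B_b(x))`, the maps `F(0,R) → F(0,ρ) → F(0,0) = H(K, K - {x})` are
isomorphisms for `ρ ∈ (0,R]`, and for `i : F(0,R) → F(ε,R)` and `j : F(ε,R) → F(α,r)` the map `j i`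
is an isomorphism onto the image of `j`. -/
def HomologicalCondition (K : Set X) (x : X) (ε R r α : ℝ) : Prop :=
  (∀ ρ, (hρ : ρ ∈ Ioc 0 R) → ∀ l,
    IsIso (HRelMap l (subset_refl K) (ball_subset_ball hρ.2 : ball x ρ ⊆ ball x R)) ∧
    IsIso (HRelMap l (subset_refl K)
      (singleton_subset_iff.2 (mem_ball_self hρ.1) : {x} ⊆ ball x ρ))) ∧
  ∃ (hα : ε ≤ α) (hr : r ≤ R), ∀ l,
    let i := HRelMap l (self_subset_cthickening K : K ⊆ cthickening ε K) (subset_refl (ball x R))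
    let j := HRelMap l (cthickening_mono hα K) (ball_subset_ball hr : ball x r ⊆ ball x R)
    Function.Injective (i ≫ j).hom ∧ LinearMap.range (i ≫ j).hom = LinearMap.range j.hom

/-- The set `A_L(ε)` of triples `(R, r, α)`, the intersection of `A_x(ε)` over `x ∈ L`; for
`L = {x}` this is `A_x(ε)`. The condition on spheres is only present if `S` is a Whitney
stratification. -/
def scales (K : Set X) (S : Set (Set X)) (L : Set X) (ε : ℝ) : Set (ℝ × ℝ × ℝ) :=
  { q | q.2.1 ≤ q.1 ∧ q.2.2 < q.2.1 ∧ ε ≤ q.2.2 ∧ ∀ x ∈ L,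
      (∀ ρ ∈ Ioc 0 q.1, IsTopologicalBall (closedBall x ρ)) ∧
      (∀ M : RiemannianStructure X, M.IsWhitney S →
        ∀ ρ ∈ Ioc 0 q.1, ∀ Y ∈ S, M.Transverse (sphere x ρ) Y) ∧
      HomologicalCondition K x ε q.1 q.2.1 q.2.2 }

/-- The section `{(R, r) | (R, r, α) ∈ A}`. -/
def alphaSection (A : Set (ℝ × ℝ × ℝ)) (α : ℝ) : Set (ℝ × ℝ) := { q | (q.1, q.2, α) ∈ A }

/-- Scale functions that witness weak seemliness of a family `A(ε)`, `ε ≥ 0`. -/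
structure SeemlyData (A : ℝ → Set (ℝ × ℝ × ℝ)) where
  bound : ℝ
  lower : ℝ → ℝ
  upper : ℝ → ℝ
  bound_pos : 0 < bound
  lower_le_upper : ∀ ε ∈ Icc 0 bound, lower ε ≤ upper ε
  lower_mono : MonotoneOn lower (Icc 0 bound)
  upper_anti : AntitoneOn upper (Icc 0 bound)
  lower_zero : lower 0 = 0
  lower_tendsto : Tendsto lower (𝓝[>] 0) (𝓝 0)
  upper_tendsto : Tendsto upper (𝓝[>] 0) (𝓝 (upper 0))
  nonempty : ∀ ε ∈ Icc 0 bound, ∀ α ∈ Icc (lower ε) (upper ε), (alphaSection (A ε) α).Nonempty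
  dist_tendsto : Tendsto (fun ε => ⨆ α ∈ Icc (lower ε) (upper ε),
    hausdorffEDist (alphaSection (A 0) α) (alphaSection (A ε) α)) (𝓝[>] 0) (𝓝 0)

/-- The family `A(ε)`, `ε ≥ 0`, is weakly seemly. -/
def WeaklySeemly (A : ℝ → Set (ℝ × ℝ × ℝ)) : Prop := Nonempty (SeemlyData A)

/-- `K` is weakly locally homologically seemly. -/
def WeaklyLocallySeemly (K : Set X) (S : Set (Set X)) : Prop :=
  ∀ Y ∈ S, ∃ w₀ > 0, ∀ w ∈ Ioo 0 w₀, WeaklySeemly (scales K S (awayFromBoundary Y w))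

namespace SeemlyData

variable {A : ℝ → Set (ℝ × ℝ × ℝ)} (D : SeemlyData A)

/-- The intersection `A([0,ε] | α ≤ β)` of the sections of `A(ε')` at all
`α ∈ [α^l(ε'), β]`, for all `ε' ∈ [0,ε]`. -/
def slab (ε β : ℝ) : Set (ℝ × ℝ) :=
  { q | ∀ ε' ∈ Icc 0 ε, ∀ α ∈ Icc (D.lower ε') β, q ∈ alphaSection (A ε') α }

/-- The supremum of the larger local scales. -/
def Rbar (ε β : ℝ) : EReal := ⨆ q ∈ D.slab ε β, (q.1 : EReal)

/-- The infimum of the smaller local scales. -/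
def rbar (ε β : ℝ) : EReal := ⨅ q ∈ D.slab ε β, (q.2 : EReal)

/-- The interior of the right isosceles triangle with vertices `(r̄ + δ, r̄)`, `(R̄, r̄)`,
`(R̄, R̄ - δ)`; it is empty if `r̄ + δ ≥ R̄`. -/
def triangle (ε β : ℝ) (δ : EReal) : Set (ℝ × ℝ) :=
  { q | D.rbar ε β < q.2 ∧ (q.1 : EReal) < D.Rbar ε β ∧ (q.2 : EReal) + δ < q.1 }

/-- The gap `δ̄(ε,β)`. -/
def gap (ε β : ℝ) : EReal :=
  sInf { δ | ∃ d : ℝ, 0 < d ∧ δ = d ∧ D.triangle ε β d ⊆ D.slab ε β }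

/-- `τ(ε,β) = R̄(ε,β) - r̄(ε,β) - δ̄(ε,β)`. -/
def tau (ε β : ℝ) : EReal := D.Rbar ε β - D.rbar ε β - D.gap ε β

/-- The set `E(f,g)`. The functions `α^l` are used on their domain only. -/
def goodScales (f g : ℝ → ℝ → ℝ) : Set ℝ :=
  { ε | 0 ≤ ε ∧ g 0 ε ∈ Icc 0 D.bound ∧ D.lower (g 0 ε) ∈ Icc 0 D.bound ∧
      let ε' := D.lower (g 0 ε)
      ((f 0 ε + f ε' ε : ℝ) : EReal) < D.tau ε' (g ε' ε) }

end SeemlyData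

/-- A choice of the scale functions for all those `w` for which the family `A_{K^w}(ε)` is weakly
seemly. -/
def ScaleChoice (K : Set X) (S : Set (Set X)) : Type u :=
  ∀ w : LowerStratum S → ℝ≥0, WeaklySeemly (scales K S (shrunk S w)) →
    SeemlyData (scales K S (shrunk S w))

/-- The set `Ω(ε,f,g)` of those `w` for which `ε ∈ E_{K^w}(f,g)`. -/
def Omega {K : Set X} {S : Set (Set X)} (choice : ScaleChoice K S) (ε : ℝ) (f g : ℝ → ℝ → ℝ) :
    Set (LowerStratum S → ℝ≥0) :=
  { w | ∃ h : WeaklySeemly (scales K S (shrunk S w)), ε ∈ (choice w h).goodScales f g }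

/-- The scale functions chosen for `w ∈ Ω(ε,f,g)`. -/
def scaleData {K : Set X} {S : Set (Set X)} (choice : ScaleChoice K S) {ε : ℝ}
    {f g : ℝ → ℝ → ℝ} {w : LowerStratum S → ℝ≥0} (hw : w ∈ Omega choice ε f g) :
    SeemlyData (scales K S (shrunk S w)) :=
  choice w (Exists.fst hw)

end Seemly

end LocalHomology

end

/-! The image in question is trapped between relative homology groups of subspaces. Let `A` be the
pair (K, K - B_{R'}(x)). Let `F₁`, `F₂`, `F₃` be the pairs (D, D - B), where D is the closed
neighborhood of K of radius g_c(0,ε), ε', β, and B is the ball at x of radius R' - f_c(0,ε), r' +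
f_c(ε',ε), r', respectively. Let `L₁` → `L₂` be the inclusion of the two pairs of simplicial
complexes. The balls of radius ε about P cover K and those of radius ε' + ε cover D_{ε'}(K).
Enlarged by the factor c they stay in the neighborhoods of `F₁` and `F₃`. The losses in the radii
pay for the ball radii and for d(x,p).

In homology this gives maps A → L₁ → F₁ → F₂ → L₂ → F₃. The part from `L₁` to `L₂` is the inclusion
of complexes; the part from `A` to `F₂` and the part from `F₂` to `F₃` are inclusions of subspaces
(`exists_injective_range_eq`). Seemliness at scale 0 makes A → F₃ injective, so A → L₂ is injective.
Seemliness at scale g_c(0,ε) says that `F₁` and `A` have the same image in `F₂`, so `L₁` and `A`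
have the same image in `L₂`. Hence the image of L₁ → L₂ is the homology of `A`, which is H(K, K -
{x}).

The comparison of complexes and subspaces is a nerve theorem for pairs, proved on chains. Cells (σ,
s) pair an ordered simplex σ with a singular simplex s, both possibly empty, and span the tensor
product of the two augmented chain complexes. The subcomplex `coverSet`, in which s lies in the
balls centered at σ, is a double mapping cylinder: one edge (s empty) is the Čech complex, the other
(σ empty) consists of the singular simplices inside single balls. Each edge is a deformation
retract. Adding to σ the center of a ball that contains s pushes everything onto the first edge,
without any convexity (`HHmap_nerve_bijective`). Coning s along shortest paths in the convex
intersection of balls pushes everything onto the second (`HHmap_small_bijective`). Both arguments,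
and barycentric subdivision (`HHmap_fine_bijective`), are instances of `HHmap_bijective_of_deform`:
iterating 1 - dK - Kd carries every chain into a subcomplex. Vietoris–Rips complexes are squeezed
between Čech complexes by a weak form of Jung's theorem (`exists_sq_dist_le`). -/

noncomputable section

namespace LocalHomology

/-! ## Relative homology of based chain complexes

The free abelian group on a set `B` of cells carries a grading `deg` and a differential `d`. All
the groups below are relative homology groups of pairs spanned by sets of cells, and all the maps
between them are induced by inclusions. The cells of degree `0` are augmentation cells. -/

section BasedHomology

/-- The linear map `f` maps chains on `s` to chains on `s`. -/
def Stable {B : Type u} (f : (B →₀ ℤ) →ₗ[ℤ] (B →₀ ℤ)) (s : Set B) : Prop :=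
  ∀ c ∈ Finsupp.supported ℤ ℤ s, f c ∈ Finsupp.supported ℤ ℤ s

/-- A linear map sends chains on `s` into a submodule if it does so for all cells of `s`. -/
theorem map_supported {B N : Type*} [AddCommGroup N] (f : (B →₀ ℤ) →ₗ[ℤ] N)
    {s : Set B} {V : Submodule ℤ N} (h : ∀ b ∈ s, f (Finsupp.single b 1) ∈ V)
    {c : B →₀ ℤ} (hc : c ∈ Finsupp.supported ℤ ℤ s) : f c ∈ V := by
  rw [Finsupp.supported_eq_span_single] at hc
  refine (Submodule.span_le (p := V.comap f)).2 ?_ hc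
  rintro _ ⟨b, hb, rfl⟩
  exact h b hb

theorem single_mem_supported {B : Type*} {s : Set B} {b : B} (hb : b ∈ s) (n : ℤ) :
    Finsupp.single b n ∈ Finsupp.supported ℤ ℤ s :=
  Finsupp.single_mem_supported ℤ n hb

theorem mem_supported_inter {B : Type*} {s t : Set B} {c : B →₀ ℤ} :
    c ∈ Finsupp.supported ℤ ℤ (s ∩ t) ↔
      c ∈ Finsupp.supported ℤ ℤ s ∧ c ∈ Finsupp.supported ℤ ℤ t := by
  rw [Finsupp.supported_inter, Submodule.mem_inf]

theorem supported_mono' {B : Type*} {s t : Set B} (h : s ⊆ t) {c : B →₀ ℤ}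
    (hc : c ∈ Finsupp.supported ℤ ℤ s) : c ∈ Finsupp.supported ℤ ℤ t :=
  Finsupp.supported_mono h hc

theorem Stable.of_single {B : Type u} {f : (B →₀ ℤ) →ₗ[ℤ] (B →₀ ℤ)} {s : Set B}
    (h : ∀ b ∈ s, f (Finsupp.single b 1) ∈ Finsupp.supported ℤ ℤ s) : Stable f s :=
  fun _ hc => map_supported f h hc

theorem Stable.inter {B : Type u} {f : (B →₀ ℤ) →ₗ[ℤ] (B →₀ ℤ)} {s t : Set B} (hs : Stable f s)
    (ht : Stable f t) : Stable f (s ∩ t) := fun c hc => by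
  rw [mem_supported_inter] at hc ⊢
  exact ⟨hs c hc.1, ht c hc.2⟩

variable {B : Type u} (deg : B → ℕ) (d : (B →₀ ℤ) →ₗ[ℤ] (B →₀ ℤ))

/-- The relative cycles of the pair spanned by `s` and `s₀`. -/
def relCycles (l : ℕ) (s s₀ : Set B) : Submodule ℤ (B →₀ ℤ) :=
  -- The degree counts vertices, so dimension `l` corresponds to degree `l + 1`.
  Finsupp.supported ℤ ℤ (s ∩ {b | deg b = l + 1}) ⊓ (Finsupp.supported ℤ ℤ s₀).comap d

/-- The relative boundaries of the pair spanned by `s` and `s₀`. -/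
def relBoundaries (l : ℕ) (s s₀ : Set B) : Submodule ℤ (B →₀ ℤ) :=
  (Finsupp.supported ℤ ℤ (s ∩ {b | deg b = l + 2})).map d ⊔
    Finsupp.supported ℤ ℤ (s₀ ∩ {b | deg b = l + 1})

/-- The relative homology of the pair spanned by `s` and `s₀`. -/
abbrev HH (l : ℕ) (s s₀ : Set B) : Type u :=
  relCycles deg d l s s₀ ⧸ (relBoundaries deg d l s s₀).submoduleOf (relCycles deg d l s s₀)

variable {deg d} {l : ℕ} {s s₀ s' s₀' s'' s₀'' : Set B}

theorem relCycles_mono (h : s ⊆ s') (h₀ : s₀ ⊆ s₀') :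
    relCycles deg d l s s₀ ≤ relCycles deg d l s' s₀' :=
  inf_le_inf (Finsupp.supported_mono (inter_subset_inter_left _ h))
    (Submodule.comap_mono (Finsupp.supported_mono h₀))

theorem relBoundaries_mono (h : s ⊆ s') (h₀ : s₀ ⊆ s₀') :
    relBoundaries deg d l s s₀ ≤ relBoundaries deg d l s' s₀' :=
  sup_le_sup (Submodule.map_mono (Finsupp.supported_mono (inter_subset_inter_left _ h)))
    (Finsupp.supported_mono (inter_subset_inter_left _ h₀))

variable (deg d l) in
/-- The map in homology induced by an inclusion of pairs. -/
def HHmap (h : s ⊆ s') (h₀ : s₀ ⊆ s₀') : HH deg d l s s₀ →ₗ[ℤ] HH deg d l s' s₀' :=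
  Submodule.mapQ _ _ (Submodule.inclusion (relCycles_mono h h₀))
    (fun _ hc => relBoundaries_mono h h₀ hc)

/-- The class of a relative cycle. -/
def HHmk (c : B →₀ ℤ) (hc : c ∈ relCycles deg d l s s₀) : HH deg d l s s₀ :=
  Submodule.Quotient.mk ⟨c, hc⟩

theorem HHmk_surjective (z : HH deg d l s s₀) : ∃ c hc, HHmk c hc = z := by
  obtain ⟨⟨c, hc⟩, rfl⟩ := Submodule.Quotient.mk_surjective _ z
  exact ⟨c, hc, rfl⟩

theorem HHmk_eq_iff {c c' : B →₀ ℤ} (hc : c ∈ relCycles deg d l s s₀)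
    (hc' : c' ∈ relCycles deg d l s s₀) :
    HHmk c hc = HHmk c' hc' ↔ c - c' ∈ relBoundaries deg d l s s₀ :=
  Submodule.Quotient.eq _

theorem HHmk_eq_zero_iff {c : B →₀ ℤ} (hc : c ∈ relCycles deg d l s s₀) :
    HHmk c hc = 0 ↔ c ∈ relBoundaries deg d l s s₀ :=
  Submodule.Quotient.mk_eq_zero _

@[simp]
theorem HHmap_mk (h : s ⊆ s') (h₀ : s₀ ⊆ s₀') {c : B →₀ ℤ} (hc : c ∈ relCycles deg d l s s₀) :
    HHmap deg d l h h₀ (HHmk c hc) = HHmk c (relCycles_mono h h₀ hc) := rfl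

theorem HHmap_HHmap (h : s ⊆ s') (h₀ : s₀ ⊆ s₀') (h' : s' ⊆ s'') (h₀' : s₀' ⊆ s₀'')
    (z : HH deg d l s s₀) :
    HHmap deg d l h' h₀' (HHmap deg d l h h₀ z) =
      HHmap deg d l (h.trans h') (h₀.trans h₀') z := by
  obtain ⟨c, hc, rfl⟩ := HHmk_surjective z
  rfl

/-! ### Deformation onto a subcomplex -/

variable (d) in
/-- The chain map `1 - dK - Kd`, which is homotopic to the identity. -/
def deform (K : (B →₀ ℤ) →ₗ[ℤ] (B →₀ ℤ)) : (B →₀ ℤ) →ₗ[ℤ] (B →₀ ℤ) :=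
  LinearMap.id - d ∘ₗ K - K ∘ₗ d

theorem deform_apply (K : (B →₀ ℤ) →ₗ[ℤ] (B →₀ ℤ)) (c : B →₀ ℤ) :
    deform d K c = c - d (K c) - K (d c) := rfl

variable (deg d) in
/-- The differential `d` squares to zero and has degree `-1`. -/
structure IsDifferential : Prop where
  sq_zero : ∀ c, d (d c) = 0
  degree : ∀ b, d (Finsupp.single b 1) ∈ Finsupp.supported ℤ ℤ {b' | deg b' + 1 = deg b}

variable (deg) in
/-- The map `K` has degree `1`. -/
def RaisesDegree (K : (B →₀ ℤ) →ₗ[ℤ] (B →₀ ℤ)) : Prop :=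
  ∀ b, K (Finsupp.single b 1) ∈ Finsupp.supported ℤ ℤ {b' | deg b' = deg b + 1}

variable {K : (B →₀ ℤ) →ₗ[ℤ] (B →₀ ℤ)}

theorem IsDifferential.map_degree (hd : IsDifferential deg d) {n : ℕ} {c : B →₀ ℤ}
    (hc : c ∈ Finsupp.supported ℤ ℤ {b | deg b = n}) :
    d c ∈ Finsupp.supported ℤ ℤ {b | deg b + 1 = n} :=
  map_supported d (fun b hb => by
    have hb' : deg b = n := hb
    simpa only [hb'] using hd.degree b) hc

theorem RaisesDegree.map_degree (hK : RaisesDegree deg K) {n : ℕ} {c : B →₀ ℤ}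
    (hc : c ∈ Finsupp.supported ℤ ℤ {b | deg b = n}) :
    K c ∈ Finsupp.supported ℤ ℤ {b | deg b = n + 1} :=
  map_supported K (fun b hb => by
    have hb' : deg b = n := hb
    simpa only [hb'] using hK b) hc

theorem RaisesDegree.map_degree' (hK : RaisesDegree deg K) {n : ℕ} {c : B →₀ ℤ}
    (hc : c ∈ Finsupp.supported ℤ ℤ {b | deg b + 1 = n}) :
    K c ∈ Finsupp.supported ℤ ℤ {b | deg b = n} :=
  map_supported K (fun b hb => by
    have hb' : deg b + 1 = n := hb
    simpa only [hb'] using hK b) hc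

theorem IsDifferential.map_degree' (hd : IsDifferential deg d) {n : ℕ} {c : B →₀ ℤ}
    (hc : c ∈ Finsupp.supported ℤ ℤ {b | deg b = n + 1}) :
    d c ∈ Finsupp.supported ℤ ℤ {b | deg b = n} :=
  supported_mono' (fun _ hb => Nat.succ_injective hb) (hd.map_degree hc)

theorem d_deform (hd : IsDifferential deg d) (c : B →₀ ℤ) :
    d (deform d K c) = deform d K (d c) := by
  simp [deform_apply, hd.sq_zero]

theorem d_deform_pow (hd : IsDifferential deg d) (m : ℕ) (c : B →₀ ℤ) :
    d ((deform d K ^ m) c) = (deform d K ^ m) (d c) := by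
  induction m generalizing c with
  | zero => rfl
  | succ m ih => rw [pow_succ, Module.End.mul_apply, ih, d_deform hd, Module.End.mul_apply]

theorem Stable.deform (hs : Stable d s) (hK : Stable K s) : Stable (deform d K) s :=
  fun _ hc => sub_mem (sub_mem hc (hs _ (hK _ hc))) (hK _ (hs _ hc))

theorem Stable.pow {f : (B →₀ ℤ) →ₗ[ℤ] (B →₀ ℤ)} (hf : Stable f s) (m : ℕ) :
    Stable (f ^ m) s := by
  induction m with
  | zero => exact fun _ hc => hc
  | succ m ih =>
    intro _ hc
    rw [pow_succ, Module.End.mul_apply]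
    exact ih _ (hf _ hc)

theorem stable_deform_degree (hd : IsDifferential deg d) (hK : RaisesDegree deg K) (n : ℕ) :
    Stable (deform d K) {b | deg b = n} :=
  fun _ hc => sub_mem (sub_mem hc (hd.map_degree' (hK.map_degree hc)))
    (hK.map_degree' (hd.map_degree hc))

/-- The difference to the identity is dKc + Kdc up to sign. The first term bounds in `s`; the second
lies in `s₀` because dc does. -/
theorem deform_homotopic (hd : IsDifferential deg d) (hK : RaisesDegree deg K)
    (ds : Stable d s) (Ks : Stable K s) (ds₀ : Stable d s₀) (Ks₀ : Stable K s₀) {c : B →₀ ℤ}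
    (hc : c ∈ relCycles deg d l s s₀) :
    deform d K c ∈ relCycles deg d l s s₀ ∧ deform d K c - c ∈ relBoundaries deg d l s s₀ := by
  obtain ⟨hc, hc₀⟩ := hc
  rw [SetLike.mem_coe, mem_supported_inter] at hc
  refine ⟨⟨?_, ?_⟩, ?_⟩
  · rw [SetLike.mem_coe, mem_supported_inter]
    exact ⟨ds.deform Ks c hc.1, stable_deform_degree hd hK _ c hc.2⟩
  · change d _ ∈ Finsupp.supported ℤ ℤ _
    rw [d_deform hd]
    exact ds₀.deform Ks₀ _ hc₀
  · rw [deform_apply, show c - d (K c) - K (d c) - c = - (d (K c) + K (d c)) by abel]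
    refine neg_mem (add_mem (Submodule.mem_sup_left ⟨K c, ?_, rfl⟩) (Submodule.mem_sup_right ?_))
    · rw [SetLike.mem_coe, mem_supported_inter]
      exact ⟨Ks c hc.1, hK.map_degree hc.2⟩
    · rw [mem_supported_inter]
      exact ⟨Ks₀ _ hc₀, hK.map_degree' (hd.map_degree hc.2)⟩

theorem deform_pow_homotopic (hd : IsDifferential deg d) (hK : RaisesDegree deg K)
    (ds : Stable d s) (Ks : Stable K s) (ds₀ : Stable d s₀) (Ks₀ : Stable K s₀) (m : ℕ)
    {c : B →₀ ℤ} (hc : c ∈ relCycles deg d l s s₀) :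
    (deform d K ^ m) c ∈ relCycles deg d l s s₀ ∧
      (deform d K ^ m) c - c ∈ relBoundaries deg d l s s₀ := by
  induction m with
  | zero => exact ⟨hc, by simp⟩
  | succ m ih =>
    rw [pow_succ', Module.End.mul_apply]
    have := deform_homotopic hd hK ds Ks ds₀ Ks₀ ih.1
    exact ⟨this.1, by simpa using add_mem this.2 ih.2⟩

/-- If the deformation eventually moves every chain on `s` into `D`, then the inclusion of
`(D, D ∩ s₀)` in `(s, s₀)` induces an isomorphism in homology. -/
theorem HHmap_bijective_of_deform (hd : IsDifferential deg d) (hK : RaisesDegree deg K)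
    {D : Set B} (ds : Stable d s) (Ks : Stable K s) (ds₀ : Stable d s₀) (Ks₀ : Stable K s₀)
    (dD : Stable d D) (KD : Stable K D) (hD : D ⊆ s) (h₀ : s₀ ⊆ s)
    (hpow : ∀ c ∈ Finsupp.supported ℤ ℤ s, ∃ m, (deform d K ^ m) c ∈ Finsupp.supported ℤ ℤ D)
    {D₀ : Set B} (hD₀ : D₀ = D ∩ s₀) (hD₀s : D₀ ⊆ s₀) :
    Function.Bijective (HHmap deg d l hD hD₀s) := by
  subst hD₀
  have dD₀ := dD.inter ds₀
  have KD₀ := KD.inter Ks₀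
  constructor
  · rw [injective_iff_map_eq_zero]
    intro z hz
    obtain ⟨c, hc, rfl⟩ := HHmk_surjective z
    rw [HHmap_mk, HHmk_eq_zero_iff] at hz
    rw [HHmk_eq_zero_iff]
    obtain ⟨_, ⟨a, ha, rfl⟩, e, he, hae⟩ := Submodule.mem_sup.1 hz
    rw [SetLike.mem_coe, mem_supported_inter] at ha
    rw [mem_supported_inter] at he
    -- The bounding chain and the correction term may need different exponents. Chains on `D` stay
    -- on `D`, so the sum of the exponents serves both.
    obtain ⟨m, hm⟩ := hpow a ha.1
    obtain ⟨n, hn⟩ := hpow e (supported_mono' h₀ he.1)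
    have key : (deform d K ^ (m + n)) c ∈ relBoundaries deg d l D (D ∩ s₀) := by
      rw [← hae, map_add, ← d_deform_pow hd]
      refine add_mem (Submodule.mem_sup_left ⟨_, ?_, rfl⟩) (Submodule.mem_sup_right ?_)
      · rw [SetLike.mem_coe, mem_supported_inter]
        refine ⟨?_, (stable_deform_degree hd hK _).pow _ _ ha.2⟩
        rw [add_comm, pow_add, Module.End.mul_apply]
        exact (dD.deform KD).pow _ _ hm
      · rw [mem_supported_inter, mem_supported_inter]
        refine ⟨⟨?_, (ds₀.deform Ks₀).pow _ _ he.1⟩, (stable_deform_degree hd hK _).pow _ _ he.2⟩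
        rw [pow_add, Module.End.mul_apply]
        exact (dD.deform KD).pow _ _ hn
    -- The homotopy also lives on the smaller pair, so there `c` is homologous to its deformed
    -- image, which bounds.
    have := (deform_pow_homotopic hd hK dD KD dD₀ KD₀ (m + n) hc).2
    simpa using sub_mem key this
  · intro z
    obtain ⟨c, hc, rfl⟩ := HHmk_surjective z
    have hc' := hc
    obtain ⟨hc1, hc₀⟩ := hc
    rw [SetLike.mem_coe, mem_supported_inter] at hc1
    have hc₀ : d c ∈ Finsupp.supported ℤ ℤ s₀ := hc₀
    obtain ⟨m, hm⟩ := hpow c hc1.1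
    refine ⟨HHmk ((deform d K ^ m) c) ⟨?_, ?_⟩, ?_⟩
    · rw [SetLike.mem_coe, mem_supported_inter]
      exact ⟨hm, (stable_deform_degree hd hK _).pow _ _ hc1.2⟩
    · change d _ ∈ Finsupp.supported ℤ ℤ _
      rw [mem_supported_inter]
      refine ⟨dD _ hm, ?_⟩
      rw [d_deform_pow hd]
      exact (ds₀.deform Ks₀).pow _ _ hc₀
    · exact (HHmk_eq_iff _ _).2 (deform_pow_homotopic hd hK ds Ks ds₀ Ks₀ m hc').2

/-- If the deformation lowers a rank function, it eventually moves every chain into the part of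
rank zero. -/
theorem exists_deform_pow_mem (rk : B → ℕ) (ds : Stable d s) (Ks : Stable K s)
    (h : ∀ b ∈ s, deform d K (Finsupp.single b 1) ∈
      Finsupp.supported ℤ ℤ {b' | rk b' ≤ rk b - 1}) {c : B →₀ ℤ}
    (hc : c ∈ Finsupp.supported ℤ ℤ s) :
    ∃ m, (deform d K ^ m) c ∈ Finsupp.supported ℤ ℤ (s ∩ {b | rk b = 0}) := by
  -- Truncated subtraction keeps rank zero at rank zero. The largest rank in the support of a chain
  -- thus bounds the number of iterations.
  have key : ∀ n : ℕ, ∀ c ∈ Finsupp.supported ℤ ℤ (s ∩ {b | rk b ≤ n}),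
      (deform d K ^ n) c ∈ Finsupp.supported ℤ ℤ (s ∩ {b | rk b = 0}) := by
    intro n
    induction n with
    | zero => exact fun c hc => by simpa using hc
    | succ n ih =>
      intro c hc
      rw [pow_succ, Module.End.mul_apply]
      apply ih
      refine map_supported (V := Finsupp.supported ℤ ℤ (s ∩ {b | rk b ≤ n})) _ ?_ hc
      rintro b ⟨hb, hbn⟩
      rw [mem_supported_inter]
      refine ⟨ds.deform Ks _ (single_mem_supported hb 1), supported_mono' ?_ (h b hb)⟩
      intro b' (hb' : rk b' ≤ rk b - 1)
      have : rk b ≤ n + 1 := hbn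
      exact (by omega : rk b' ≤ n)
  refine ⟨c.support.sup rk, key _ c ?_⟩
  rw [mem_supported_inter]
  exact ⟨hc, fun b hb => Finset.le_sup (f := rk) hb⟩

end BasedHomology

/-! ## Comparison with homology of simplicial sets -/

section

open Simplicial

/-! ### Homology classes of quotient complexes of modules, by explicit chains. -/

section ModuleComplexes

variable {A₀ : Type*} [Ring A₀]

variable (C : ChainComplex (ModuleCat.{u} A₀) ℕ) (l : ℕ)

/-- The class of a cycle in the homology of a complex of modules. -/
def cycleClass : LinearMap.ker (C.sc l).g.hom →ₗ[A₀] C.homology l :=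
  (C.sc l).moduleCatHomologyIso.inv.hom ∘ₗ
    Submodule.mkQ (LinearMap.range (C.sc l).moduleCatToCycles)

theorem cycleClass_surjective : Function.Surjective (cycleClass C l) := by
  have h1 : Function.Surjective (C.sc l).moduleCatHomologyIso.inv.hom :=
    (ModuleCat.epi_iff_surjective _).1 inferInstance
  exact h1.comp (Submodule.mkQ_surjective _)

theorem cycleClass_eq_zero_iff (x : LinearMap.ker (C.sc l).g.hom) :
    cycleClass C l x = 0 ↔ ∃ y : C.X (l + 1), C.d (l + 1) l y = x.1 := by
  have h1 : Function.Injective (C.sc l).moduleCatHomologyIso.inv.hom :=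
    (ModuleCat.mono_iff_injective _).1 inferInstance
  have key : ∀ i, (ComplexShape.down ℕ).prev l = i →
      ((∃ y, (C.sc l).f y = x.1) ↔ ∃ y : C.X i, C.d i l y = x.1) := by
    rintro i rfl
    rfl
  rw [← key (l + 1) (ChainComplex.prev ℕ l)]
  refine (map_eq_zero_iff _ h1).trans ((Submodule.Quotient.mk_eq_zero _).trans ?_)
  constructor
  · rintro ⟨y, hy⟩
    exact ⟨y, congrArg Subtype.val hy⟩
  · rintro ⟨y, hy⟩
    exact ⟨y, Subtype.ext hy⟩

/-- Replaces the explicit quotient by the abstract projection from cycles, whose naturality is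
available. -/
theorem cycleClass_eq_homologyπ (x : LinearMap.ker (C.sc l).g.hom) :
    cycleClass C l x = C.homologyπ l ((C.sc l).moduleCatCyclesIso.inv x) := by
  have := congrArg (fun f => f.hom x) (C.sc l).moduleCatCyclesIso_inv_π
  change (C.sc l).homologyπ.hom ((C.sc l).moduleCatCyclesIso.inv.hom x) =
    cycleClass C l x at this
  exact this.symm

variable {C} in
theorem homologyMap_cycleClass {D : ChainComplex (ModuleCat.{u} A₀) ℕ} (φ : C ⟶ D)
    (x : LinearMap.ker (C.sc l).g.hom) (y : LinearMap.ker (D.sc l).g.hom) (h : φ.f l x.1 = y.1) :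
    HomologicalComplex.homologyMap φ l (cycleClass C l x) = cycleClass D l y := by
  rw [cycleClass_eq_homologyπ, cycleClass_eq_homologyπ]
  have h1 := congrArg (fun f => f.hom ((C.sc l).moduleCatCyclesIso.inv x))
    (HomologicalComplex.homologyπ_naturality φ l)
  refine h1.trans ?_
  change D.homologyπ l (HomologicalComplex.cyclesMap φ l _) = _
  congr 1
  have hm : Function.Injective (D.iCycles l) := (ModuleCat.mono_iff_injective _).1 inferInstance
  apply hm
  have h2 := congrArg (fun f => f.hom ((C.sc l).moduleCatCyclesIso.inv x))
    (HomologicalComplex.cyclesMap_i φ l)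
  refine h2.trans ?_
  have h3 := congrArg (fun f => f.hom x) (C.sc l).moduleCatCyclesIso_inv_iCycles
  have h4 := congrArg (fun f => f.hom y) (D.sc l).moduleCatCyclesIso_inv_iCycles
  refine (congrArg (φ.f l) h3).trans (Eq.trans h h4.symm)

theorem mem_ker_sc_g {x : C.X l} (h : ∀ n, l = n + 1 → C.d l n x = 0) :
    x ∈ LinearMap.ker (C.sc l).g.hom := by
  change C.d l _ x = 0
  cases l with
  | zero =>
    -- Nothing follows degree zero in the complex shape, so this differential vanishes.
    rw [C.shape _ _ (by simp)]
    rfl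
  | succ n =>
    rw [ChainComplex.next_nat_succ]
    exact h n rfl

variable {C l} in
theorem d_eq_zero_of_mem_ker {x : C.X l} (h : x ∈ LinearMap.ker (C.sc l).g.hom) (n : ℕ)
    (hn : l = n + 1) : C.d l n x = 0 := by
  subst hn
  have h' : C.d (n + 1) ((ComplexShape.down ℕ).next (n + 1)) x = 0 := h
  rwa [ChainComplex.next_nat_succ] at h'

variable {C} {A : ChainComplex (ModuleCat.{u} A₀) ℕ} (φ : A ⟶ C)

theorem cokernel_π_f_surjective (n : ℕ) : Function.Surjective ((cokernel.π φ).f n) :=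
  (ModuleCat.epi_iff_surjective _).1
    (inferInstanceAs (Epi ((HomologicalComplex.eval _ _ n).map (cokernel.π φ))))

/-- Exactness of the cokernel sequence of complexes can be tested in each degree. -/
theorem cokernel_π_f_eq_zero_iff (n : ℕ) (x : C.X n) :
    (cokernel.π φ).f n x = 0 ↔ ∃ y, φ.f n y = x := by
  constructor
  · have h := (HomologicalComplex.exact_iff_degreewise_exact _).1 (ShortComplex.exact_cokernel φ) n
    exact (ShortComplex.moduleCat_exact_iff _).1 h x
  · rintro ⟨y, rfl⟩
    have := congrArg (fun f => (f.f n).hom y) (cokernel.condition φ)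
    exact this

theorem hom_f_d_apply {A C : ChainComplex (ModuleCat.{u} A₀) ℕ} (φ : A ⟶ C) (i j : ℕ) (x : A.X i) :
    φ.f j (A.d i j x) = C.d i j (φ.f i x) := by
  have := congrArg (fun f => f.hom x) (φ.comm i j)
  exact this.symm

/-- The chains whose boundary comes from the subcomplex. -/
def relativeCycles (l : ℕ) : Submodule A₀ (C.X l) :=
  (LinearMap.ker ((cokernel φ).sc l).g.hom).comap ((cokernel.π φ).f l).hom

theorem d_cokernel_π_eq_zero_iff (i j : ℕ) (x : C.X i) :
    (cokernel φ).d i j ((cokernel.π φ).f i x) = 0 ↔ ∃ y, φ.f j y = C.d i j x := by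
  rw [← hom_f_d_apply, cokernel_π_f_eq_zero_iff]

theorem mem_relativeCycles_iff (l : ℕ) (x : C.X l) :
    x ∈ relativeCycles φ l ↔ ∀ n, l = n + 1 → ∃ y, φ.f n y = C.d l n x := by
  constructor
  · intro h n hn
    exact (d_cokernel_π_eq_zero_iff φ l n x).1 (d_eq_zero_of_mem_ker h n hn)
  · intro h
    exact mem_ker_sc_g _ _ fun n hn => (d_cokernel_π_eq_zero_iff φ l n x).2 (h n hn)

/-- The class of a relative cycle. -/
def relativeClass (l : ℕ) : relativeCycles φ l →ₗ[A₀] (cokernel φ).homology l :=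
  cycleClass (cokernel φ) l ∘ₗ ((cokernel.π φ).f l).hom.restrict fun _ hc => hc

theorem relativeClass_surjective (l : ℕ) : Function.Surjective (relativeClass φ l) := by
  intro z
  obtain ⟨⟨x, hx⟩, rfl⟩ := cycleClass_surjective _ l z
  obtain ⟨y, rfl⟩ := cokernel_π_f_surjective _ l x
  exact ⟨⟨y, hx⟩, rfl⟩

/-- A bounding chain in the quotient lifts, and the boundary of the lift misses `x` by an element of
the subcomplex. -/
theorem relativeClass_eq_zero_iff (l : ℕ) (x : relativeCycles φ l) :
    relativeClass φ l x = 0 ↔ ∃ y z, x.1 = C.d (l + 1) l y + φ.f l z := by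
  refine (cycleClass_eq_zero_iff _ l _).trans ?_
  change (∃ y, (cokernel φ).d (l + 1) l y = (cokernel.π φ).f l x.1) ↔ _
  have key : ∀ y, (cokernel φ).d (l + 1) l ((cokernel.π φ).f (l + 1) y) =
      (cokernel.π φ).f l x.1 ↔ ∃ z, φ.f l z = x.1 - C.d (l + 1) l y := by
    intro y
    rw [← hom_f_d_apply, eq_comm, ← sub_eq_zero, ← cokernel_π_f_eq_zero_iff]
    exact Eq.congr_left (map_sub ((cokernel.π φ).f l).hom _ _).symm
  constructor
  · rintro ⟨y, hy⟩
    obtain ⟨y, rfl⟩ := cokernel_π_f_surjective _ (l + 1) y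
    obtain ⟨z, hz⟩ := (key y).1 hy
    exact ⟨y, z, by rw [hz]; abel⟩
  · rintro ⟨y, z, h⟩
    exact ⟨_, (key y).2 ⟨z, by rw [h]; abel⟩⟩

theorem homologyMap_relativeClass {A' C' : ChainComplex (ModuleCat.{u} A₀) ℕ} (φ' : A' ⟶ C')
    (ψ : C ⟶ C') (χ : cokernel φ ⟶ cokernel φ') (h : cokernel.π φ ≫ χ = ψ ≫ cokernel.π φ')
    (l : ℕ) (x : relativeCycles φ l) (y : relativeCycles φ' l) (hxy : ψ.f l x.1 = y.1) :
    HomologicalComplex.homologyMap χ l (relativeClass φ l x) = relativeClass φ' l y := by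
  refine homologyMap_cycleClass l χ _ _ ?_
  have h2 := congrArg (fun g => (g.f l).hom x.1) h
  exact h2.trans (congrArg ((cokernel.π φ').f l) hxy)

end ModuleComplexes

/-! ### Simplicial chains as chains of cells. -/

section Models

variable {B : Type u} {deg : B → ℕ} {d : (B →₀ ℤ) →ₗ[ℤ] (B →₀ ℤ)}

variable (deg d) in
/-- An identification of the simplices of a simplicial set with cells. -/
structure CellModel (Y : SSet.{u}) where
  cell : ∀ n : ℕ, Y _⦋n⦌ → B
  injective : ∀ n, Function.Injective (cell n)
  deg_cell : ∀ n y, deg (cell n y) = n + 1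
  d_cell : ∀ n (y : Y _⦋n + 1⦌), d (Finsupp.single (cell (n + 1) y) 1) =
    ∑ i : Fin (n + 2), (-1 : ℤ) ^ (i : ℕ) • Finsupp.single (cell n (Y.δ i y)) 1

namespace CellModel

variable {Y Y' : SSet.{u}} (M : CellModel deg d Y) (M' : CellModel deg d Y')

/-- A simplex as a chain. -/
def chain (n : ℕ) (y : Y _⦋n⦌) : (Y.chainComplex (coeffZ.{u})).X n :=
  (SSet.ιChainComplex (R := coeffZ) Y y).hom (ULift.up 1)

/-- The identification of simplicial chains with chains of cells. -/
def toCells (n : ℕ) :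
    (Y.chainComplex (coeffZ.{u})).X n ⟶ ModuleCat.of ℤ (B →₀ ℤ) :=
  (Y.isColimitChainComplexXCofan coeffZ n).desc (Cofan.mk _ fun y =>
    ModuleCat.ofHom ((LinearMap.toSpanSingleton ℤ _ (Finsupp.single (M.cell n y) 1)) ∘ₗ
      ULift.moduleEquiv.toLinearMap))

theorem ι_toCells (n : ℕ) (y : Y _⦋n⦌) : SSet.ιChainComplex Y y ≫ M.toCells n =
    ModuleCat.ofHom ((LinearMap.toSpanSingleton ℤ _ (Finsupp.single (M.cell n y) 1)) ∘ₗ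
      ULift.moduleEquiv.toLinearMap) :=
  (Y.isColimitChainComplexXCofan coeffZ n).fac _ ⟨y⟩

theorem toCells_chain (n : ℕ) (y : Y _⦋n⦌) :
    M.toCells n (chain n y) = Finsupp.single (M.cell n y) 1 := by
  have := congrArg (fun f => f.hom (ULift.up 1)) (M.ι_toCells n y)
  change M.toCells n (chain n y) = (1 : ℤ) • Finsupp.single (M.cell n y) 1 at this
  rw [this, one_smul]

open Classical in
/-- The inverse identification. -/
def ofCells (n : ℕ) : (B →₀ ℤ) →+ (Y.chainComplex (coeffZ.{u})).X n :=
  Finsupp.liftAddHom fun b =>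
    -- Cells that are not simplices go to zero; this map is inverse to `toCells` only on chains
    -- supported in the range of `cell n`.
    zmultiplesHom _ (if h : ∃ y, M.cell n y = b then chain n h.choose else 0)

theorem ofCells_single (n : ℕ) (y : Y _⦋n⦌) :
    M.ofCells n (Finsupp.single (M.cell n y) 1) = chain n y := by
  have h : ∃ y', M.cell n y' = M.cell n y := ⟨y, rfl⟩
  rw [ofCells, Finsupp.liftAddHom_apply_single, zmultiplesHom_apply, one_zsmul, dif_pos h,
    M.injective n h.choose_spec]

/-- The chain module is a coproduct of copies of ℤ, and a linear map out of ℤ is determined by the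
image of 1. -/
theorem hom_ext_chain {n : ℕ} {N : ModuleCat.{u} ℤ}
    {f g : (Y.chainComplex (coeffZ.{u})).X n ⟶ N} (h : ∀ y, f (chain n y) = g (chain n y)) :
    f = g := by
  apply SSet.chainComplex_hom_ext
  intro y
  ext ⟨m⟩
  have hm : (ULift.up m : ULift.{u} ℤ) = m • ULift.up 1 := by
    ext; simp
  change f.hom.toAddMonoidHom ((SSet.ιChainComplex (R := coeffZ) Y y).hom.toAddMonoidHom
      (ULift.up m)) =
    g.hom.toAddMonoidHom ((SSet.ιChainComplex (R := coeffZ) Y y).hom.toAddMonoidHom (ULift.up m))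
  rw [hm, map_zsmul, map_zsmul, map_zsmul]
  exact congrArg _ (h y)

theorem ofCells_toCells (n : ℕ) (x) : M.ofCells n (M.toCells n x) = x := by
  have : M.toCells n ≫ ModuleCat.ofHom ⟨(M.ofCells n).toAddHom, fun m c => by
      simpa using map_intCast_smul (M.ofCells n) ℤ ℤ m c⟩ = 𝟙 _ := by
    apply hom_ext_chain
    intro y
    change M.ofCells n (M.toCells n (chain n y)) = chain n y
    rw [toCells_chain, ofCells_single]
  exact congrArg (fun f => f.hom x) this

theorem toCells_ofCells (n : ℕ) {c : B →₀ ℤ}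
    (hc : c ∈ Finsupp.supported ℤ ℤ (Set.range (M.cell n))) :
    M.toCells n (M.ofCells n c) = c := by
  have := map_supported ((((M.toCells n).hom.toAddMonoidHom.comp (M.ofCells n)).toIntLinearMap) -
    LinearMap.id) (s := Set.range (M.cell n)) (V := ⊥) ?_ hc
  · rw [Submodule.mem_bot, LinearMap.sub_apply, sub_eq_zero] at this
    exact this
  · rintro _ ⟨y, rfl⟩
    rw [Submodule.mem_bot, LinearMap.sub_apply, sub_eq_zero]
    change M.toCells n (M.ofCells n _) = _
    rw [ofCells_single]
    exact M.toCells_chain n y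

/-- Membership in a submodule is vanishing in the quotient, an equation of morphisms that can be
tested on simplices. -/
theorem toCells_mem (n : ℕ) (x) :
    M.toCells n x ∈ Finsupp.supported ℤ ℤ (Set.range (M.cell n)) := by
  have : M.toCells n ≫ ModuleCat.ofHom (Y := (B →₀ ℤ) ⧸ Finsupp.supported ℤ ℤ (Set.range (M.cell n)))
      (Finsupp.supported ℤ ℤ (Set.range (M.cell n))).mkQ = 0 := by
    apply hom_ext_chain
    intro y
    change Submodule.mkQ _ (M.toCells n (chain n y)) = 0
    rw [toCells_chain, Submodule.mkQ_apply, Submodule.Quotient.mk_eq_zero]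
    exact single_mem_supported (Set.mem_range_self y) 1
  have h := congrArg (fun f => f.hom x) this
  exact (Submodule.Quotient.mk_eq_zero _).1 h

theorem toCells_d (n : ℕ) (x) :
    M.toCells n ((Y.chainComplex (coeffZ.{u})).d (n + 1) n x) = d (M.toCells (n + 1) x) := by
  have : (Y.chainComplex (coeffZ.{u})).d (n + 1) n ≫ M.toCells n =
      M.toCells (n + 1) ≫ ModuleCat.ofHom d := by
    apply hom_ext_chain
    intro y
    change M.toCells n ((Y.chainComplex (coeffZ.{u})).d (n + 1) n (chain (n + 1) y)) =
      d (M.toCells (n + 1) (chain (n + 1) y))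
    rw [toCells_chain, M.d_cell]
    have h := congrArg (fun f => (f ≫ M.toCells n).hom (ULift.up 1))
      (SSet.ιChainComplex_d Y (coeffZ.{u}) y)
    -- Evaluation at the generator is additive in the morphism, so it passes through the alternating
    -- sum of faces.
    let ev : ((coeffZ.{u}) ⟶ ModuleCat.of ℤ (B →₀ ℤ)) →+ (B →₀ ℤ) :=
      AddMonoidHom.mk' (fun f => f.hom (ULift.up 1)) fun _ _ => rfl
    refine h.trans ?_
    rw [Preadditive.sum_comp]
    change ev _ = _
    rw [map_sum]
    refine Finset.sum_congr rfl fun i _ => ?_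
    rw [Preadditive.zsmul_comp, map_zsmul]
    exact congrArg _ (M.toCells_chain n _)
  exact congrArg (fun f => f.hom x) this

theorem toCells_map (f : Y ⟶ Y') {n : ℕ}
    (h : ∀ y, M'.cell n (f.app _ y) = M.cell n y) (x) :
    M'.toCells n ((SSet.chainComplexMap f (coeffZ.{u})).f n x) = M.toCells n x := by
  have : (SSet.chainComplexMap f (coeffZ.{u})).f n ≫ M'.toCells n = M.toCells n := by
    apply hom_ext_chain
    intro y
    change M'.toCells n ((SSet.chainComplexMap f (coeffZ.{u})).f n (chain n y)) = _
    rw [toCells_chain]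
    have h1 := congrArg (fun f => f.hom (ULift.up 1))
      (SSet.ι_chainComplexMap_f Y Y' f (coeffZ.{u}) y)
    change (SSet.chainComplexMap f (coeffZ.{u})).f n (chain n y) = chain n (f.app _ y) at h1
    rw [h1, toCells_chain, h]
  exact congrArg (fun f => f.hom x) this

end CellModel

variable (deg d) in
/-- An identification of the simplices of a pair of simplicial sets with cells of `s` and `s₀`. -/
structure PairModel (f : Arrow SSet.{u}) (s s₀ : Set B) where
  right : CellModel deg d f.right
  left : CellModel deg d f.left
  comm : ∀ n (y : f.left _⦋n⦌), right.cell n (f.hom.app _ y) = left.cell n y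
  range_right : ∀ n, Set.range (right.cell n) = s ∩ {b | deg b = n + 1}
  range_left : ∀ n, Set.range (left.cell n) = s₀ ∩ {b | deg b = n + 1}
  -- All augmentation cells lie in the smaller set. They disappear from the relative complex, whose
  -- homology is therefore the unreduced relative homology, even if the subspace is empty.
  augmentation : {b | deg b = 0} ⊆ s₀

namespace PairModel

variable {f f' : Arrow SSet.{u}} {s s₀ s' s₀' : Set B} (M : PairModel deg d f s s₀)
  (M' : PairModel deg d f' s' s₀')

/-- Turns the image of the subcomplex into a support condition, by which relative cycles and
boundaries are translated. -/
theorem exists_left_iff (n : ℕ) (x : (f.right.chainComplex (coeffZ.{u})).X n) :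
    (∃ y, (SSet.chainComplexMap f.hom (coeffZ.{u})).f n y = x) ↔
      M.right.toCells n x ∈ Finsupp.supported ℤ ℤ (s₀ ∩ {b | deg b = n + 1}) := by
  constructor
  · rintro ⟨y, rfl⟩
    rw [CellModel.toCells_map M.left M.right f.hom (M.comm n), ← M.range_left]
    exact M.left.toCells_mem n y
  · intro h
    rw [← M.range_left] at h
    refine ⟨M.left.ofCells n (M.right.toCells n x), ?_⟩
    have h1 := CellModel.toCells_map M.left M.right f.hom (M.comm n)
      (M.left.ofCells n (M.right.toCells n x))
    rw [M.left.toCells_ofCells n h] at h1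
    have h2 := congrArg (M.right.ofCells n) h1
    rwa [M.right.ofCells_toCells, M.right.ofCells_toCells] at h2

variable (hd : IsDifferential deg d) (l : ℕ)

include hd in
theorem mem_relativeCycles_iff (x : (f.right.chainComplex (coeffZ.{u})).X l) :
    x ∈ relativeCycles (SSet.chainComplexMap f.hom (coeffZ.{u})) l ↔
      M.right.toCells l x ∈ relCycles deg d l s s₀ := by
  have hx := M.right.toCells_mem l x
  rw [M.range_right] at hx
  have hdeg := hd.map_degree' (mem_supported_inter.1 hx).2
  rw [LocalHomology.mem_relativeCycles_iff]
  simp only [M.exists_left_iff]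
  constructor
  · intro h
    refine ⟨hx, ?_⟩
    change d _ ∈ Finsupp.supported ℤ ℤ s₀
    cases l with
    | zero => exact supported_mono' M.augmentation hdeg
    | succ n =>
      have := h n rfl
      rw [M.right.toCells_d] at this
      exact (mem_supported_inter.1 this).1
  · rintro h n rfl
    rw [M.right.toCells_d, mem_supported_inter]
    exact ⟨h.2, hdeg⟩

theorem toCells_ofCells {c : B →₀ ℤ} (hc : c ∈ relCycles deg d l s s₀) :
    M.right.toCells l (M.right.ofCells l c) = c :=
  M.right.toCells_ofCells l (by rw [M.range_right]; exact hc.1)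

include hd in
theorem ofCells_mem {c : B →₀ ℤ} (hc : c ∈ relCycles deg d l s s₀) :
    M.right.ofCells l c ∈ relativeCycles (SSet.chainComplexMap f.hom (coeffZ.{u})) l := by
  rwa [M.mem_relativeCycles_iff hd, M.toCells_ofCells l hc]

/-- The homology class of simplicial chains that corresponds to a relative cycle of cells. -/
def relClass : relCycles deg d l s s₀ →+ (simplicialRel l).obj f :=
  (relativeClass (SSet.chainComplexMap f.hom (coeffZ.{u})) l).toAddMonoidHom.comp
    (AddMonoidHom.mk' (fun c => ⟨M.right.ofCells l c, M.ofCells_mem hd l c.2⟩) fun _ _ =>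
      Subtype.ext (map_add (M.right.ofCells l) _ _))

theorem relClass_surjective : Function.Surjective (M.relClass hd l) := by
  intro z
  obtain ⟨x, rfl⟩ := relativeClass_surjective _ l z
  refine ⟨⟨M.right.toCells l x.1, (M.mem_relativeCycles_iff hd l x.1).1 x.2⟩, ?_⟩
  exact congrArg (relativeClass _ l) (Subtype.ext (M.right.ofCells_toCells l x.1))

theorem relClass_eq_zero_iff (c : relCycles deg d l s s₀) :
    M.relClass hd l c = 0 ↔ c.1 ∈ relBoundaries deg d l s s₀ := by
  obtain ⟨c, hc⟩ := c
  refine (relativeClass_eq_zero_iff _ l _).trans ?_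
  have hcr := M.toCells_ofCells l hc
  constructor
  · rintro ⟨y, z, h⟩
    have h' : M.right.toCells l (M.right.ofCells l c) = _ := congrArg (M.right.toCells l) h
    rw [hcr, map_add, M.right.toCells_d] at h'
    change c ∈ _
    rw [h']
    refine add_mem (Submodule.mem_sup_left ⟨_, ?_, rfl⟩) (Submodule.mem_sup_right ?_)
    · have := M.right.toCells_mem (l + 1) y
      rwa [M.range_right] at this
    · exact (M.exists_left_iff l _).1 ⟨z, rfl⟩
  · intro h
    obtain ⟨_, ⟨a, ha, rfl⟩, e, he, hae⟩ := Submodule.mem_sup.1 h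
    have ha' : M.right.toCells (l + 1) (M.right.ofCells (l + 1) a) = a :=
      M.right.toCells_ofCells _ (by rw [M.range_right]; exact ha)
    have hs₀ : s₀ ∩ {b | deg b = l + 1} ⊆ Set.range (M.right.cell l) := by
      rw [← M.range_left]
      rintro _ ⟨y, rfl⟩
      exact ⟨_, M.comm l y⟩
    have he' : M.right.toCells l (M.right.ofCells l e) = e :=
      M.right.toCells_ofCells _ (supported_mono' hs₀ he)
    obtain ⟨z, hz⟩ := (M.exists_left_iff l (M.right.ofCells l e)).2 (by rwa [he'])
    refine ⟨M.right.ofCells (l + 1) a, z, ?_⟩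
    have hinj : Function.Injective (M.right.toCells l) :=
      Function.LeftInverse.injective (M.right.ofCells_toCells l)
    apply hinj
    rw [hz, map_add, M.right.toCells_d, ha', he']
    exact hcr.trans hae.symm

/-- The comparison isomorphism. -/
def equiv : HH deg d l s s₀ ≃+ (simplicialRel l).obj f :=
  AddEquiv.ofBijective (QuotientAddGroup.lift _ (M.relClass hd l)
      fun c hc => (M.relClass_eq_zero_iff hd l c).2 hc) <| by
    constructor
    · refine (injective_iff_map_eq_zero _).2 fun z hz => ?_
      obtain ⟨c, hc, rfl⟩ := HHmk_surjective z
      exact (HHmk_eq_zero_iff hc).2 ((M.relClass_eq_zero_iff hd l ⟨c, hc⟩).1 hz)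
    · intro z
      obtain ⟨c, hc⟩ := M.relClass_surjective hd l z
      exact ⟨HHmk c.1 c.2, hc⟩

theorem equiv_mk {c : B →₀ ℤ} (hc : c ∈ relCycles deg d l s s₀) :
    M.equiv hd l (HHmk c hc) = M.relClass hd l ⟨c, hc⟩ := rfl

theorem map_equiv (φ : f ⟶ f')
    (hφ : ∀ n y, M'.right.cell n (φ.right.app _ y) = M.right.cell n y)
    (h : s ⊆ s') (h₀ : s₀ ⊆ s₀') (z : HH deg d l s s₀) :
    (simplicialRel l).map φ (M.equiv hd l z) = M'.equiv hd l (HHmap deg d l h h₀ z) := by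
  obtain ⟨c, hc, rfl⟩ := HHmk_surjective z
  rw [HHmap_mk, equiv_mk, equiv_mk]
  refine homologyMap_relativeClass _ _ (SSet.chainComplexMap φ.right (coeffZ.{u})) _
    (cokernel.π_desc _ _ _) l _ _ ?_
  have hinj : Function.Injective (M'.right.toCells l) :=
    Function.LeftInverse.injective (M'.right.ofCells_toCells l)
  apply hinj
  refine (CellModel.toCells_map M.right M'.right φ.right (hφ l) _).trans ?_
  exact (M.toCells_ofCells l hc).trans (M'.toCells_ofCells l (relCycles_mono h h₀ hc)).symm

end PairModel

end Models

end

/-! ## Cells: pairs of a list of points and a singular simplex -/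

section ListChains

variable {V W : Type*}

/-- The augmented boundary of an ordered simplex. -/
def listBd : List V → (List V →₀ ℤ)
  | [] => 0
  | q :: σ => Finsupp.single σ 1 - Finsupp.lmapDomain ℤ ℤ (List.cons q) (listBd σ)

/-- The boundary of ordered simplicial chains. -/
def listD : (List V →₀ ℤ) →ₗ[ℤ] (List V →₀ ℤ) := Finsupp.linearCombination ℤ listBd

@[simp]
theorem listD_single (σ : List V) : listD (Finsupp.single σ 1) = listBd σ := by
  simp [listD]

/-- Adding a first vertex to ordered simplices. -/
def consL (q : V) : (List V →₀ ℤ) →ₗ[ℤ] (List V →₀ ℤ) := Finsupp.lmapDomain ℤ ℤ (List.cons q)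

@[simp]
theorem consL_single (q : V) (σ : List V) (n : ℤ) :
    consL q (Finsupp.single σ n) = Finsupp.single (q :: σ) n :=
  Finsupp.mapDomain_single

theorem listBd_cons (q : V) (σ : List V) :
    listBd (q :: σ) = Finsupp.single σ 1 - consL q (listBd σ) := rfl

theorem linearMap_ext_single {B N : Type*} [AddCommGroup N] {f g : (B →₀ ℤ) →ₗ[ℤ] N}
    (h : ∀ b, f (Finsupp.single b 1) = g (Finsupp.single b 1)) (c : B →₀ ℤ) : f c = g c := by
  have : f = g := Finsupp.lhom_ext' fun b => LinearMap.ext_ring (h b)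
  rw [this]

/-- The cone formula: thanks to the augmentation, prefixing a vertex is a contracting homotopy in
every degree. -/
theorem listD_consL (q : V) (c : List V →₀ ℤ) : listD (consL q c) = c - consL q (listD c) :=
  linearMap_ext_single (f := listD ∘ₗ consL q) (g := LinearMap.id - consL q ∘ₗ listD)
    (fun σ => by simp [listBd_cons]) c

theorem listD_listBd (σ : List V) : listD (listBd σ) = 0 := by
  induction σ with
  | nil => simp [listBd]
  | cons q σ ih => simp [listBd_cons, listD_consL, ih]

theorem listD_listD (c : List V →₀ ℤ) : listD (listD c) = 0 :=
  linearMap_ext_single (f := listD ∘ₗ listD) (g := 0) (fun σ => by simp [listD_listBd]) c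

/-- The map of ordered chains induced by a map of vertices. -/
def mapL (f : V → W) : (List V →₀ ℤ) →ₗ[ℤ] (List W →₀ ℤ) := Finsupp.lmapDomain ℤ ℤ (List.map f)

@[simp]
theorem mapL_single (f : V → W) (σ : List V) (n : ℤ) :
    mapL f (Finsupp.single σ n) = Finsupp.single (σ.map f) n :=
  Finsupp.mapDomain_single

theorem mapL_consL (f : V → W) (q : V) (c : List V →₀ ℤ) :
    mapL f (consL q c) = consL (f q) (mapL f c) :=
  linearMap_ext_single (f := mapL f ∘ₗ consL q) (g := consL (f q) ∘ₗ mapL f)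
    (fun σ => by simp) c

theorem mapL_listBd (f : V → W) (σ : List V) : mapL f (listBd σ) = listBd (σ.map f) := by
  induction σ with
  | nil => simp [listBd]
  | cons q σ ih => simp [listBd_cons, mapL_consL, ih]

theorem listBd_mem (σ : List V) :
    listBd σ ∈ Finsupp.supported ℤ ℤ {σ' | σ'.length + 1 = σ.length ∧ σ'.Sublist σ} := by
  induction σ with
  | nil => exact zero_mem _
  | cons q σ ih =>
    rw [listBd_cons]
    refine sub_mem (single_mem_supported (by exact ⟨rfl, List.sublist_cons_self q σ⟩) 1) ?_
    refine map_supported (consL q) ?_ ih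
    rintro σ' ⟨h1, h2⟩
    rw [consL_single]
    exact single_mem_supported (by exact ⟨by simp [h1], h2.cons_cons q⟩) 1

/-- The recursion removes the first vertex with sign plus; removing a later vertex keeps the first
one and flips the sign. -/
theorem listBd_ofFn {n : ℕ} (f : Fin (n + 1) → V) :
    listBd (List.ofFn f) = ∑ i : Fin (n + 1),
      (-1 : ℤ) ^ (i : ℕ) • Finsupp.single (List.ofFn (f ∘ i.succAbove)) 1 := by
  induction n with
  | zero => simp [listBd_cons, listBd, Function.comp_def]
  | succ n ih =>
    rw [List.ofFn_succ, listBd_cons, ih, map_sum, sub_eq_add_neg, ← Finset.sum_neg_distrib,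
      Fin.sum_univ_succ (n := n + 1)]
    congr 1
    · simp [Function.comp_def]
    · refine Finset.sum_congr rfl fun i _ => ?_
      rw [map_smul, consL_single, Fin.val_succ, pow_succ, mul_neg_one, neg_smul,
        List.ofFn_succ (f := f ∘ i.succ.succAbove)]
      simp [Function.comp_def]

/-- The sign involution of ordered chains. -/
def signL : (List V →₀ ℤ) →ₗ[ℤ] (List V →₀ ℤ) :=
  Finsupp.linearCombination ℤ fun σ => (-1 : ℤ) ^ σ.length • Finsupp.single σ 1

@[simp]
theorem signL_single (σ : List V) :
    signL (Finsupp.single σ 1) = (-1 : ℤ) ^ σ.length • Finsupp.single σ 1 := by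
  simp [signL]

theorem signL_consL (q : V) (c : List V →₀ ℤ) : signL (consL q c) = - consL q (signL c) :=
  linearMap_ext_single (f := signL ∘ₗ consL q) (g := - (consL q ∘ₗ signL)) (fun σ => by
    simp only [LinearMap.comp_apply, LinearMap.neg_apply, signL_single, map_smul, consL_single,
      List.length_cons, pow_succ]
    simp) c

theorem signL_listBd (σ : List V) :
    signL (listBd σ) = - ((-1 : ℤ) ^ σ.length • listBd σ) := by
  induction σ with
  | nil => simp [listBd]
  | cons q σ ih =>
    rw [listBd_cons, map_sub, signL_consL, ih, signL_single, List.length_cons, pow_succ]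
    simp [smul_sub]
    abel

/-- A face has one vertex less. This sign makes the mixed terms cancel in the square of `cellD`. -/
theorem signL_listD (c : List V →₀ ℤ) : signL (listD c) = - listD (signL c) :=
  linearMap_ext_single (f := signL ∘ₗ listD) (g := - (listD ∘ₗ signL))
    (fun σ => by
      rw [LinearMap.comp_apply, LinearMap.neg_apply, LinearMap.comp_apply, listD_single,
        signL_listBd, signL_single, map_smul, listD_single]) c

end ListChains

/-! ### Affine maps of standard simplices. -/

section Affine

/-- The standard simplex with `n` vertices. -/
abbrev Simp (n : ℕ) : Type := stdSimplex ℝ (Fin n)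

/-- The affine map between standard simplices with the given values at the vertices. -/
def aff {n m : ℕ} (w : Fin n → Simp m) : C(Simp n, Simp m) where
  toFun t := ⟨fun j => ∑ i, t i * w i j, fun j => Finset.sum_nonneg fun i _ =>
    mul_nonneg (t.2.1 i) ((w i).2.1 j), by
      rw [Finset.sum_comm]
      simp [← Finset.mul_sum]⟩
  continuous_toFun := by
    refine Continuous.subtype_mk (continuous_pi fun j => ?_) _
    exact continuous_finsetSum _ fun i _ =>
      ((continuous_apply i).comp continuous_subtype_val).mul continuous_const

theorem aff_apply {n m : ℕ} (w : Fin n → Simp m) (t : Simp n) (j : Fin m) :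
    aff w t j = ∑ i, t i * w i j := rfl

theorem aff_aff {n m k : ℕ} (w : Fin m → Simp k) (u : Fin n → Simp m) (t : Simp n) :
    aff w (aff u t) = aff (fun i => aff w (u i)) t := by
  ext j
  simp only [aff_apply, Finset.sum_mul, Finset.mul_sum]
  rw [Finset.sum_comm]
  simp only [mul_assoc]

theorem aff_vertex {n m : ℕ} (w : Fin n → Simp m) (i : Fin n) :
    aff w (stdSimplex.vertex i) = w i := by
  ext j
  simp [aff_apply, Pi.single_apply]

theorem aff_vertices {n m : ℕ} (f : Fin n → Fin m) (t : Simp n) :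
    aff (fun i => stdSimplex.vertex (f i)) t = stdSimplex.map f t := by
  ext j
  rw [stdSimplex.map_coe, FunOnFinite.linearMap_apply_apply, aff_apply, Finset.sum_filter]
  refine Finset.sum_congr rfl fun i _ => ?_
  simp [Pi.single_apply, eq_comm]

theorem aff_id {n : ℕ} (t : Simp n) : aff (fun i => stdSimplex.vertex i) t = t := by
  rw [aff_vertices (fun i => i)]
  exact stdSimplex.map_id_apply t

end Affine

/-! ### Singular simplices and their augmented boundary. -/

section Singular

variable (X : Type u) [TopologicalSpace X]

/-- Singular simplices of all dimensions, listed by their number of vertices. There is one singular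
simplex without vertices. -/
abbrev Sing : Type u := Σ n : ℕ, C(Simp n, X)

/-- The cells: pairs of an ordered simplex and a singular simplex. -/
abbrev Cell : Type u := List X × Sing X

variable {X}

/-- Absorbs the transport between numbers of vertices that are equal only propositionally, such as
the length of a mapped list. -/
theorem sing_comp_aff_congr {m : ℕ} (τ : C(Simp m, X)) {n n' : ℕ} (h : n = n')
    {f : Fin n → Simp m} {g : Fin n' → Simp m} (hfg : ∀ i, f i = g (Fin.cast h i)) :
    (⟨n, τ.comp (aff f)⟩ : Sing X) = ⟨n', τ.comp (aff g)⟩ := by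
  subst h
  have : f = g := funext hfg
  rw [this]

/-- The affine simplex with the given vertices, as a simplex inside of the singular simplex `s`. -/
def push (s : Sing X) (w : List (Simp s.1)) : Sing X := ⟨w.length, s.2.comp (aff w.get)⟩

theorem push_ofFn (s : Sing X) {n : ℕ} (f : Fin n → Simp s.1) :
    push s (List.ofFn f) = ⟨n, s.2.comp (aff f)⟩ :=
  sing_comp_aff_congr _ (List.length_ofFn) fun i => by simp; rfl

theorem push_push (s : Sing X) (w : List (Simp s.1)) (u : List (Simp w.length)) :
    push (push s w) u = push s (u.map (aff w.get)) := by
  have : push (push s w) u = ⟨u.length, s.2.comp (aff fun i => aff w.get (u.get i))⟩ := by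
    refine Sigma.ext rfl (heq_of_eq ?_)
    ext t
    exact congrArg s.2 (aff_aff w.get u.get t)
  rw [this]
  exact sing_comp_aff_congr _ (List.length_map _).symm fun i => by simp

/-- The vertices of the standard simplex. -/
def verts (n : ℕ) : List (Simp n) := List.ofFn fun i => stdSimplex.vertex i

@[simp]
theorem length_verts (n : ℕ) : (verts n).length = n := List.length_ofFn

theorem push_verts (s : Sing X) : push s (verts s.1) = s := by
  rw [verts, push_ofFn]
  refine Sigma.ext rfl (heq_of_eq ?_)
  ext t
  exact congrArg s.2 (aff_id t)

theorem map_aff_verts {m : ℕ} (w : List (Simp m)) : (verts w.length).map (aff w.get) = w := by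
  rw [verts, List.map_ofFn]
  have : (aff w.get) ∘ (fun i => stdSimplex.vertex i) = w.get := funext fun i => aff_vertex _ i
  rw [this, List.ofFn_get]

/-- The image of a chain of affine simplices in a singular simplex. -/
def pushL (s : Sing X) : (List (Simp s.1) →₀ ℤ) →ₗ[ℤ] (Sing X →₀ ℤ) :=
  Finsupp.lmapDomain ℤ ℤ (push s)

@[simp]
theorem pushL_single (s : Sing X) (w : List (Simp s.1)) (n : ℤ) :
    pushL s (Finsupp.single w n) = Finsupp.single (push s w) n :=
  Finsupp.mapDomain_single

theorem pushL_push (s : Sing X) (w : List (Simp s.1)) (c : List (Simp w.length) →₀ ℤ) :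
    pushL (push s w) c = pushL s (mapL (aff w.get) c) :=
  linearMap_ext_single (f := pushL (push s w)) (g := pushL s ∘ₗ mapL (aff w.get))
    (fun u => (pushL_single (push s w) u 1).trans (by
      refine (congrArg (fun b => Finsupp.single b (1 : ℤ)) (push_push s w u)).trans ?_
      exact ((congrArg (pushL s) (mapL_single _ u 1)).trans (pushL_single s _ 1)).symm)) c

/-- The augmented boundary of a singular simplex. -/
def singBd (s : Sing X) : Sing X →₀ ℤ := pushL s (listBd (verts s.1))

/-- The boundary of singular chains. -/
def singD : (Sing X →₀ ℤ) →ₗ[ℤ] (Sing X →₀ ℤ) := Finsupp.linearCombination ℤ singBd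

@[simp]
theorem singD_single (s : Sing X) : singD (Finsupp.single s 1) = singBd s := by
  simp [singD]

/-- The list `w` is the image of the vertices of its own standard simplex under an affine map, and
`listBd` is natural. -/
theorem singBd_push (s : Sing X) (w : List (Simp s.1)) :
    singBd (push s w) = pushL s (listBd w) := by
  have h := pushL_push s w (listBd (verts w.length))
  rw [mapL_listBd, map_aff_verts] at h
  exact h

theorem singD_pushL (s : Sing X) (c : List (Simp s.1) →₀ ℤ) :
    singD (pushL s c) = pushL s (listD c) :=
  linearMap_ext_single (f := singD ∘ₗ pushL s) (g := pushL s ∘ₗ listD)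
    (fun w => by simp [singBd_push]) c

theorem singD_singD (c : Sing X →₀ ℤ) : singD (singD c) = 0 :=
  linearMap_ext_single (f := singD ∘ₗ singD) (g := 0)
    (fun s => by simp [singBd, singD_pushL, listD_listBd]) c

theorem singBd_mk {n : ℕ} (τ : C(Simp (n + 1), X)) :
    singBd ⟨n + 1, τ⟩ = ∑ i : Fin (n + 1), (-1 : ℤ) ^ (i : ℕ) • Finsupp.single
      (⟨n, τ.comp ⟨stdSimplex.map i.succAbove, stdSimplex.continuous_map _⟩⟩ : Sing X) 1 := by
  rw [singBd, verts, listBd_ofFn, map_sum]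
  refine Finset.sum_congr rfl fun i _ => ?_
  rw [map_smul, pushL_single, push_ofFn]
  congr 3
  ext t
  exact congrArg τ (aff_vertices _ t)

/-- The points of a singular simplex. -/
def Sing.carrier (s : Sing X) : Set X := Set.range s.2

theorem carrier_push (s : Sing X) (w : List (Simp s.1)) : (push s w).carrier ⊆ s.carrier := by
  rintro _ ⟨t, rfl⟩
  exact ⟨_, rfl⟩

theorem singBd_mem (s : Sing X) :
    singBd s ∈ Finsupp.supported ℤ ℤ {s' | s'.1 + 1 = s.1 ∧ s'.carrier ⊆ s.carrier} := by
  refine map_supported _ (fun w hw => ?_) (listBd_mem (verts s.1))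
  rw [pushL_single]
  exact single_mem_supported (by exact ⟨hw.1.trans (length_verts _), carrier_push s w⟩) 1

variable (X) in
/-- The singular simplex without vertices. -/
def emptySing : Sing X :=
  ⟨0, ⟨fun t => (by simpa using t.2.2 : False).elim, continuous_iff_continuousAt.2 fun t =>
    (by simpa using t.2.2 : False).elim⟩⟩

/-- An empty sum of coordinates cannot be 1. -/
instance : IsEmpty (Simp 0) := ⟨fun t => by simpa using t.2.2⟩

theorem eq_emptySing {s : Sing X} (h : s.1 = 0) : s = emptySing X := by
  obtain ⟨n, τ⟩ := s
  obtain rfl : n = 0 := h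
  refine Sigma.ext rfl (heq_of_eq ?_)
  ext t
  exact isEmptyElim t

theorem carrier_eq_empty {s : Sing X} (h : s.1 = 0) : s.carrier = ∅ := by
  obtain ⟨n, τ⟩ := s
  obtain rfl : n = 0 := h
  exact Set.range_eq_empty _

theorem carrier_nonempty {s : Sing X} (h : s.1 ≠ 0) : s.carrier.Nonempty := by
  obtain ⟨n, τ⟩ := s
  obtain ⟨n, rfl⟩ := Nat.exists_eq_succ_of_ne_zero h
  exact ⟨_, ⟨stdSimplex.vertex 0, rfl⟩⟩

end Singular

/-! ### The tensor product of the augmented ordered and singular chain complexes. -/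

section Cells

variable {X : Type u} [TopologicalSpace X]

/-- The degree of a cell is its number of vertices. -/
def cellDeg (b : Cell X) : ℕ := b.1.length + b.2.1

/-- The cross product of ordered and singular chains. -/
def cross : (List X →₀ ℤ) →ₗ[ℤ] (Sing X →₀ ℤ) →ₗ[ℤ] (Cell X →₀ ℤ) :=
  Finsupp.linearCombination ℤ fun σ => Finsupp.lmapDomain ℤ ℤ (Prod.mk σ)

@[simp]
theorem cross_single (σ : List X) (s : Sing X) :
    cross (Finsupp.single σ 1) (Finsupp.single s 1) = Finsupp.single (σ, s) 1 := by
  simp [cross]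

theorem cross_ext {N : Type*} [AddCommGroup N]
    {f g : (List X →₀ ℤ) →ₗ[ℤ] (Sing X →₀ ℤ) →ₗ[ℤ] N}
    (h : ∀ σ s, f (Finsupp.single σ 1) (Finsupp.single s 1) =
      g (Finsupp.single σ 1) (Finsupp.single s 1)) (a : List X →₀ ℤ) (b : Sing X →₀ ℤ) :
    f a b = g a b := by
  have h1 : ∀ σ, f (Finsupp.single σ 1) = g (Finsupp.single σ 1) := fun σ =>
    LinearMap.ext fun b => linearMap_ext_single (h σ) b
  rw [linearMap_ext_single h1 a]

/-- The boundary of chains of cells. -/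
def cellD : (Cell X →₀ ℤ) →ₗ[ℤ] (Cell X →₀ ℤ) :=
  Finsupp.linearCombination ℤ fun b => cross (listBd b.1) (Finsupp.single b.2 1) +
    (-1 : ℤ) ^ b.1.length • cross (Finsupp.single b.1 1) (singBd b.2)

@[simp]
theorem cellD_single (σ : List X) (s : Sing X) : cellD (Finsupp.single (σ, s) 1) =
    cross (listBd σ) (Finsupp.single s 1) +
      (-1 : ℤ) ^ σ.length • cross (Finsupp.single σ 1) (singBd s) := by
  simp [cellD]

/-- The Leibniz rule; carrying the sign by a linear map makes it bilinear, hence checkable on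
generators. -/
theorem cellD_cross (a : List X →₀ ℤ) (b : Sing X →₀ ℤ) :
    cellD (cross a b) = cross (listD a) b + cross (signL a) (singD b) := by
  have h := cross_ext (f := cross.compr₂ cellD)
    (g := cross.comp listD + (cross.comp signL).compl₂ singD)
    (fun σ s => by
      simp only [LinearMap.compr₂_apply, LinearMap.add_apply, LinearMap.comp_apply,
        LinearMap.compl₂_apply, cross_single, cellD_single, listD_single, signL_single,
        singD_single, map_smul, LinearMap.smul_apply]) a b
  simpa only [LinearMap.compr₂_apply, LinearMap.add_apply, LinearMap.comp_apply,
    LinearMap.compl₂_apply] using h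

theorem cross_mem {s : Set (List X)} {t : Set (Sing X)} {r : Set (Cell X)}
    (h : ∀ σ ∈ s, ∀ τ ∈ t, (σ, τ) ∈ r) {a : List X →₀ ℤ} {b : Sing X →₀ ℤ}
    (ha : a ∈ Finsupp.supported ℤ ℤ s) (hb : b ∈ Finsupp.supported ℤ ℤ t) :
    cross a b ∈ Finsupp.supported ℤ ℤ r := by
  refine map_supported (cross.flip b) (fun σ hσ => ?_) ha
  rw [LinearMap.flip_apply]
  refine map_supported (cross _) (fun τ hτ => ?_) hb
  rw [cross_single]
  exact single_mem_supported (h σ hσ τ hτ) 1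

/-- Reduces a support condition on a boundary to closure under faces of either factor. -/
theorem cellD_single_mem (b : Cell X) {r : Set (Cell X)}
    (h1 : ∀ σ', σ'.length + 1 = b.1.length → σ'.Sublist b.1 → (σ', b.2) ∈ r)
    (h2 : ∀ s' : Sing X, s'.1 + 1 = b.2.1 → s'.carrier ⊆ b.2.carrier → (b.1, s') ∈ r) :
    cellD (Finsupp.single b 1) ∈ Finsupp.supported ℤ ℤ r := by
  obtain ⟨σ, s⟩ := b
  rw [cellD_single]
  refine add_mem ?_ (Submodule.smul_mem _ _ ?_)
  · refine cross_mem (t := {s}) ?_ (listBd_mem σ) (single_mem_supported (by exact rfl) 1)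
    rintro σ' ⟨h, h'⟩ _ rfl
    exact h1 σ' h h'
  · refine cross_mem (s := {σ}) ?_ (single_mem_supported (by exact rfl) 1) (singBd_mem s)
    rintro _ rfl s' ⟨h, h'⟩
    exact h2 s' h h'

theorem isDifferential_cellD : IsDifferential (B := Cell X) cellDeg cellD where
  sq_zero c := linearMap_ext_single (f := cellD ∘ₗ cellD) (g := 0) (fun ⟨σ, s⟩ => by
    rw [LinearMap.comp_apply, ← cross_single, cellD_cross, map_add, cellD_cross, cellD_cross,
      listD_listD, singD_singD, signL_listD]
    simp) c
  degree b := cellD_single_mem b (fun σ' h _ => by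
    change σ'.length + b.2.1 + 1 = b.1.length + b.2.1
    omega) (fun s' h _ => by
    change b.1.length + s'.1 + 1 = b.1.length + b.2.1
    omega)

end Cells

/-! ## Singular and simplicial homology in terms of cells -/

section

open Simplicial

/-! ### Singular chains of subspaces. -/

section SingularModel

variable {X : Type u} [TopologicalSpace X]

/-- The singular simplices of `Y`. -/
def singSet (Y : Set X) : Set (Cell X) := {b | b.1 = [] ∧ b.2.carrier ⊆ Y}

theorem singSet_mono {Y Y' : Set X} (h : Y ⊆ Y') : singSet Y ⊆ singSet Y' :=
  fun _ hb => ⟨hb.1, hb.2.trans h⟩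

/-- The cell of a singular simplex of a subspace. -/
def singCell {Y : Set X} {n : ℕ} (y : (TopCat.toSSet.obj (TopCat.of Y)) _⦋n⦌) : Cell X :=
  ([], ⟨n + 1, (ContinuousMap.mk (Subtype.val : Y → X) continuous_subtype_val).comp
    (TopCat.toSSetObjEquiv (TopCat.of Y) (Opposite.op ⦋n⦌) y)⟩)

theorem singCell_injective {Y : Set X} {n : ℕ} : Function.Injective (singCell (Y := Y) (n := n)) := by
  intro y y' h
  apply (TopCat.toSSetObjEquiv (TopCat.of Y) (Opposite.op ⦋n⦌)).injective
  have h1 := eq_of_heq (Sigma.mk.inj (Prod.mk.inj h).2).2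
  ext t
  exact congrArg (fun f : C(Simp (n + 1), X) => f t) h1

theorem range_singCell (Y : Set X) (n : ℕ) :
    Set.range (singCell (Y := Y) (n := n)) = singSet Y ∩ {b | cellDeg b = n + 1} := by
  ext ⟨σ, m, τ⟩
  constructor
  · rintro ⟨y, hy⟩
    rw [← hy]
    refine ⟨⟨rfl, ?_⟩, ?_⟩
    · rintro _ ⟨t, rfl⟩
      exact (TopCat.toSSetObjEquiv (TopCat.of Y) (Opposite.op ⦋n⦌) y t).2
    · exact Nat.zero_add _
  · rintro ⟨⟨h1, h2⟩, h3⟩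
    obtain rfl : σ = [] := h1
    obtain rfl : m = n + 1 := by simpa [cellDeg] using h3
    refine ⟨(TopCat.toSSetObjEquiv (TopCat.of Y) (Opposite.op ⦋n⦌)).symm
      ⟨fun t => ⟨τ t, h2 ⟨t, rfl⟩⟩, τ.continuous.subtype_mk _⟩, ?_⟩
    simp only [singCell, Equiv.apply_symm_apply]
    rfl

/-- The singular simplices of a subspace as cells. -/
def singModel (Y : Set X) :
    CellModel (B := Cell X) cellDeg cellD (TopCat.toSSet.obj (TopCat.of Y)) where
  cell _ y := singCell y
  injective _ := singCell_injective
  deg_cell _ _ := Nat.zero_add _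
  d_cell n y := by
    rw [singCell, cellD_single, singBd_mk]
    simp only [listBd, map_zero, LinearMap.zero_apply, zero_add, List.length_nil, pow_zero,
      one_smul, map_sum, map_smul, cross_single]
    rfl

/-- The cells of the pair `(Y, Y - U)`. -/
def singPairModel (Y U : Set X) : PairModel (B := Cell X) cellDeg cellD
    (TopCat.toSSet.mapArrow.obj (pair Y U)) (singSet Y) (singSet (Y \ U)) where
  right := singModel Y
  left := singModel (Y \ U)
  comm _ _ := rfl
  range_right n := range_singCell Y n
  range_left n := range_singCell (Y \ U) n
  augmentation := by
    rintro ⟨σ, s⟩ h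
    have h' : σ.length + s.1 = 0 := h
    refine ⟨List.eq_nil_of_length_eq_zero (by exact (by omega : σ.length = 0)), ?_⟩
    rw [carrier_eq_empty (by exact (by omega : s.1 = 0))]
    exact empty_subset _

/-- Singular homology of a pair of subspaces in terms of cells. -/
def singEquiv (l : ℕ) (Y U : Set X) :
    HH (B := Cell X) cellDeg cellD l (singSet Y) (singSet (Y \ U)) ≃+ HRel l Y U :=
  (singPairModel Y U).equiv isDifferential_cellD l

theorem HRelMap_singEquiv (l : ℕ) {Y Y' U U' : Set X} (hY : Y ⊆ Y') (hU : U' ⊆ U)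
    (z : HH (B := Cell X) cellDeg cellD l (singSet Y) (singSet (Y \ U))) :
    HRelMap l hY hU (singEquiv l Y U z) = singEquiv l Y' U'
      (HHmap cellDeg cellD l (singSet_mono hY) (singSet_mono (sdiff_subset_sdiff hY hU)) z) :=
  (singPairModel Y U).map_equiv (singPairModel Y' U') isDifferential_cellD l
    (TopCat.toSSet.mapArrow.map (pairIncl hY hU)) (fun _ _ => rfl) _ _ z

end SingularModel

open Classical in
theorem toFinset_ofFn {X : Type*} {n : ℕ} (f : Fin n → X) :
    (List.ofFn f).toFinset = Finset.univ.image f := by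
  ext x
  simp

/-! ### Ordered chains of simplicial complexes. -/

section SimplicialModel

variable {X : Type u} [TopologicalSpace X]

open Classical in
/-- The ordered simplices of a simplicial complex. -/
def nerveSet (C : PreAbstractSimplicialComplex X) : Set (Cell X) :=
  {b | b.2.1 = 0 ∧ (b.1 = [] ∨ b.1.toFinset ∈ C.faces)}

theorem nerveSet_mono {C D : PreAbstractSimplicialComplex X} (h : C ≤ D) :
    nerveSet C ⊆ nerveSet D :=
  fun _ hb => ⟨hb.1, hb.2.imp id fun hb => h hb⟩

/-- The cell of an ordered simplex. -/
def nerveCell {C : PreAbstractSimplicialComplex X} {n : ℕ} (y : (orderedSSet C) _⦋n⦌) : Cell X :=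
  (List.ofFn y.1, emptySing X)

theorem nerveCell_injective {C : PreAbstractSimplicialComplex X} {n : ℕ} :
    Function.Injective (nerveCell (C := C) (n := n)) := by
  intro y y' h
  exact Subtype.ext (List.ofFn_injective (Prod.mk.inj h).1)

theorem range_nerveCell (C : PreAbstractSimplicialComplex X) (n : ℕ) :
    Set.range (nerveCell (C := C) (n := n)) = nerveSet C ∩ {b | cellDeg b = n + 1} := by
  classical
  ext ⟨σ, s⟩
  constructor
  · rintro ⟨y, hy⟩
    rw [← hy]
    refine ⟨⟨rfl, Or.inr ?_⟩, ?_⟩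
    · change (List.ofFn y.1).toFinset ∈ C.faces
      rw [toFinset_ofFn]
      convert! y.2
    · change (List.ofFn y.1).length + 0 = n + 1
      exact List.length_ofFn
  · rintro ⟨⟨h1, h2⟩, h3⟩
    have h1 : s.1 = 0 := h1
    have h3 : σ.length + s.1 = n + 1 := h3
    have hσ : σ.length = n + 1 := by omega
    have hσ' : σ = List.ofFn fun i : Fin (n + 1) => σ.get (Fin.cast hσ.symm i) := by
      refine List.ext_get (by simp [hσ]) fun i _ _ => by simp [-List.ofFn_succ]
    have h2 : σ.toFinset ∈ C.faces := by
      refine h2.resolve_left fun h => ?_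
      have h : σ = [] := h
      simp [h] at hσ
    rw [hσ', toFinset_ofFn] at h2
    refine ⟨⟨fun i : Fin (n + 1) => σ.get (Fin.cast hσ.symm i), by convert! h2⟩, ?_⟩
    rw [eq_emptySing h1]
    exact Prod.ext hσ'.symm rfl

/-- The ordered simplices of a simplicial complex as cells. -/
def nerveModel (C : PreAbstractSimplicialComplex X) :
    CellModel (B := Cell X) cellDeg cellD (orderedSSet C) where
  cell _ y := nerveCell y
  injective _ := nerveCell_injective
  deg_cell n y := List.length_ofFn
  d_cell n y := by
    have h0 : singBd (emptySing X) = 0 :=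
      (congrArg (pushL (emptySing X)) (show listBd (verts 0) = 0 by simp [verts, listBd])).trans
        (map_zero (pushL (emptySing X)))
    rw [nerveCell, cellD_single, h0, map_zero, smul_zero, add_zero]
    refine (congrArg (fun c => cross c (Finsupp.single (emptySing X) 1))
      (listBd_ofFn (n := n + 1) y.1)).trans ?_
    simp only [map_sum, LinearMap.sum_apply, map_smul, LinearMap.smul_apply, cross_single]
    rfl

/-- The cells of a pair of simplicial complexes. -/
def nervePairModel {C₀ C : PreAbstractSimplicialComplex X} (h : C₀ ≤ C) :
    PairModel (B := Cell X) cellDeg cellD (Arrow.mk (orderedIncl h)) (nerveSet C)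
      (nerveSet C₀) where
  right := nerveModel C
  left := nerveModel C₀
  comm _ _ := rfl
  range_right n := range_nerveCell C n
  range_left n := range_nerveCell C₀ n
  augmentation := by
    rintro ⟨σ, s⟩ h
    have h' : σ.length + s.1 = 0 := h
    have h1 : σ.length = 0 := by omega
    have h2 : s.1 = 0 := by omega
    exact ⟨h2, Or.inl (List.eq_nil_of_length_eq_zero h1)⟩

/-- Homology of a pair of simplicial complexes in terms of cells. -/
def nerveEquiv (l : ℕ) {C₀ C : PreAbstractSimplicialComplex X} (h : C₀ ≤ C) :
    HH (B := Cell X) cellDeg cellD l (nerveSet C) (nerveSet C₀) ≃+ simplicialH l h :=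
  (nervePairModel h).equiv isDifferential_cellD l

theorem simplicialHMap_nerveEquiv (l : ℕ) {C₀ C D₀ D : PreAbstractSimplicialComplex X}
    (hC : C₀ ≤ C) (hD : D₀ ≤ D) (h₀ : C₀ ≤ D₀) (h : C ≤ D)
    (z : HH (B := Cell X) cellDeg cellD l (nerveSet C) (nerveSet C₀)) :
    simplicialHMap l hC hD h₀ h (nerveEquiv l hC z) = nerveEquiv l hD
      (HHmap cellDeg cellD l (nerveSet_mono h) (nerveSet_mono h₀) z) :=
  (nervePairModel hC).map_equiv (nervePairModel hD) isDifferential_cellD l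
    (Arrow.homMk (u := orderedIncl h₀) (v := orderedIncl h) rfl) (fun _ _ => rfl) _ _ z

end SimplicialModel

end

/-! ## Barycentric subdivision -/

section Subdivision

theorem eq_of_supported {B N : Type*} [AddCommGroup N] {f g : (B →₀ ℤ) →ₗ[ℤ] N} {s : Set B}
    (h : ∀ b ∈ s, f (Finsupp.single b 1) = g (Finsupp.single b 1)) {c : B →₀ ℤ}
    (hc : c ∈ Finsupp.supported ℤ ℤ s) : f c = g c := by
  have := map_supported (f - g) (V := ⊥)
    (fun b hb => by rw [Submodule.mem_bot, LinearMap.sub_apply, h b hb, sub_self]) hc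
  rwa [Submodule.mem_bot, LinearMap.sub_apply, sub_eq_zero] at this

variable {m : ℕ}

/-- The barycenter of the affine simplex with vertices `v, w₁, …, wₙ`. -/
def bary (v : Simp m) (w : List (Simp m)) : Simp m :=
  haveI : Nonempty (Fin (v :: w).length) := ⟨⟨0, Nat.succ_pos _⟩⟩
  aff (v :: w).get stdSimplex.barycenter

theorem aff_barycenter_congr {n n' : ℕ} [Nonempty (Fin n)] [Nonempty (Fin n')] (h : n = n')
    {f : Fin n → Simp m} {g : Fin n' → Simp m} (hfg : ∀ i, f i = g (Fin.cast h i)) :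
    aff f stdSimplex.barycenter = aff g stdSimplex.barycenter := by
  subst h
  have : f = g := funext hfg
  rw [this]

theorem aff_bary {k : ℕ} (f : Fin m → Simp k) (v : Simp m) (w : List (Simp m)) :
    aff f (bary v w) = bary (aff f v) (w.map (aff f)) := by
  have : Nonempty (Fin (v :: w).length) := ⟨⟨0, Nat.succ_pos _⟩⟩
  have : Nonempty (Fin (aff f v :: w.map (aff f)).length) := ⟨⟨0, Nat.succ_pos _⟩⟩
  rw [bary, aff_aff]
  refine aff_barycenter_congr (by simp) fun i => ?_
  change aff f (v :: w)[i.1] = ((v :: w).map (aff f))[i.1]'_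
  rw [List.getElem_map]

/-- The homotopy between barycentric subdivision and the identity on affine simplices with at most
`n` vertices. -/
def listT : ℕ → List (Simp m) → (List (Simp m) →₀ ℤ)
  -- Faces are not structurally smaller lists, so the recursion runs on a bound for the number of
  -- vertices; `subT` takes the exact length.
  | 0, _ => 0
  | _ + 1, [] => 0
  | n + 1, v :: w => consL (bary v w) (Finsupp.single (v :: w) 1 -
      Finsupp.linearCombination ℤ (listT n) (listBd (v :: w)))

/-- The homotopy between barycentric subdivision and the identity. -/
def subT : (List (Simp m) →₀ ℤ) →ₗ[ℤ] (List (Simp m) →₀ ℤ) :=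
  Finsupp.linearCombination ℤ fun w => listT w.length w

theorem subT_nil : subT (Finsupp.single ([] : List (Simp m)) 1) = 0 := by
  simp [subT, listT]

/-- The faces of `v :: w` have exactly the length of `w`, so the recursion bound agrees with the one
in `subT`. -/
theorem subT_cons (v : Simp m) (w : List (Simp m)) : subT (Finsupp.single (v :: w) 1) =
    consL (bary v w) (Finsupp.single (v :: w) 1 - subT (listBd (v :: w))) := by
  have h : Finsupp.linearCombination ℤ (listT w.length) (listBd (v :: w)) =
      subT (listBd (v :: w)) := by
    refine eq_of_supported (fun w' hw' => ?_) (listBd_mem (v :: w))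
    have : w'.length = w.length := Nat.succ_injective hw'.1
    simp [subT, this]
  rw [← h, subT, Finsupp.linearCombination_single, one_smul]
  rfl

theorem subT_mem (w : List (Simp m)) :
    subT (Finsupp.single w 1) ∈ Finsupp.supported ℤ ℤ {w' | w'.length = w.length + 1} := by
  induction hn : w.length generalizing w with
  | zero =>
    rw [List.eq_nil_of_length_eq_zero hn, subT_nil]
    exact zero_mem _
  | succ n ih =>
    obtain ⟨v, w, rfl⟩ := List.exists_cons_of_length_eq_add_one hn
    rw [subT_cons]
    have hmem : Finsupp.single (v :: w) 1 - subT (listBd (v :: w)) ∈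
        Finsupp.supported ℤ ℤ {w' : List (Simp m) | w'.length = n + 1} := by
      refine sub_mem (single_mem_supported (by exact hn) 1) ?_
      exact map_supported subT (fun w' hw' => ih w' (by have := hw'.1; omega)) (listBd_mem _)
    refine map_supported (consL _) (fun w' hw' => ?_) hmem
    rw [consL_single]
    exact single_mem_supported (by exact congrArg (· + 1) hw') 1

/-- Affine maps preserve barycenters. By this naturality the homotopy passes to singular simplices.
-/
theorem mapL_aff_subT {k : ℕ} (f : Fin m → Simp k) (c : List (Simp m) →₀ ℤ) :
    mapL (aff f) (subT c) = subT (mapL (aff f) c) := by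
  refine linearMap_ext_single (f := mapL (aff f) ∘ₗ subT) (g := subT ∘ₗ mapL (aff f))
    (fun w => ?_) c
  rw [LinearMap.comp_apply, LinearMap.comp_apply, mapL_single]
  induction hn : w.length generalizing w with
  | zero => rw [List.eq_nil_of_length_eq_zero hn, List.map_nil, subT_nil, subT_nil, map_zero]
  | succ n ih =>
    obtain ⟨v, w, rfl⟩ := List.exists_cons_of_length_eq_add_one hn
    rw [List.map_cons, subT_cons, subT_cons, mapL_consL, aff_bary, map_sub, mapL_single,
      ← List.map_cons, ← mapL_listBd]
    congr 2
    refine eq_of_supported (f := mapL (aff f) ∘ₗ subT) (g := subT ∘ₗ mapL (aff f))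
      (fun w' hw' => ?_) (listBd_mem (v :: w))
    rw [LinearMap.comp_apply, LinearMap.comp_apply, mapL_single]
    exact ih w' (by have := hw'.1; omega)

/-- Barycentric subdivision of affine simplices. -/
abbrev subS : (List (Simp m) →₀ ℤ) →ₗ[ℤ] (List (Simp m) →₀ ℤ) := deform listD subT

theorem subS_nil : subS (Finsupp.single ([] : List (Simp m)) 1) = Finsupp.single [] 1 := by
  simp [deform_apply, subT_nil, listBd]

/-- The usual recursion for subdivision, the cone from the barycenter over the subdivided boundary,
follows from the cone formula. -/
theorem subS_cons (v : Simp m) (w : List (Simp m)) : subS (Finsupp.single (v :: w) 1) =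
    consL (bary v w) (subS (listBd (v :: w))) := by
  simp only [deform_apply, listD_single, subT_cons, listD_consL, map_sub, listD_listBd, map_zero]
  abel

/-- The convex hull of a list of points of a simplex. -/
def hull (w : List (Simp m)) : Set (Fin m → ℝ) := convexHull ℝ {x | ∃ y ∈ w, y.1 = x}

theorem hull_mono {w w' : List (Simp m)} (h : w ⊆ w') : hull w ⊆ hull w' :=
  convexHull_mono fun _ ⟨y, hy, hx⟩ => ⟨y, h hy, hx⟩

theorem mem_hull {w : List (Simp m)} {y : Simp m} (hy : y ∈ w) : y.1 ∈ hull w :=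
  subset_convexHull ℝ _ ⟨y, hy, rfl⟩

theorem aff_eq_sum {n : ℕ} (w : Fin n → Simp m) (t : Simp n) :
    (aff w t).1 = ∑ i, t i • (w i).1 := by
  ext j
  rw [Finset.sum_apply]
  rfl

theorem aff_get_mem_hull (w : List (Simp m)) (t : Simp w.length) : (aff w.get t).1 ∈ hull w := by
  rw [aff_eq_sum]
  exact (convex_convexHull ℝ _).sum_mem (fun i _ => t.2.1 i) t.2.2
    fun i _ => mem_hull (List.get_mem w i)

theorem bary_mem_hull (v : Simp m) (w : List (Simp m)) : (bary v w).1 ∈ hull (v :: w) :=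
  aff_get_mem_hull _ _

theorem dist_le_of_mem_hull {w : List (Simp m)} {x z : Fin m → ℝ} {r : ℝ}
    (h : ∀ y ∈ w, dist y.1 z ≤ r) (hx : x ∈ hull w) : dist x z ≤ r := by
  have : hull w ⊆ closedBall z r := by
    refine convexHull_min ?_ (convex_closedBall z r)
    rintro _ ⟨y, hy, rfl⟩
    exact h y hy
  exact this hx

theorem dist_le_of_mem_hull₂ {w : List (Simp m)} {x z : Fin m → ℝ} {r : ℝ}
    (h : ∀ y ∈ w, ∀ y' ∈ w, dist y y' ≤ r) (hx : x ∈ hull w) (hz : z ∈ hull w) :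
    dist x z ≤ r := by
  refine dist_le_of_mem_hull (fun y hy => ?_) hx
  rw [dist_comm]
  exact dist_le_of_mem_hull (fun y' hy' => h y' hy' y hy) hz

/-- A vertex minus the barycenter is the average of its differences to all n vertices. One of these
is zero, which gives the factor 1 - 1/n. -/
theorem dist_bary_le {v : Simp m} {w : List (Simp m)} {r : ℝ}
    (h : ∀ y ∈ v :: w, ∀ y' ∈ v :: w, dist y y' ≤ r) {N : ℕ} (hN : (v :: w).length ≤ N)
    {y : Simp m} (hy : y ∈ v :: w) : dist y.1 (bary v w).1 ≤ (1 - (N : ℝ)⁻¹) * r := by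
  have : Nonempty (Fin (v :: w).length) := ⟨⟨0, Nat.succ_pos _⟩⟩
  have hr : 0 ≤ r := dist_nonneg.trans (h y hy y hy)
  have hn : (0 : ℝ) < (v :: w).length := by simp; positivity
  set n := (v :: w).length with hn_def
  obtain ⟨k, rfl⟩ : ∃ k : Fin n, (v :: w).get k = y := List.get_of_mem hy
  have e1 : ((v :: w).get k).1 - (bary v w).1 =
      ∑ i, (n : ℝ)⁻¹ • (((v :: w).get k).1 - ((v :: w).get i).1) := by
    have e2 : (bary v w).1 = ∑ i, (n : ℝ)⁻¹ • ((v :: w).get i).1 := by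
      rw [bary, aff_eq_sum]
      refine Finset.sum_congr rfl fun i _ => ?_
      have : (stdSimplex.barycenter : Simp (v :: w).length) i = (n : ℝ)⁻¹ := by
        change ((Fintype.card (Fin n) : ℕ) : ℝ)⁻¹ = _
        rw [Fintype.card_fin]
      rw [this]
    simp_rw [smul_sub]
    rw [Finset.sum_sub_distrib, e2, Finset.sum_const, Finset.card_univ, Fintype.card_fin,
      ← Nat.cast_smul_eq_nsmul ℝ, smul_smul, mul_inv_cancel₀ hn.ne', one_smul]
  rw [dist_eq_norm, e1]
  refine (norm_sum_le _ _).trans ?_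
  rw [← Finset.add_sum_erase _ _ (Finset.mem_univ k), sub_self, smul_zero, norm_zero, zero_add]
  have e3 : ∀ i ∈ Finset.univ.erase k,
      ‖(n : ℝ)⁻¹ • (((v :: w).get k).1 - ((v :: w).get i).1)‖ ≤ (n : ℝ)⁻¹ * r := by
    intro i _
    rw [norm_smul, norm_inv, RCLike.norm_natCast]
    refine mul_le_mul_of_nonneg_left ?_ (by positivity)
    rw [← dist_eq_norm]
    exact h _ hy _ (List.get_mem _ i)
  refine (Finset.sum_le_sum e3).trans ?_
  rw [Finset.sum_const, Finset.card_erase_of_mem (Finset.mem_univ k), Finset.card_univ,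
    Fintype.card_fin, ← Nat.cast_smul_eq_nsmul ℝ, smul_eq_mul, ← mul_assoc,
    Nat.cast_sub (by exact_mod_cast hn), Nat.cast_one, sub_mul, mul_inv_cancel₀ hn.ne', one_mul]
  refine mul_le_mul_of_nonneg_right ?_ hr
  have : (n : ℝ) ≤ N := by exact_mod_cast hN
  exact sub_le_sub_left (inv_anti₀ hn this) 1

/-- A simplex of the subdivision is the barycenter joined to one in a subdivided face, which lies in
the hull. A fixed `N` keeps the factor the same for all faces. -/
theorem subS_mem (N : ℕ) {w : List (Simp m)} {r : ℝ} (hr : 0 ≤ r) (hN : w.length ≤ N)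
    (h : ∀ y ∈ w, ∀ y' ∈ w, dist y y' ≤ r) :
    subS (Finsupp.single w 1) ∈ Finsupp.supported ℤ ℤ {u | u.length = w.length ∧
      (∀ x ∈ u, x.1 ∈ hull w) ∧ ∀ x ∈ u, ∀ y ∈ u, dist x y ≤ (1 - (N : ℝ)⁻¹) * r} := by
  induction hn : w.length generalizing w with
  | zero =>
    rw [List.eq_nil_of_length_eq_zero hn, subS_nil]
    exact single_mem_supported (by simp) 1
  | succ n ih =>
    obtain ⟨v, w, rfl⟩ := List.exists_cons_of_length_eq_add_one hn
    rw [subS_cons]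
    have hmem : subS (listBd (v :: w)) ∈ Finsupp.supported ℤ ℤ {u | u.length = n ∧
        (∀ x ∈ u, x.1 ∈ hull (v :: w)) ∧
        ∀ x ∈ u, ∀ y ∈ u, dist x y ≤ (1 - (N : ℝ)⁻¹) * r} := by
      refine map_supported _ (fun w' hw' => ?_) (listBd_mem (v :: w))
      have hsub := hw'.2.subset
      refine supported_mono' ?_ (ih (w := w') (by have := hw'.1; omega)
        (fun y hy y' hy' => h y (hsub hy) y' (hsub hy')) (by have := hw'.1; omega))
      rintro u ⟨h1, h2, h3⟩
      exact ⟨h1, fun x hx => hull_mono hsub (h2 x hx), h3⟩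
    refine map_supported (consL _) ?_ hmem
    rintro u ⟨h1, h2, h3⟩
    rw [consL_single]
    have hb : ∀ x ∈ u, dist x (bary v w) ≤ (1 - (N : ℝ)⁻¹) * r := fun x hx =>
      dist_le_of_mem_hull (fun y hy => dist_bary_le h hN hy) (h2 x hx)
    refine single_mem_supported (by
      refine ⟨congrArg (· + 1) h1, List.forall_mem_cons.2 ⟨bary_mem_hull v w, h2⟩, ?_⟩
      intro x hx y hy
      rcases List.mem_cons.1 hx with rfl | hx <;> rcases List.mem_cons.1 hy with rfl | hy
      · rw [dist_self]
        refine mul_nonneg (sub_nonneg.2 ?_) hr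
        exact inv_le_one_of_one_le₀ (by exact_mod_cast (by omega : 1 ≤ N))
      · rw [dist_comm]
        exact hb y hy
      · exact hb x hx
      · exact h3 x hx y hy) 1

/-- Subdivision keeps the number of vertices, so the factor can be iterated. The denominator
`w.length + 1` makes it less than 1 for the empty list too. -/
theorem subS_pow_mem (k : ℕ) {w : List (Simp m)} {r : ℝ} (hr : 0 ≤ r)
    (h : ∀ y ∈ w, ∀ y' ∈ w, dist y y' ≤ r) :
    (subS ^ k) (Finsupp.single w 1) ∈ Finsupp.supported ℤ ℤ {u | u.length = w.length ∧
      ∀ x ∈ u, ∀ y ∈ u, dist x y ≤ (1 - ((w.length + 1 : ℕ) : ℝ)⁻¹) ^ k * r} := by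
  induction k with
  | zero => exact single_mem_supported (by simpa using h) 1
  | succ k ih =>
    rw [pow_succ' (subS (m := m)), Module.End.mul_apply]
    refine map_supported subS ?_ ih
    rintro u ⟨h1, h2⟩
    have h0 : 0 ≤ (1 - ((w.length + 1 : ℕ) : ℝ)⁻¹) :=
      sub_nonneg.2 (inv_le_one_of_one_le₀ (by exact_mod_cast Nat.succ_pos _))
    refine supported_mono' ?_ (subS_mem (w.length + 1) (by positivity) (by omega) h2)
    rintro u' ⟨h3, -, h4⟩
    refine ⟨h3.trans h1, fun x hx y hy => (h4 x hx y hy).trans_eq ?_⟩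
    rw [pow_succ]
    ring

end Subdivision

/-! ### Small singular simplices. -/

section SmallSimplices

variable {X : Type u}

/-- The homotopy between barycentric subdivision and the identity on singular chains. -/
def singT [TopologicalSpace X] : (Sing X →₀ ℤ) →ₗ[ℤ] (Sing X →₀ ℤ) :=
  Finsupp.linearCombination ℤ fun s => pushL s (subT (Finsupp.single (verts s.1) 1))

section

variable [TopologicalSpace X]

/-- Allows all iterated subdivisions of `s` to be computed in one standard simplex. -/
theorem singT_pushL (s : Sing X) (c : List (Simp s.1) →₀ ℤ) :
    singT (pushL s c) = pushL s (subT c) := by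
  refine linearMap_ext_single (f := singT ∘ₗ pushL s) (g := pushL s ∘ₗ subT) (fun w => ?_) c
  rw [LinearMap.comp_apply, LinearMap.comp_apply, pushL_single, singT,
    Finsupp.linearCombination_single, one_smul]
  have h := pushL_push s w (subT (Finsupp.single (verts w.length) 1))
  rw [mapL_aff_subT, mapL_single, map_aff_verts] at h
  exact h

theorem deform_pushL (s : Sing X) (c : List (Simp s.1) →₀ ℤ) :
    deform singD singT (pushL s c) = pushL s (subS c) := by
  simp only [deform_apply, map_sub, singT_pushL, singD_pushL]

theorem deform_pow_single (k : ℕ) (s : Sing X) : (deform singD singT ^ k) (Finsupp.single s 1) =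
    pushL s ((subS ^ k) (Finsupp.single (verts s.1) 1)) := by
  induction k with
  | zero =>
    change _ = pushL s (Finsupp.single (verts s.1) 1)
    rw [pushL_single, push_verts]
    rfl
  | succ k ih =>
    rw [pow_succ', Module.End.mul_apply, ih, deform_pushL, pow_succ', Module.End.mul_apply]

theorem singT_single_mem (s : Sing X) : singT (Finsupp.single s 1) ∈
    Finsupp.supported ℤ ℤ {s' : Sing X | s'.1 = s.1 + 1 ∧ s'.carrier ⊆ s.carrier} := by
  rw [singT, Finsupp.linearCombination_single, one_smul]
  refine map_supported _ (fun w hw => ?_) (subT_mem (verts s.1))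
  rw [pushL_single]
  exact single_mem_supported (by exact ⟨hw.trans (by simp), carrier_push s w⟩) 1

open Classical in
/-- The subdivision homotopy on chains of cells. -/
def cellT : (Cell X →₀ ℤ) →ₗ[ℤ] (Cell X →₀ ℤ) :=
  Finsupp.linearCombination ℤ fun b =>
    -- The value on cells with a nonempty list is immaterial: subdivision is only applied to purely
    -- singular cells.
    if b.1 = [] then cross (Finsupp.single [] 1) (singT (Finsupp.single b.2 1)) else 0

theorem cellT_cross (c : Sing X →₀ ℤ) :
    cellT (cross (Finsupp.single [] 1) c) = cross (Finsupp.single [] 1) (singT c) :=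
  linearMap_ext_single (f := cellT ∘ₗ cross (Finsupp.single [] 1))
    (g := cross (Finsupp.single [] 1) ∘ₗ singT) (fun s => by simp [cellT]) c

theorem cellD_cross_nil (c : Sing X →₀ ℤ) :
    cellD (cross (Finsupp.single [] 1) c) = cross (Finsupp.single [] 1) (singD c) := by
  rw [cellD_cross]
  simp [listBd]

theorem deform_cross_nil (c : Sing X →₀ ℤ) :
    deform cellD cellT (cross (Finsupp.single [] 1) c) =
      cross (Finsupp.single [] 1) (deform singD singT c) := by
  simp only [deform_apply, map_sub, cellT_cross, cellD_cross_nil]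

theorem deform_pow_cross_nil (k : ℕ) (c : Sing X →₀ ℤ) :
    (deform cellD cellT ^ k) (cross (Finsupp.single [] 1) c) =
      cross (Finsupp.single [] 1) ((deform singD singT ^ k) c) := by
  induction k with
  | zero => rfl
  | succ k ih =>
    rw [pow_succ', Module.End.mul_apply, ih, deform_cross_nil, pow_succ', Module.End.mul_apply]

theorem cellT_single_mem (b : Cell X) {r : Set (Cell X)}
    (h : b.1 = [] → ∀ s' : Sing X, s'.1 = b.2.1 + 1 → s'.carrier ⊆ b.2.carrier → ([], s') ∈ r) :
    cellT (Finsupp.single b 1) ∈ Finsupp.supported ℤ ℤ r := by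
  rw [cellT, Finsupp.linearCombination_single, one_smul]
  split_ifs with hb
  · refine cross_mem (s := {[]}) ?_ (single_mem_supported (by exact rfl) 1)
      (singT_single_mem b.2)
    rintro _ rfl s' ⟨h1, h2⟩
    exact h hb s' h1 h2
  · exact zero_mem _

theorem raisesDegree_cellT : RaisesDegree (B := Cell X) cellDeg cellT := fun b =>
  cellT_single_mem b fun hb s' h _ => by
    change ([] : List X).length + s'.1 = b.1.length + b.2.1 + 1
    rw [hb, h, ← add_assoc]

/-- A set of singular simplices that is defined by a hereditary condition on their images. -/
structure Hereditary (V : Set (Cell X)) : Prop where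
  nil : ∀ b ∈ V, b.1 = []
  mono : ∀ s s' : Sing X, ([], s) ∈ V → s'.carrier ⊆ s.carrier → ([], s') ∈ V

theorem hereditary_singSet (Y : Set X) : Hereditary (singSet Y) :=
  ⟨fun _ hb => hb.1, fun _ _ h h' => ⟨rfl, h'.trans h.2⟩⟩

theorem Hereditary.inter {V W : Set (Cell X)} (hV : Hereditary V) (hW : Hereditary W) :
    Hereditary (V ∩ W) :=
  ⟨fun b hb => hV.nil b hb.1, fun s s' h h' => ⟨hV.mono s s' h.1 h', hW.mono s s' h.2 h'⟩⟩

theorem Hereditary.stable_cellT {V : Set (Cell X)} (hV : Hereditary V) : Stable cellT V :=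
  Stable.of_single fun ⟨σ, s⟩ hb => cellT_single_mem _ fun h s' _ h' => by
    obtain rfl : σ = [] := h
    exact hV.mono s s' hb h'

theorem Hereditary.stable_cellD {V : Set (Cell X)} (hV : Hereditary V) : Stable cellD V :=
  Stable.of_single fun ⟨σ, s⟩ hb => by
    obtain rfl : σ = [] := hV.nil _ hb
    exact cellD_single_mem _ (fun σ' h _ => by simp at h) fun s' _ h' => hV.mono s s' hb h'

end

variable [MetricSpace X]

/-- The singular simplices of diameter less than `η`. -/
def fineSet (η : ℝ) : Set (Cell X) :=
  {b | b.1 = [] ∧ ∀ x ∈ b.2.carrier, ∀ y ∈ b.2.carrier, dist x y < η}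

theorem hereditary_fineSet (η : ℝ) : Hereditary (fineSet (X := X) η) :=
  ⟨fun _ hb => hb.1, fun _ _ h h' => ⟨rfl, fun x hx y hy => h.2 x (h' hx) y (h' hy)⟩⟩

/-- Singular simplices are uniformly continuous by compactness, and the pieces of the subdivided
standard simplex shrink geometrically. -/
theorem exists_deform_pow_single_mem {η : ℝ} (hη : 0 < η) (s : Sing X) :
    ∃ k, (deform cellD cellT ^ k) (Finsupp.single ([], s) 1) ∈
      Finsupp.supported ℤ ℤ (fineSet η) := by
  have huc : UniformContinuous s.2 := CompactSpace.uniformContinuous_of_continuous s.2.continuous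
  obtain ⟨δ, hδ, h⟩ := Metric.uniformContinuous_iff.1 huc η hη
  obtain ⟨k, hk⟩ : ∃ k : ℕ, (1 - ((s.1 + 1 : ℕ) : ℝ)⁻¹) ^ k < δ :=
    exists_pow_lt_of_lt_one hδ (sub_lt_self 1 (by positivity))
  refine ⟨k, ?_⟩
  rw [← cross_single, deform_pow_cross_nil, deform_pow_single]
  have hdist : ∀ y ∈ verts s.1, ∀ y' ∈ verts s.1, dist y y' ≤ 1 := fun y _ y' _ =>
    (Metric.dist_le_diam_of_mem (bounded_stdSimplex _) y.2 y'.2).trans diam_stdSimplex_le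
  have hmem := map_supported (pushL s) (V := Finsupp.supported ℤ ℤ
    {s' : Sing X | ∀ x ∈ s'.carrier, ∀ y ∈ s'.carrier, dist x y < η}) ?_
    (subS_pow_mem k zero_le_one hdist)
  · refine cross_mem (s := {[]}) ?_ (single_mem_supported (by exact rfl) 1) hmem
    rintro _ rfl s' hs'
    exact ⟨rfl, hs'⟩
  · rintro u ⟨hu, hu'⟩
    rw [pushL_single]
    refine single_mem_supported ?_ 1
    rintro _ ⟨t, rfl⟩ _ ⟨t', rfl⟩
    refine h ((dist_le_of_mem_hull₂ hu' (aff_get_mem_hull u t) (aff_get_mem_hull u t')).trans_lt ?_)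
    rwa [mul_one, length_verts]

/-- Small simplices compute homology. -/
theorem HHmap_fine_bijective (l : ℕ) {V V₀ : Set (Cell X)} (hV : Hereditary V)
    (hV₀ : Hereditary V₀) (h₀ : V₀ ⊆ V) {η : ℝ} (hη : 0 < η) :
    Function.Bijective (HHmap cellDeg cellD l
      (inter_subset_left : V ∩ fineSet η ⊆ V) (inter_subset_left : V₀ ∩ fineSet η ⊆ V₀)) := by
  have hfine := hV.inter (hereditary_fineSet η)
  refine HHmap_bijective_of_deform isDifferential_cellD raisesDegree_cellT hV.stable_cellD
    hV.stable_cellT hV₀.stable_cellD hV₀.stable_cellT hfine.stable_cellD hfine.stable_cellT _ h₀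
    ?_ ?_ _
  · intro c hc
    -- The support is finite and fine simplices stay fine, so the maximal exponent works for the
    -- whole chain.
    have key : ∃ k, ∀ b ∈ c.support, (deform cellD cellT ^ k) (Finsupp.single b 1) ∈
        Finsupp.supported ℤ ℤ (V ∩ fineSet η) := by
      have h1 : ∀ b : Cell X, ∃ k, b ∈ V → (deform cellD cellT ^ k) (Finsupp.single b 1) ∈
          Finsupp.supported ℤ ℤ (V ∩ fineSet η) := by
        rintro ⟨σ, s⟩
        by_cases hb : (σ, s) ∈ V
        · obtain rfl : σ = [] := hV.nil _ hb
          obtain ⟨k, hk⟩ := exists_deform_pow_single_mem hη s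
          refine ⟨k, fun _ => mem_supported_inter.2 ⟨?_, hk⟩⟩
          exact (hV.stable_cellD.deform hV.stable_cellT).pow k _ (single_mem_supported hb 1)
        · exact ⟨0, fun h => (hb h).elim⟩
      choose k hk using h1
      refine ⟨c.support.sup k, fun b hb => ?_⟩
      obtain ⟨j, hj⟩ := Nat.exists_eq_add_of_le' (Finset.le_sup (f := k) hb)
      rw [hj, pow_add, Module.End.mul_apply]
      exact (hfine.stable_cellD.deform hfine.stable_cellT).pow j _ (hk b (hc hb))
    obtain ⟨k, hk⟩ := key
    exact ⟨k, map_supported _ (s := c.support) hk ((Finsupp.mem_supported _ _).2 subset_rfl)⟩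
  · rw [inter_right_comm, inter_eq_right.2 h₀]

end SmallSimplices

/-! ## Cones over singular simplices -/

section Cone

/-- A contraction of `A` to the point `z` along curves that move towards `z` with bounded speed. -/
structure Contraction {X : Type u} [MetricSpace X] (A : Set X) (z : X) (G : X → ℝ → X) :
    Prop where
  mem : z ∈ A
  continuousOn : ContinuousOn (fun p : X × ℝ => G p.1 p.2) (A ×ˢ Icc (0 : ℝ) 1)
  mapsTo : ∀ y ∈ A, ∀ t ∈ Icc (0 : ℝ) 1, G y t ∈ A
  one : ∀ y ∈ A, G y 1 = y
  speed : ∃ M, ∀ y ∈ A, ∀ t ∈ Icc (0 : ℝ) 1, dist (G y t) z ≤ t * M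

theorem simp_sum_succ {n : ℕ} (t : Simp (n + 1)) : ∑ i : Fin n, t i.succ = 1 - t 0 := by
  have := t.2.2
  rw [Fin.sum_univ_succ] at this
  exact eq_sub_of_add_eq' this

/-- The projection of a simplex from its first vertex to the opposite face. -/
def tailPt {n : ℕ} (t : Simp (n + 1)) (h : t 0 ≠ 1) : Simp n :=
  ⟨fun i => t i.succ / (1 - t 0), fun i => div_nonneg (t.2.1 _)
    (sub_nonneg.2 (stdSimplex.le_one t 0)), by
      rw [← Finset.sum_div, simp_sum_succ, div_self (sub_ne_zero.2 h.symm)]⟩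

theorem tailPt_apply {n : ℕ} (t : Simp (n + 1)) (h : t 0 ≠ 1) (i : Fin n) :
    tailPt t h i = t i.succ / (1 - t 0) := rfl

theorem map_apply_eq_sum {n m : ℕ} (f : Fin n → Fin m) (t : Simp n) (j : Fin m) :
    stdSimplex.map f t j = ∑ i, if f i = j then t i else 0 := by
  rw [stdSimplex.map_coe, FunOnFinite.linearMap_apply_apply, Finset.sum_filter]

theorem map_succ_zero {n : ℕ} (t : Simp n) : stdSimplex.map Fin.succ t 0 = 0 := by
  rw [map_apply_eq_sum]
  simp [Fin.succ_ne_zero]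

theorem tailPt_map_succ {n : ℕ} (t : Simp n) (h) :
    tailPt (stdSimplex.map Fin.succ t) h = t := by
  ext i
  rw [tailPt_apply, map_succ_zero, sub_zero, div_one, map_apply_eq_sum]
  simp

theorem map_succAbove_succ_zero {k : ℕ} (i : Fin (k + 1)) (t : Simp (k + 1)) :
    stdSimplex.map i.succ.succAbove t 0 = t 0 := by
  rw [map_apply_eq_sum, Fin.sum_univ_succ]
  simp [Fin.succ_ne_zero]

theorem tailPt_map_succAbove_succ {k : ℕ} (i : Fin (k + 1)) (t : Simp (k + 1)) (h) (h') :
    tailPt (stdSimplex.map i.succ.succAbove t) h = stdSimplex.map i.succAbove (tailPt t h') := by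
  ext j
  rw [tailPt_apply, map_succAbove_succ_zero, map_apply_eq_sum, map_apply_eq_sum,
    Fin.sum_univ_succ]
  simp [Fin.succ_succAbove_succ, (Fin.succ_ne_zero _).symm, tailPt_apply, Finset.sum_div,
    ite_div]

variable {X : Type u} [MetricSpace X]

open Classical in
/-- The cone over a singular simplex, as a map. -/
def coneFun (z : X) (G : X → ℝ → X) {n : ℕ} (τ : C(Simp n, X)) (t : Simp (n + 1)) : X :=
  if h : t 0 = 1 then z else G (τ (tailPt t h)) (1 - t 0)

theorem one_sub_mem_Icc {n : ℕ} (t : Simp (n + 1)) : 1 - t 0 ∈ Icc (0 : ℝ) 1 :=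
  ⟨sub_nonneg.2 (stdSimplex.le_one t 0), sub_le_self _ (t.2.1 0)⟩

theorem continuous_coord {n : ℕ} (i : Fin n) : Continuous fun t : Simp n => t i :=
  (continuous_apply i).comp continuous_subtype_val

variable {A : Set X} {z : X} {G : X → ℝ → X}

/-- Away from the apex this is a composition. At the apex, where the projection to the base is
undefined, the speed bound forces convergence to `z`. -/
theorem Contraction.continuous_coneFun (hG : Contraction A z G) {n : ℕ} {τ : C(Simp n, X)}
    (hτ : Set.range τ ⊆ A) : Continuous (coneFun z G τ) := by
  rw [continuous_iff_continuousAt]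
  intro t₀
  by_cases h₀ : t₀ 0 = 1
  · have hval : coneFun z G τ t₀ = z := dif_pos h₀
    obtain ⟨M, hM⟩ := hG.speed
    rw [ContinuousAt, hval, tendsto_iff_dist_tendsto_zero]
    have hlim : Tendsto (fun t : Simp (n + 1) => (1 - t 0) * M) (𝓝 t₀) (𝓝 0) := by
      have : Continuous fun t : Simp (n + 1) => (1 - t 0) * M :=
        (continuous_const.sub (continuous_coord 0)).mul continuous_const
      simpa [h₀] using this.tendsto t₀
    refine squeeze_zero' (Eventually.of_forall fun _ => dist_nonneg) ?_ hlim
    refine Eventually.of_forall fun t => ?_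
    by_cases h : t 0 = 1
    · simp [coneFun, h]
    · rw [coneFun, dif_neg h]
      exact hM _ (hτ ⟨_, rfl⟩) _ (one_sub_mem_Icc t)
  · have hopen : IsOpen {t : Simp (n + 1) | t 0 ≠ 1} :=
      isOpen_ne_fun (continuous_coord 0) continuous_const
    refine ContinuousOn.continuousAt (s := {t : Simp (n + 1) | t 0 ≠ 1}) ?_ (hopen.mem_nhds h₀)
    rw [continuousOn_iff_continuous_domRestrict]
    have heq : ({t : Simp (n + 1) | t 0 ≠ 1}.domRestrict (coneFun z G τ)) =
        (fun p : X × ℝ => G p.1 p.2) ∘ fun t : {t : Simp (n + 1) | t 0 ≠ 1} =>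
          (τ (tailPt t.1 t.2), 1 - t.1 0) := by
      ext t
      exact dif_neg t.2
    rw [heq]
    refine hG.continuousOn.comp_continuous ?_ fun t =>
      ⟨hτ ⟨_, rfl⟩, one_sub_mem_Icc t.1⟩
    refine Continuous.prodMk (τ.continuous.comp ?_) ?_
    · refine Continuous.subtype_mk (continuous_pi fun i => ?_) _
      refine Continuous.div ((continuous_coord _).comp continuous_subtype_val) ?_
        fun t => sub_ne_zero.2 (Ne.symm t.2)
      exact continuous_const.sub ((continuous_coord 0).comp continuous_subtype_val)
    · exact continuous_const.sub ((continuous_coord 0).comp continuous_subtype_val)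

open Classical in
/-- The cone over a singular simplex. -/
def coneSing (z : X) (G : X → ℝ → X) (s : Sing X) : Sing X :=
  -- The default value keeps the number of vertices, so `coneT` raises the degree unconditionally.
  ⟨s.1 + 1, if h : Continuous (coneFun z G s.2) then ⟨_, h⟩ else ContinuousMap.const _ z⟩

theorem Contraction.coneSing_eq (hG : Contraction A z G) {s : Sing X} (hs : s.carrier ⊆ A) :
    coneSing z G s = ⟨s.1 + 1, ⟨coneFun z G s.2, hG.continuous_coneFun hs⟩⟩ := by
  rw [coneSing, dif_pos (hG.continuous_coneFun hs)]

theorem Contraction.carrier_coneSing (hG : Contraction A z G) {s : Sing X}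
    (hs : s.carrier ⊆ A) : (coneSing z G s).carrier ⊆ A := by
  rw [hG.coneSing_eq hs]
  rintro _ ⟨t, rfl⟩
  change coneFun z G s.2 t ∈ A
  by_cases h : t 0 = 1
  · rw [coneFun, dif_pos h]
    exact hG.mem
  · rw [coneFun, dif_neg h]
    exact hG.mapsTo _ (hs ⟨_, rfl⟩) _ (one_sub_mem_Icc t)

/-- The face opposite to the apex is the base, and the other faces are the cones over the faces of
the base. -/
theorem Contraction.singBd_coneSing (hG : Contraction A z G) {s : Sing X}
    (hs : s.carrier ⊆ A) : singBd (coneSing z G s) =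
      Finsupp.single s 1 - Finsupp.lmapDomain ℤ ℤ (coneSing z G) (singBd s) := by
  rw [hG.coneSing_eq hs, singBd_mk, Fin.sum_univ_succ, sub_eq_add_neg]
  congr 1
  · rw [Fin.val_zero, pow_zero, one_smul]
    congr 1
    refine Sigma.ext rfl (heq_of_eq ?_)
    ext t
    change coneFun z G s.2 (stdSimplex.map (Fin.succAbove 0) t) = s.2 t
    rw [Fin.succAbove_zero]
    have h0 : stdSimplex.map Fin.succ t 0 ≠ (1 : ℝ) := by
      rw [map_succ_zero]
      exact zero_ne_one
    rw [coneFun, dif_neg h0, tailPt_map_succ, map_succ_zero, sub_zero]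
    exact hG.one _ (hs ⟨_, rfl⟩)
  · obtain ⟨n, τ⟩ := s
    cases n with
    | zero =>
      -- The cone over the empty simplex is the point `z`; its only face is the empty simplex.
      have h0 : singBd (⟨0, τ⟩ : Sing X) = 0 := by
        simp only [singBd, verts, List.ofFn_zero, listBd, map_zero]
      rw [h0, map_zero, neg_zero]
      rfl
    | succ k =>
      rw [singBd_mk, map_sum, ← Finset.sum_neg_distrib]
      refine Finset.sum_congr rfl fun i _ => ?_
      rw [map_smul, Fin.val_succ, pow_succ, mul_neg_one, neg_smul]
      congr 2
      refine Eq.trans ?_ Finsupp.mapDomain_single.symm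
      congr 1
      rw [hG.coneSing_eq (by
        rintro _ ⟨t, rfl⟩
        exact hs ⟨_, rfl⟩)]
      refine Sigma.ext rfl (heq_of_eq ?_)
      ext t
      change coneFun z G τ (stdSimplex.map i.succ.succAbove t) = coneFun z G (τ.comp _) t
      by_cases h : t 0 = 1
      · rw [coneFun, dif_pos (by rw [map_succAbove_succ_zero, h]), coneFun, dif_pos h]
      · have h' : stdSimplex.map i.succ.succAbove t 0 ≠ (1 : ℝ) := by
          rwa [map_succAbove_succ_zero]
        rw [coneFun, dif_neg h', coneFun, dif_neg h, tailPt_map_succAbove_succ i t h' h,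
          map_succAbove_succ_zero]
        rfl

end Cone

/-! ### Contractibility of intersections of convex balls. -/

section Convexity

variable {X : Type u} [MetricSpace X]

/-- All slightly larger open balls are strongly convex. -/
def ConvexBeyond (a : ℝ) (q : X) : Prop :=
  ∃ b > a, ∀ e ∈ Ioc a b, StronglyConvex (ball q e)

theorem convexBeyond_of_lt {a : ℝ} (ha : 0 ≤ a) {P : Set X} {q : X} (hq : q ∈ P)
    (h : ENNReal.ofReal a < convRadiusSet P) : ConvexBeyond a q := by
  have h1 : ENNReal.ofReal a < convRadius q := h.trans_le (iInf₂_le q hq)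
  rw [convRadius, lt_iSup_iff] at h1
  obtain ⟨d, h1⟩ := h1
  rw [lt_iSup_iff] at h1
  obtain ⟨hd, h1⟩ := h1
  exact ⟨d, (ENNReal.ofReal_lt_ofReal_iff_of_nonneg ha).1 h1,
    fun e he => hd e ⟨ha.trans_lt he.1, he.2⟩⟩

/-- The closed ball is the intersection of slightly larger open balls. By uniqueness, the given path
is the one provided by each of these. -/
theorem ConvexBeyond.mem_closedBall {a : ℝ} {q : X} (h : ConvexBeyond a q) {x y : X}
    (hx : x ∈ closedBall q a) (hy : y ∈ closedBall q a) {γ : ℝ → X} (hγ : IsShortestPath γ x y)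
    {t : ℝ} (ht : t ∈ Icc (0 : ℝ) 1) : γ t ∈ closedBall q a := by
  obtain ⟨b, hb, h⟩ := h
  change dist (γ t) q ≤ a
  refine le_of_forall_gt_imp_ge_of_dense fun e he => ?_
  have hmin : min e b ∈ Ioc a b := ⟨lt_min he hb, min_le_right _ _⟩
  obtain ⟨Γ, -, hΓ⟩ := h _ hmin
  obtain ⟨-, h2, h3⟩ := hΓ x (closedBall_subset_ball hmin.1 hx) y (closedBall_subset_ball hmin.1 hy)
  rw [h3 γ hγ t ht]
  exact (mem_ball.1 (h2 t ht)).le.trans (min_le_left _ _)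

/-- The intersection of the balls of radius `a` with centers in the list `σ`. -/
def ballInter (a : ℝ) (σ : List X) : Set X := {z | ∀ q ∈ σ, z ∈ closedBall q a}

/-- Shortest paths from a common point stay in all the balls at once. One convex open ball around
them suffices for continuity. -/
theorem exists_contraction {a : ℝ} {σ : List X} (hσ : σ ≠ [])
    (h : ∀ q ∈ σ, ConvexBeyond a q) (hne : (ballInter a σ).Nonempty) :
    ∃ (z : X) (G : X → ℝ → X), Contraction (ballInter a σ) z G := by
  obtain ⟨z, hz⟩ := hne
  obtain ⟨q, hq⟩ := List.exists_mem_of_ne_nil σ hσ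
  obtain ⟨b, hb, h1⟩ := h q hq
  obtain ⟨Γ, hcont, hΓ⟩ := h1 b ⟨hb, le_rfl⟩
  have hsub : ∀ y ∈ ballInter a σ, y ∈ ball q b := fun y hy =>
    closedBall_subset_ball hb (hy q hq)
  have hpath : ∀ y ∈ ballInter a σ, IsShortestPath (Γ z y) z y := fun y hy =>
    (hΓ z (hsub z hz) y (hsub y hy)).1
  -- The speed is the distance of two points of one ball of radius `a`.
  refine ⟨z, Γ z, hz, ?_, ?_, fun y hy => (hpath y hy).2.1, a + a, ?_⟩
  · refine hcont.comp (f := fun p : X × ℝ => (z, p.1, p.2)) (by fun_prop) ?_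
    rintro ⟨y, t⟩ ⟨hy, ht⟩
    exact ⟨hsub z hz, hsub y hy, ht⟩
  · exact fun y hy t ht q' hq' => (h q' hq').mem_closedBall (hz q' hq') (hy q' hq') (hpath y hy) ht
  · intro y hy t ht
    have h2 := (hpath y hy).2.2 t ht 0 ⟨le_rfl, zero_le_one⟩
    rw [(hpath y hy).1, sub_zero, abs_of_nonneg ht.1] at h2
    rw [h2]
    refine mul_le_mul_of_nonneg_left ?_ ht.1
    exact (dist_triangle_right z y q).trans (add_le_add (hz q hq) (hy q hq))

end Convexity

/-! ## Nerves of coverings by balls -/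

section Coverings

variable {X : Type u} [MetricSpace X]

/-- The cells `(σ, s)` such that the balls with centers in `σ` have a common point and contain `s`,
and `s` is contained in a ball with center in `Q`. -/
def coverSet (a : ℝ) (Q : Set X) : Set (Cell X) :=
  {b | (∀ q ∈ b.1, q ∈ Q) ∧ b.2.carrier ⊆ ballInter a b.1 ∧ (ballInter a b.1).Nonempty ∧
    (b.2.1 = 0 ∨ ∃ q ∈ Q, b.2.carrier ⊆ closedBall q a)}

theorem ballInter_anti {a : ℝ} {σ σ' : List X} (h : σ' ⊆ σ) : ballInter a σ ⊆ ballInter a σ' :=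
  fun _ hz q hq => hz q (h hq)

theorem ballInter_cons {a : ℝ} {q : X} {σ : List X} {A : Set X} (hq : A ⊆ closedBall q a)
    (hσ : A ⊆ ballInter a σ) : A ⊆ ballInter a (q :: σ) := by
  intro z hz q' hq'
  rcases List.mem_cons.1 hq' with rfl | h
  · exact hq hz
  · exact hσ hz q' h

theorem coverSet_mono {a a' : ℝ} (ha : a ≤ a') {Q Q' : Set X} (hQ : Q ⊆ Q') :
    coverSet a Q ⊆ coverSet a' Q' := by
  have h : ∀ σ : List X, ballInter a σ ⊆ ballInter a' σ := fun σ z hz q hq =>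
    closedBall_subset_closedBall ha (hz q hq)
  rintro ⟨σ, s⟩ ⟨h1, h2, h3, h4⟩
  exact ⟨fun q hq => hQ (h1 q hq), h2.trans (h σ), h3.mono (h σ), h4.imp id fun ⟨q, hq, hs⟩ =>
    ⟨q, hQ hq, hs.trans (closedBall_subset_closedBall ha)⟩⟩

theorem stable_coverSet (a : ℝ) (Q : Set X) : Stable cellD (coverSet a Q) :=
  Stable.of_single fun ⟨σ, s⟩ ⟨h1, h2, h3, h4⟩ => cellD_single_mem _
    (fun σ' _ h => ⟨fun q hq => h1 q (h.subset hq), h2.trans (ballInter_anti h.subset),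
      h3.mono (ballInter_anti h.subset), h4⟩)
    (fun s' hs' h => ⟨h1, h.trans h2, h3, h4.elim (fun h0 => by
      have hs' : s'.1 + 1 = s.1 := hs'
      have h0 : s.1 = 0 := h0
      omega) fun ⟨q, hq, hs⟩ => Or.inr ⟨q, hq, h.trans hs⟩⟩)

/-! ### Adding a ball that contains a singular simplex -/

open Classical in
/-- The homotopy that adds the vertex `v s` to a cell `(σ, s)`. -/
def vertT (v : Sing X → X) : (Cell X →₀ ℤ) →ₗ[ℤ] (Cell X →₀ ℤ) :=
  Finsupp.linearCombination ℤ fun b =>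
    if b.2.1 = 0 then 0 else Finsupp.single (v b.2 :: b.1, b.2) 1

theorem vertT_single_of_eq {v : Sing X → X} {b : Cell X} (h : b.2.1 = 0) :
    vertT v (Finsupp.single b 1) = 0 := by
  simp [vertT, h]

theorem vertT_single_of_ne {v : Sing X → X} {b : Cell X} (h : b.2.1 ≠ 0) :
    vertT v (Finsupp.single b 1) = Finsupp.single (v b.2 :: b.1, b.2) 1 := by
  simp [vertT, h]

theorem vertT_cross {v : Sing X → X} {s : Sing X} (h : s.1 ≠ 0) (c : List X →₀ ℤ) :
    vertT v (cross c (Finsupp.single s 1)) = cross (consL (v s) c) (Finsupp.single s 1) :=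
  linearMap_ext_single (f := vertT v ∘ₗ cross.flip (Finsupp.single s 1))
    (g := cross.flip (Finsupp.single s 1) ∘ₗ consL (v s)) (fun σ => by
      simp only [LinearMap.comp_apply, LinearMap.flip_apply, cross_single, consL_single]
      exact vertT_single_of_ne (b := (σ, s)) h) c

theorem vertT_single_mem (v : Sing X → X) (b : Cell X) {r : Set (Cell X)}
    (h : b.2.1 ≠ 0 → (v b.2 :: b.1, b.2) ∈ r) :
    vertT v (Finsupp.single b 1) ∈ Finsupp.supported ℤ ℤ r := by
  by_cases h0 : b.2.1 = 0
  · rw [vertT_single_of_eq h0]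
    exact zero_mem _
  · rw [vertT_single_of_ne h0]
    exact single_mem_supported (h h0) 1

theorem raisesDegree_vertT (v : Sing X → X) :
    RaisesDegree (B := Cell X) cellDeg (vertT v) := fun b =>
  vertT_single_mem v b fun _ => by
    change (v b.2 :: b.1).length + b.2.1 = b.1.length + b.2.1 + 1
    rw [List.length_cons]
    omega

/-- Removing the new vertex returns the cell, and the terms with faces of σ cancel. What remains
lies over proper faces of the singular simplex. -/
theorem deform_vertT_mem (v : Sing X → X) (b : Cell X) :
    deform cellD (vertT v) (Finsupp.single b 1) ∈
      Finsupp.supported ℤ ℤ {b' : Cell X | b'.2.1 ≤ b.2.1 - 1} := by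
  obtain ⟨σ, s⟩ := b
  have hbd : ∀ σ : List X, cross (Finsupp.single σ 1) (singBd s) ∈
      Finsupp.supported ℤ ℤ {b' : Cell X | b'.2.1 ≤ s.1 - 1} := fun σ =>
    cross_mem (s := {σ}) (fun _ _ s' hs' => (by
      have := hs'.1
      exact (by omega : s'.1 ≤ s.1 - 1))) (single_mem_supported (by exact rfl) 1) (singBd_mem s)
  by_cases h0 : s.1 = 0
  · rw [deform_apply, vertT_single_of_eq (b := (σ, s)) h0, map_zero, sub_zero]
    refine sub_mem (single_mem_supported (by exact (by omega : s.1 ≤ s.1 - 1)) 1) ?_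
    have : vertT v (cellD (Finsupp.single (σ, s) 1)) ∈ Finsupp.supported ℤ ℤ (∅ : Set (Cell X)) := by
      refine map_supported (s := {b' : Cell X | b'.2.1 = 0}) _ (fun b' hb' => ?_)
        (cellD_single_mem _ (fun σ' _ _ => h0) (fun s' hs' _ => ?_))
      · rw [vertT_single_of_eq hb']
        exact zero_mem _
      · have hs' : s'.1 + 1 = s.1 := hs'
        omega
    exact supported_mono' (empty_subset _) this
  · have key : deform cellD (vertT v) (Finsupp.single (σ, s) 1) =
        (-1 : ℤ) ^ σ.length • cross (Finsupp.single (v s :: σ) 1) (singBd s) -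
          (-1 : ℤ) ^ σ.length • vertT v (cross (Finsupp.single σ 1) (singBd s)) := by
      rw [deform_apply, vertT_single_of_ne (b := (σ, s)) h0, cellD_single, cellD_single, map_add,
        vertT_cross h0, listBd_cons, map_sub, LinearMap.sub_apply, cross_single, map_smul,
        List.length_cons, pow_succ]
      simp only [mul_neg, mul_one, neg_smul]
      abel
    rw [key]
    refine sub_mem (Submodule.smul_mem _ _ (hbd _)) (Submodule.smul_mem _ _ ?_)
    exact map_supported _ (fun b' hb' => vertT_single_mem v b' fun _ => hb') (hbd σ)

theorem stable_vertT {a : ℝ} {Q : Set X} {v : Sing X → X}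
    (hv : ∀ s : Sing X, (∃ q ∈ Q, s.carrier ⊆ closedBall q a) →
      v s ∈ Q ∧ s.carrier ⊆ closedBall (v s) a) : Stable (vertT v) (coverSet a Q) :=
  Stable.of_single fun ⟨σ, s⟩ ⟨h1, h2, _, h4⟩ => vertT_single_mem v _ fun h0 => by
    obtain ⟨hq, hs⟩ := hv s (h4.resolve_left h0)
    refine ⟨fun q hq' => ?_, ballInter_cons hs h2,
      (carrier_nonempty h0).mono (ballInter_cons hs h2), Or.inr ⟨_, hq, hs⟩⟩
    rcases List.mem_cons.1 hq' with rfl | h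
    · exact hq
    · exact h1 q h

/-- The intersection over the empty list is the whole space, so the augmentation cell needs a point
of `X`. -/
theorem nerveSet_cech [Nonempty X] (a : ℝ) (Q : Set X) :
    nerveSet (cech a Q) = coverSet a Q ∩ {b | b.2.1 = 0} := by
  classical
  ext ⟨σ, s⟩
  constructor
  · rintro ⟨h0, h⟩
    have h0 : s.1 = 0 := h0
    refine ⟨⟨?_, ?_, ?_, Or.inl h0⟩, h0⟩
    · rcases h with h | ⟨-, h, -⟩
      · have h : σ = [] := h
        simp [h]
      · exact fun q hq => h (Finset.mem_coe.2 (List.mem_toFinset.2 hq))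
    · rw [carrier_eq_empty h0]
      exact empty_subset _
    · rcases h with h | ⟨-, -, z, hz⟩
      · have h : σ = [] := h
        exact ⟨Classical.arbitrary X, by simp [ballInter, h]⟩
      · exact ⟨z, fun q hq => mem_iInter₂.1 hz q (List.mem_toFinset.2 hq)⟩
  · rintro ⟨⟨h1, -, ⟨z, hz⟩, -⟩, h0⟩
    refine ⟨h0, ?_⟩
    by_cases hσ : σ = []
    · exact Or.inl hσ
    · refine Or.inr ⟨List.toFinset_nonempty_iff _ |>.2 hσ, fun q hq => ?_, z, ?_⟩
      · exact h1 q (List.mem_toFinset.1 (Finset.mem_coe.1 hq))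
      · exact mem_iInter₂.2 fun q hq => hz q (List.mem_toFinset.1 hq)

theorem nerveSet_subset_coverSet [Nonempty X] (a : ℝ) (Q : Set X) :
    nerveSet (cech a Q) ⊆ coverSet a Q := by
  rw [nerveSet_cech]
  exact inter_subset_left

/-- The homology of a pair of Čech complexes in terms of the covering by balls. -/
theorem HHmap_nerve_bijective [Nonempty X] (l : ℕ) (a : ℝ) {Q₀ Q : Set X} (hQ : Q₀ ⊆ Q) :
    Function.Bijective (HHmap cellDeg cellD l (nerveSet_subset_coverSet a Q)
      (nerveSet_subset_coverSet a Q₀)) := by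
  -- One choice of centers must preserve both coverings, so centers in `Q₀` are preferred whenever
  -- possible.
  have h : ∀ s : Sing X, ∃ q, ((∃ q ∈ Q, s.carrier ⊆ closedBall q a) →
      q ∈ Q ∧ s.carrier ⊆ closedBall q a) ∧ ((∃ q ∈ Q₀, s.carrier ⊆ closedBall q a) →
      q ∈ Q₀ ∧ s.carrier ⊆ closedBall q a) := by
    intro s
    by_cases h0 : ∃ q ∈ Q₀, s.carrier ⊆ closedBall q a
    · obtain ⟨q, hq, hs⟩ := h0
      exact ⟨q, fun _ => ⟨hQ hq, hs⟩, fun _ => ⟨hq, hs⟩⟩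
    · by_cases h1 : ∃ q ∈ Q, s.carrier ⊆ closedBall q a
      · obtain ⟨q, hq, hs⟩ := h1
        exact ⟨q, fun _ => ⟨hq, hs⟩, fun h => (h0 h).elim⟩
      · exact ⟨Classical.arbitrary X, fun h => (h1 h).elim, fun h => (h0 h).elim⟩
  choose v hv hv₀ using h
  have h0 : Stable cellD {b : Cell X | b.2.1 = 0} := Stable.of_single fun b hb =>
    cellD_single_mem b (fun _ _ _ => hb) fun s' hs' _ => by
      have hb : b.2.1 = 0 := hb
      omega
  have h1 : Stable (vertT v) {b : Cell X | b.2.1 = 0} := Stable.of_single fun b hb =>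
    vertT_single_mem v b fun h => (h hb).elim
  have hS := stable_vertT hv
  refine HHmap_bijective_of_deform isDifferential_cellD (raisesDegree_vertT v)
    (stable_coverSet a Q) hS (stable_coverSet a Q₀) (stable_vertT hv₀) ?_ ?_ _
    (coverSet_mono le_rfl hQ) ?_ ?_ _
  · rw [nerveSet_cech]
    exact (stable_coverSet a Q).inter h0
  · rw [nerveSet_cech]
    exact hS.inter h1
  · intro c hc
    rw [nerveSet_cech]
    exact exists_deform_pow_mem (fun b => b.2.1) (stable_coverSet a Q) hS
      (fun b _ => deform_vertT_mem v b) hc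
  · rw [nerveSet_cech, nerveSet_cech, inter_right_comm, inter_eq_right.2 (coverSet_mono le_rfl hQ)]

/-! ### Coning in intersections of balls -/

/-- The homotopy that replaces the singular simplex of a cell `(σ, s)` by a cone. -/
def coneT (z : List X → X) (G : List X → X → ℝ → X) : (Cell X →₀ ℤ) →ₗ[ℤ] (Cell X →₀ ℤ) :=
  Finsupp.linearCombination ℤ fun b => match b.1 with
    | [] => 0
    | q :: σ => (-1 : ℤ) ^ (q :: σ).length •
      Finsupp.single (q :: σ, coneSing (z (q :: σ)) (G (q :: σ)) b.2) 1

variable {z : List X → X} {G : List X → X → ℝ → X}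

theorem coneT_single_nil (s : Sing X) : coneT z G (Finsupp.single ([], s) 1) = 0 := by
  simp [coneT]

theorem coneT_single_of_ne {σ : List X} (h : σ ≠ []) (s : Sing X) :
    coneT z G (Finsupp.single (σ, s) 1) =
      (-1 : ℤ) ^ σ.length • Finsupp.single (σ, coneSing (z σ) (G σ) s) 1 := by
  cases σ with
  | nil => exact (h rfl).elim
  | cons q σ => simp [coneT]

theorem coneT_cross {σ : List X} (h : σ ≠ []) (c : Sing X →₀ ℤ) :
    coneT z G (cross (Finsupp.single σ 1) c) = (-1 : ℤ) ^ σ.length •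
      cross (Finsupp.single σ 1) (Finsupp.lmapDomain ℤ ℤ (coneSing (z σ) (G σ)) c) :=
  linearMap_ext_single (f := coneT z G ∘ₗ cross (Finsupp.single σ 1))
    (g := (-1 : ℤ) ^ σ.length • cross (Finsupp.single σ 1) ∘ₗ
      Finsupp.lmapDomain ℤ ℤ (coneSing (z σ) (G σ))) (fun s => by
      simp only [LinearMap.comp_apply, LinearMap.smul_apply, Finsupp.lmapDomain_apply,
        Finsupp.mapDomain_single, cross_single]
      exact coneT_single_of_ne h s) c

theorem coneT_single_mem (b : Cell X) {r : Set (Cell X)}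
    (h : b.1 ≠ [] → (b.1, coneSing (z b.1) (G b.1) b.2) ∈ r) :
    coneT z G (Finsupp.single b 1) ∈ Finsupp.supported ℤ ℤ r := by
  obtain ⟨σ, s⟩ := b
  by_cases h0 : σ = []
  · rw [h0, coneT_single_nil]
    exact zero_mem _
  · rw [coneT_single_of_ne h0]
    exact Submodule.smul_mem _ _ (single_mem_supported (h h0) 1)

variable (z G) in
theorem raisesDegree_coneT : RaisesDegree (B := Cell X) cellDeg (coneT z G) := fun b =>
  coneT_single_mem b fun _ => by
    change b.1.length + (b.2.1 + 1) = b.1.length + b.2.1 + 1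
    omega

/-- The base of the cone returns the cell, as the two signs multiply to 1, and the cones over faces
cancel. What remains has a vertex of σ removed. -/
theorem deform_coneT_mem {a : ℝ} {b : Cell X}
    (hG : b.1 ≠ [] → Contraction (ballInter a b.1) (z b.1) (G b.1))
    (hb : b.2.carrier ⊆ ballInter a b.1) :
    deform cellD (coneT z G) (Finsupp.single b 1) ∈
      Finsupp.supported ℤ ℤ {b' : Cell X | b'.1.length ≤ b.1.length - 1} := by
  obtain ⟨σ, s⟩ := b
  have hbd : ∀ s : Sing X, cross (listBd σ) (Finsupp.single s 1) ∈
      Finsupp.supported ℤ ℤ {b' : Cell X | b'.1.length ≤ σ.length - 1} := fun s =>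
    cross_mem (t := {s}) (fun σ' hσ' _ _ => (by
      have := hσ'.1
      exact (by omega : σ'.length ≤ σ.length - 1))) (listBd_mem σ)
      (single_mem_supported (by exact rfl) 1)
  by_cases h0 : σ = []
  · subst h0
    rw [deform_apply, coneT_single_nil, map_zero, sub_zero]
    refine sub_mem (single_mem_supported (by exact Nat.zero_le _) 1) ?_
    have : coneT z G (cellD (Finsupp.single ([], s) 1)) ∈
        Finsupp.supported ℤ ℤ (∅ : Set (Cell X)) := by
      refine map_supported (s := {b' : Cell X | b'.1 = []}) _ ?_
        (cellD_single_mem _ (fun σ' h _ => by simp at h) (fun s' _ _ => rfl))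
      rintro ⟨σ', s'⟩ h
      obtain rfl : σ' = [] := h
      rw [coneT_single_nil]
      exact zero_mem _
    exact supported_mono' (empty_subset _) this
  · have key : deform cellD (coneT z G) (Finsupp.single (σ, s) 1) =
        - ((-1 : ℤ) ^ σ.length • cross (listBd σ) (Finsupp.single (coneSing (z σ) (G σ) s) 1)) -
          coneT z G (cross (listBd σ) (Finsupp.single s 1)) := by
      have hs : (-1 : ℤ) ^ σ.length * (-1 : ℤ) ^ σ.length = 1 := by
        rw [← mul_pow]
        simp
      rw [deform_apply, coneT_single_of_ne h0, map_smul, cellD_single, cellD_single, map_add,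
        map_smul, coneT_cross h0, (hG h0).singBd_coneSing hb, map_sub, cross_single, smul_add,
        smul_smul, smul_smul, hs, one_smul, one_smul]
      abel
    rw [key]
    refine sub_mem (neg_mem (Submodule.smul_mem _ _ (hbd _))) ?_
    exact map_supported _ (fun b' hb' => coneT_single_mem b' fun _ => hb') (hbd s)

theorem stable_coneT {a : ℝ} {Q : Set X} (hG : ∀ σ : List X, σ ≠ [] → (∀ q ∈ σ, q ∈ Q) →
    (ballInter a σ).Nonempty → Contraction (ballInter a σ) (z σ) (G σ)) :
    Stable (coneT z G) (coverSet a Q) :=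
  Stable.of_single fun ⟨σ, s⟩ ⟨h1, h2, h3, _⟩ => coneT_single_mem _ fun h0 => by
    have h := (hG σ h0 h1 h3).carrier_coneSing h2
    obtain ⟨q, hq⟩ := List.exists_mem_of_ne_nil σ h0
    exact ⟨h1, h, h3, Or.inr ⟨q, h1 q hq, h.trans fun y hy => hy q hq⟩⟩

/-- The singular simplices that are contained in a ball of radius `a` with center in `Q`. -/
def smallSet (a : ℝ) (Q : Set X) : Set (Cell X) := coverSet a Q ∩ {b | b.1.length = 0}

theorem smallSet_subset_coverSet (a : ℝ) (Q : Set X) : smallSet a Q ⊆ coverSet a Q :=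
  inter_subset_left

theorem mem_smallSet [Nonempty X] {a : ℝ} {Q : Set X} {b : Cell X} : b ∈ smallSet a Q ↔
    b.1 = [] ∧ (b.2.1 = 0 ∨ ∃ q ∈ Q, b.2.carrier ⊆ closedBall q a) := by
  obtain ⟨σ, s⟩ := b
  constructor
  · rintro ⟨⟨-, -, -, h⟩, h'⟩
    exact ⟨List.eq_nil_of_length_eq_zero h', h⟩
  · rintro ⟨h, h'⟩
    obtain rfl : σ = [] := h
    exact ⟨⟨by simp, fun z _ => by simp [ballInter],
      ⟨Classical.arbitrary X, by simp [ballInter]⟩, h'⟩, rfl⟩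

/-- The homology of a pair of coverings by convex balls is the singular homology of the unions. -/
theorem HHmap_small_bijective [Nonempty X] (l : ℕ) {a : ℝ} {Q₀ Q : Set X} (hQ : Q₀ ⊆ Q)
    (hconv : ∀ q ∈ Q, ConvexBeyond a q) :
    Function.Bijective (HHmap cellDeg cellD l (smallSet_subset_coverSet a Q)
      (smallSet_subset_coverSet a Q₀)) := by
  -- The contraction depends on σ alone, so the resulting homotopy also preserves the covering with
  -- centers in `Q₀`.
  have h : ∀ σ : List X, ∃ (z : X) (G : X → ℝ → X), σ ≠ [] → (∀ q ∈ σ, q ∈ Q) →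
      (ballInter a σ).Nonempty → Contraction (ballInter a σ) z G := by
    intro σ
    by_cases h : σ ≠ [] ∧ (∀ q ∈ σ, q ∈ Q) ∧ (ballInter a σ).Nonempty
    · obtain ⟨z, G, hG⟩ := exists_contraction h.1 (fun q hq => hconv q (h.2.1 q hq)) h.2.2
      exact ⟨z, G, fun _ _ _ => hG⟩
    · exact ⟨Classical.arbitrary X, fun x _ => x, fun h1 h2 h3 => (h ⟨h1, h2, h3⟩).elim⟩
  choose z G hG using h
  have h0 : Stable cellD {b : Cell X | b.1.length = 0} := Stable.of_single fun b hb =>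
    cellD_single_mem b (fun σ' hσ' _ => by
      have hb : b.1.length = 0 := hb
      omega) fun _ _ _ => hb
  have h1 : Stable (coneT z G) {b : Cell X | b.1.length = 0} :=
    Stable.of_single fun b hb => coneT_single_mem b fun h =>
      (h (List.eq_nil_of_length_eq_zero hb)).elim
  have hS := stable_coneT hG
  refine HHmap_bijective_of_deform isDifferential_cellD (raisesDegree_coneT z G)
    (stable_coverSet a Q) hS (stable_coverSet a Q₀)
    (stable_coneT fun σ h1 h2 => hG σ h1 fun q hq => hQ (h2 q hq))
    ((stable_coverSet a Q).inter h0) (hS.inter h1) _ (coverSet_mono le_rfl hQ) ?_ ?_ _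
  · exact fun c hc => exists_deform_pow_mem (fun b => b.1.length) (stable_coverSet a Q) hS
      (fun b hb => deform_coneT_mem (fun h => hG b.1 h hb.1 hb.2.2.1) hb.2.1) hc
  · rw [smallSet, inter_right_comm, inter_eq_right.2 (coverSet_mono le_rfl hQ)]

end Coverings

/-! ## Comparison of Čech and Vietoris-Rips complexes -/

section Jung

variable {E : Type*} [NormedAddCommGroup E] [InnerProductSpace ℝ E] {ι : Type*} [Fintype ι]

/-- The variance of a random point. -/
def variance (x : ι → E) (w : ι → ℝ) : ℝ := ∑ i, w i * ‖x i‖ ^ 2 - ‖∑ i, w i • x i‖ ^ 2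

/-- Steiner's identity for moments of inertia. -/
theorem sum_sq_norm_sub (x : ι → E) {w : ι → ℝ} (hw : ∑ i, w i = 1) (y : E) :
    ∑ i, w i * ‖x i - y‖ ^ 2 = variance x w + ‖∑ i, w i • x i - y‖ ^ 2 := by
  have h : ∀ i, w i * ‖x i - y‖ ^ 2 =
      w i * ‖x i‖ ^ 2 - 2 * inner ℝ (w i • x i) y + w i * ‖y‖ ^ 2 := fun i => by
    rw [norm_sub_sq_real, real_inner_smul_left]
    ring
  rw [Finset.sum_congr rfl fun i _ => h i, Finset.sum_add_distrib, Finset.sum_sub_distrib,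
    ← Finset.sum_mul, hw, ← Finset.mul_sum, ← sum_inner, norm_sub_sq_real, variance]
  ring

/-- Points at mutual distance at most `D` are contained in a ball of radius `D / √2`. -/
theorem exists_sq_dist_le [Nonempty ι] (x : ι → E) {D : ℝ} (hD : ∀ i j, dist (x i) (x j) ≤ D) :
    ∃ z, ∀ i, 2 * dist z (x i) ^ 2 ≤ D ^ 2 := by
  classical
  have hcont : Continuous (variance x) := by
    unfold variance
    fun_prop
  obtain ⟨i₀⟩ := ‹Nonempty ι›
  -- The center of the ball is the mean for the weights of maximal variance.
  obtain ⟨w, hw, hmax⟩ := (isCompact_stdSimplex ℝ ι).exists_isMaxOn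
    ⟨_, single_mem_stdSimplex ℝ i₀⟩ hcont.continuousOn
  set z := ∑ i, w i • x i with hz
  have hvar : ∀ j, dist z (x j) ^ 2 ≤ variance x w := by
    intro j
    have hF := sum_sq_norm_sub x hw.2 z
    rw [← hz, sub_self, norm_zero] at hF
    -- Moving mass `t` to the point `x j` cannot increase the variance; divided by `t`, this is the
    -- claim. Then `t` tends to 0.
    have key : ∀ t ∈ Ioc (0 : ℝ) 1, (1 - t) * ‖x j - z‖ ^ 2 ≤ variance x w := by
      intro t ht
      have hmem := convex_stdSimplex ℝ ι hw (single_mem_stdSimplex ℝ j)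
        (sub_nonneg.2 ht.2) ht.1.le (sub_add_cancel 1 t)
      have h1 : variance x _ ≤ variance x w := hmax hmem
      set w' := (1 - t) • w + t • (Pi.single j 1 : ι → ℝ) with hw'
      have h2 := sum_sq_norm_sub x hmem.2 z
      have h3 : ∑ i, w' i • x i = (1 - t) • z + t • x j := by
        simp [hw', add_smul, Finset.sum_add_distrib, mul_smul, ← Finset.smul_sum, ← hz,
          Pi.single_apply]
      have h4 : ∑ i, w' i * ‖x i - z‖ ^ 2 =
          (1 - t) * ∑ i, w i * ‖x i - z‖ ^ 2 + t * ‖x j - z‖ ^ 2 := by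
        simp [hw', add_mul, Finset.sum_add_distrib, mul_assoc, ← Finset.mul_sum,
          Pi.single_apply]
      have h5 : (1 - t) • z + t • x j - z = t • (x j - z) := by
        module
      rw [h4, hF, h3, h5, norm_smul, Real.norm_of_nonneg ht.1.le] at h2
      have h6 : t * ((1 - t) * ‖x j - z‖ ^ 2) ≤ t * variance x w := by nlinarith
      exact le_of_mul_le_mul_left h6 ht.1
    rw [dist_comm, dist_eq_norm]
    have hlim : Tendsto (fun t : ℝ => (1 - t) * ‖x j - z‖ ^ 2) (𝓝[>] 0) (𝓝 (‖x j - z‖ ^ 2)) := by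
      have : Continuous fun t : ℝ => (1 - t) * ‖x j - z‖ ^ 2 := by fun_prop
      have := this.tendsto 0
      rw [sub_zero, one_mul] at this
      exact this.mono_left nhdsWithin_le_nhds
    refine le_of_tendsto hlim ?_
    filter_upwards [Ioc_mem_nhdsGT (zero_lt_one : (0 : ℝ) < 1)] with t ht using key t ht
  -- The left side is the mean squared distance to `x j`. Added to the previous bound it yields the
  -- factor 2.
  have h1 : ∀ j, variance x w + dist z (x j) ^ 2 ≤ D ^ 2 := by
    intro j
    rw [dist_eq_norm, ← sum_sq_norm_sub x hw.2]
    calc ∑ i, w i * ‖x i - x j‖ ^ 2 ≤ ∑ i, w i * D ^ 2 := by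
          refine Finset.sum_le_sum fun i _ => mul_le_mul_of_nonneg_left ?_ (hw.1 i)
          rw [← dist_eq_norm]
          exact pow_le_pow_left₀ dist_nonneg (hD i j) 2
      _ = D ^ 2 := by rw [← Finset.sum_mul, hw.2, one_mul]
  refine ⟨z, fun i => ?_⟩
  linarith [hvar i, h1 i]

end Jung

section Rips

variable {X : Type u} [MetricSpace X]

theorem one_le_ripsConst : 1 ≤ ripsConst X := by
  unfold ripsConst
  split_ifs
  · exact Real.one_le_sqrt.2 one_le_two
  · exact one_le_two

theorem cech_le_rips (a : ℝ) (Q : Set X) : cech a Q ≤ rips a Q := by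
  classical
  intro σ hσ
  refine ⟨hσ.1, hσ.2.1, fun x hx y hy => ?_⟩
  refine (cech a Q).isRelLowerSet_faces hσ |>.2 ?_ (by simp)
  intro z hz
  rcases Finset.mem_insert.1 hz with rfl | hz
  · exact hx
  · rwa [Finset.mem_singleton.1 hz]

/-- Edges of the Čech complex have length at most 2a. Any vertex is the center of a ball of radius
2a containing the simplex; in Euclidean space radius √2 a suffices. -/
theorem rips_le_cech (a : ℝ) (Q : Set X) : rips a Q ≤ cech (ripsConst X * a) Q := by
  classical
  rintro σ ⟨hne, hQ, hσ⟩
  refine ⟨hne, hQ, ?_⟩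
  have hdist : ∀ x ∈ σ, ∀ y ∈ σ, dist x y ≤ 2 * a := by
    intro x hx y hy
    obtain ⟨-, -, z, hz⟩ := hσ x hx y hy
    have h1 : dist z x ≤ a := mem_iInter₂.1 hz x (by simp)
    have h2 : dist z y ≤ a := mem_iInter₂.1 hz y (by simp)
    linarith [dist_triangle_left x y z]
  have hne' : Nonempty σ := hne.to_subtype
  obtain ⟨⟨x₀, hx₀⟩⟩ := id hne'
  unfold ripsConst
  split_ifs with h
  · obtain ⟨n, ⟨e⟩⟩ := h
    obtain ⟨z, hz⟩ := exists_sq_dist_le (fun i : σ => e i) (D := 2 * a) fun i j => by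
      rw [e.dist_eq]
      exact hdist _ i.2 _ j.2
    refine ⟨e.symm z, mem_iInter₂.2 fun x hx => ?_⟩
    have h0 : 0 ≤ a := by
      have := hdist _ hx _ hx
      rw [dist_self] at this
      linarith
    rw [mem_closedBall, ← e.dist_eq, e.apply_symm_apply]
    refine abs_le_of_sq_le_sq' ?_ (by positivity) |>.2
    rw [mul_pow, Real.sq_sqrt zero_le_two]
    have := hz ⟨x, hx⟩
    change 2 * dist z (e x) ^ 2 ≤ _ at this
    linarith
  · exact ⟨x₀, mem_iInter₂.2 fun x hx => hdist _ hx₀ _ hx⟩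

theorem ComplexKind.one_le_const (k : ComplexKind) : 1 ≤ k.const X := by
  cases k
  · exact le_rfl
  · exact one_le_ripsConst

theorem ComplexKind.cech_le (k : ComplexKind) (a : ℝ) (Q : Set X) :
    LocalHomology.cech a Q ≤ k.complex a Q := by
  cases k
  · exact le_rfl
  · exact cech_le_rips a Q

theorem ComplexKind.le_cech (k : ComplexKind) (a : ℝ) (Q : Set X) :
    k.complex a Q ≤ LocalHomology.cech (k.const X * a) Q := by
  cases k
  · exact le_of_eq (by rw [ComplexKind.const, one_mul]; rfl)
  · exact rips_le_cech a Q

end Rips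

/-! ## Interleaving of coverings and subspaces -/

section Interleaving

variable {X : Type u} [MetricSpace X] [Nonempty X]

theorem hereditary_smallSet (a : ℝ) (Q : Set X) : Hereditary (smallSet a Q) where
  nil _ hb := (mem_smallSet.1 hb).1
  mono s s' h hs := by
    refine mem_smallSet.2 ⟨rfl, ?_⟩
    by_cases h0 : s'.1 = 0
    · exact Or.inl h0
    · refine Or.inr (((mem_smallSet.1 h).2.resolve_left fun h1 => ?_).imp
        fun q hq => ⟨hq.1, hs.trans hq.2⟩)
      have h1 : s.1 = 0 := h1
      have := (carrier_nonempty h0).mono hs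
      rw [carrier_eq_empty h1] at this
      exact not_nonempty_empty this

variable {l : ℕ} {a a' η : ℝ} {Q Q₀ Q₀' : Set X} {V V₀ F F₀ : Set (Cell X)}

/-- A pair of subspaces that is covered by the balls of radius `a` maps to the nerve. -/
theorem exists_toNerve (hQ : Q₀ ⊆ Q) (hV : Hereditary V) (hV₀ : Hereditary V₀) (h₀ : V₀ ⊆ V)
    (hη : 0 < η) (h1 : V ∩ fineSet η ⊆ coverSet a Q) (h2 : V₀ ∩ fineSet η ⊆ coverSet a Q₀) :
    ∃ φ : HH (B := Cell X) cellDeg cellD l V V₀ →ₗ[ℤ]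
        HH (B := Cell X) cellDeg cellD l (nerveSet (cech a Q)) (nerveSet (cech a Q₀)),
      ∀ z, HHmap cellDeg cellD l (nerveSet_subset_coverSet a Q) (nerveSet_subset_coverSet a Q₀)
        (φ (HHmap cellDeg cellD l inter_subset_left inter_subset_left z)) =
          HHmap cellDeg cellD l h1 h2 z := by
  -- The map is the zigzag from `V` back to its fine simplices, into the covering, and back to the
  -- nerve.
  let e := LinearEquiv.ofBijective _ (HHmap_nerve_bijective l a hQ)
  let f := LinearEquiv.ofBijective _ (HHmap_fine_bijective l hV hV₀ h₀ hη)
  refine ⟨e.symm.toLinearMap ∘ₗ HHmap cellDeg cellD l h1 h2 ∘ₗ f.symm.toLinearMap, fun z => ?_⟩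
  refine (e.apply_symm_apply _).trans ?_
  exact congrArg _ (f.symm_apply_apply z)

/-- The nerve of convex balls maps to the union of the balls. -/
theorem exists_toSmall (hQ : Q₀ ⊆ Q) (hconv : ∀ q ∈ Q, ConvexBeyond a q) :
    ∃ ψ : HH (B := Cell X) cellDeg cellD l (nerveSet (cech a Q)) (nerveSet (cech a Q₀)) →ₗ[ℤ]
        HH (B := Cell X) cellDeg cellD l (smallSet a Q) (smallSet a Q₀),
      ∀ n, HHmap cellDeg cellD l (smallSet_subset_coverSet a Q)
        (smallSet_subset_coverSet a Q₀) (ψ n) =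
          HHmap cellDeg cellD l (nerveSet_subset_coverSet a Q) (nerveSet_subset_coverSet a Q₀) n := by
  let e := LinearEquiv.ofBijective _ (HHmap_small_bijective l hQ hconv)
  exact ⟨e.symm.toLinearMap ∘ₗ HHmap cellDeg cellD l (nerveSet_subset_coverSet a Q)
    (nerveSet_subset_coverSet a Q₀), fun n => e.apply_symm_apply _⟩

/-- Every class is represented by fine simplices. These are small for the covering, and the two maps
are inverse to each other up to inclusion there. -/
theorem toSmall_toNerve (hQ : Q₀ ⊆ Q) (hV : Hereditary V) (hV₀ : Hereditary V₀) (h₀ : V₀ ⊆ V)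
    (hη : 0 < η) {h1 : V ∩ fineSet η ⊆ coverSet a Q} {h2 : V₀ ∩ fineSet η ⊆ coverSet a Q₀}
    {φ : HH (B := Cell X) cellDeg cellD l V V₀ →ₗ[ℤ]
      HH (B := Cell X) cellDeg cellD l (nerveSet (cech a Q)) (nerveSet (cech a Q₀))}
    (hφ : ∀ z, HHmap cellDeg cellD l (nerveSet_subset_coverSet a Q)
      (nerveSet_subset_coverSet a Q₀)
        (φ (HHmap cellDeg cellD l inter_subset_left inter_subset_left z)) =
          HHmap cellDeg cellD l h1 h2 z)
    {ψ : HH (B := Cell X) cellDeg cellD l (nerveSet (cech a' Q)) (nerveSet (cech a' Q₀)) →ₗ[ℤ]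
      HH (B := Cell X) cellDeg cellD l (smallSet a' Q) (smallSet a' Q₀)}
    (hψ : ∀ n, HHmap cellDeg cellD l (smallSet_subset_coverSet a' Q)
      (smallSet_subset_coverSet a' Q₀) (ψ n) = HHmap cellDeg cellD l
        (nerveSet_subset_coverSet a' Q) (nerveSet_subset_coverSet a' Q₀) n)
    (hconv : ∀ q ∈ Q, ConvexBeyond a' q) (ha : a ≤ a') (hF : smallSet a' Q ⊆ F)
    (hF₀ : smallSet a' Q₀ ⊆ F₀) (hVF : V ⊆ F) (hVF₀ : V₀ ⊆ F₀)
    (z : HH (B := Cell X) cellDeg cellD l V V₀) :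
    HHmap cellDeg cellD l hF hF₀ (ψ (HHmap cellDeg cellD l
      (nerveSet_mono (cech_mono ha subset_rfl)) (nerveSet_mono (cech_mono ha subset_rfl)) (φ z))) =
        HHmap cellDeg cellD l hVF hVF₀ z := by
  obtain ⟨z, rfl⟩ := (HHmap_fine_bijective l hV hV₀ h₀ hη).2 z
  have hsmall : ∀ {V : Set (Cell X)} {Q : Set X}, Hereditary V → V ∩ fineSet η ⊆ coverSet a Q →
      V ∩ fineSet η ⊆ smallSet a' Q := fun hV h b hb =>
    ⟨coverSet_mono ha subset_rfl (h hb), by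
      change b.1.length = 0
      rw [hV.nil b hb.1, List.length_nil]⟩
  have key : ψ (HHmap cellDeg cellD l (nerveSet_mono (cech_mono ha subset_rfl))
      (nerveSet_mono (cech_mono ha subset_rfl))
        (φ (HHmap cellDeg cellD l inter_subset_left inter_subset_left z))) =
      HHmap cellDeg cellD l (hsmall hV h1) (hsmall hV₀ h2) z := by
    apply (HHmap_small_bijective l hQ hconv).1
    rw [hψ, HHmap_HHmap, HHmap_HHmap]
    have := congrArg (HHmap cellDeg cellD l (coverSet_mono ha (subset_refl Q))
      (coverSet_mono ha (subset_refl Q₀))) (hφ z)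
    rwa [HHmap_HHmap, HHmap_HHmap] at this
  rw [key, HHmap_HHmap, HHmap_HHmap]

/-- Tested in the larger covering, where the nerve embeds in homology; there small simplices and
nerve give the same class. -/
theorem toNerve_toSmall (hQ : Q₀ ⊆ Q) (hQ' : Q₀' ⊆ Q) (hQQ : Q₀ ⊆ Q₀')
    (hη : 0 < η) {h1 : V ∩ fineSet η ⊆ coverSet a' Q} {h2 : V₀ ∩ fineSet η ⊆ coverSet a' Q₀'}
    {φ : HH (B := Cell X) cellDeg cellD l V V₀ →ₗ[ℤ]
      HH (B := Cell X) cellDeg cellD l (nerveSet (cech a' Q)) (nerveSet (cech a' Q₀'))}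
    (hφ : ∀ z, HHmap cellDeg cellD l (nerveSet_subset_coverSet a' Q)
      (nerveSet_subset_coverSet a' Q₀')
        (φ (HHmap cellDeg cellD l inter_subset_left inter_subset_left z)) =
          HHmap cellDeg cellD l h1 h2 z)
    {ψ : HH (B := Cell X) cellDeg cellD l (nerveSet (cech a Q)) (nerveSet (cech a Q₀)) →ₗ[ℤ]
      HH (B := Cell X) cellDeg cellD l (smallSet a Q) (smallSet a Q₀)}
    (hψ : ∀ n, HHmap cellDeg cellD l (smallSet_subset_coverSet a Q)
      (smallSet_subset_coverSet a Q₀) (ψ n) = HHmap cellDeg cellD l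
        (nerveSet_subset_coverSet a Q) (nerveSet_subset_coverSet a Q₀) n)
    (ha : a ≤ a') (hF : smallSet a Q ⊆ V) (hF₀ : smallSet a Q₀ ⊆ V₀)
    (n : HH (B := Cell X) cellDeg cellD l (nerveSet (cech a Q)) (nerveSet (cech a Q₀))) :
    φ (HHmap cellDeg cellD l hF hF₀ (ψ n)) = HHmap cellDeg cellD l
      (nerveSet_mono (cech_mono ha subset_rfl)) (nerveSet_mono (cech_mono ha hQQ)) n := by
  apply (HHmap_nerve_bijective l a' hQ').1
  have hψn := congrArg (HHmap cellDeg cellD l (coverSet_mono ha (subset_refl Q))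
    (coverSet_mono ha hQQ)) (hψ n)
  rw [HHmap_HHmap, HHmap_HHmap] at hψn
  have hsmall : smallSet a Q₀ ⊆ smallSet a Q :=
    inter_subset_inter_left _ (coverSet_mono le_rfl hQ)
  obtain ⟨z, hz⟩ := (HHmap_fine_bijective l (hereditary_smallSet a Q) (hereditary_smallSet a Q₀)
    hsmall hη).2 (ψ n)
  rw [HHmap_HHmap, ← hψn, ← hz, HHmap_HHmap, HHmap_HHmap]
  have := hφ (HHmap cellDeg cellD l (inter_subset_inter_left _ hF)
    (inter_subset_inter_left _ hF₀) z)
  rwa [HHmap_HHmap, HHmap_HHmap] at this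

/-- Complexes that are interleaved with coverings by balls, which are interleaved with pairs of
subspaces, recover the homology of a pair of subspaces. -/
theorem exists_injective_range_eq {a₀ a₁ a₂ a₃ : ℝ} (h01 : a₀ ≤ a₁) (h12 : a₁ ≤ a₂) (h23 : a₂ ≤ a₃)
    {P₁ P₂ P : Set X} (hP₁ : P₁ ⊆ P₂) (hP₂ : P₂ ⊆ P) (hc₁ : ∀ q ∈ P, ConvexBeyond a₁ q)
    (hc₃ : ∀ q ∈ P, ConvexBeyond a₃ q) {A A₀ F₁ F₁₀ F₂ F₂₀ F₃ F₃₀ : Set (Cell X)}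
    (hA : Hereditary A) (hA₀ : Hereditary A₀) (hF₂ : Hereditary F₂) (hF₂₀ : Hereditary F₂₀)
    (hAA : A₀ ⊆ A) (hFF : F₂₀ ⊆ F₂) (hAF : A ⊆ F₁) (hAF₀ : A₀ ⊆ F₁₀) (hF : F₁ ⊆ F₂)
    (hF₀ : F₁₀ ⊆ F₂₀) (hF' : F₂ ⊆ F₃) (hF₀' : F₂₀ ⊆ F₃₀) (hη : 0 < η)
    (hAη : A ∩ fineSet η ⊆ coverSet a₀ P) (hAη₀ : A₀ ∩ fineSet η ⊆ coverSet a₀ P₁)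
    (hFη : F₂ ∩ fineSet η ⊆ coverSet a₂ P) (hFη₀ : F₂₀ ∩ fineSet η ⊆ coverSet a₂ P₂)
    (hs₁ : smallSet a₁ P ⊆ F₁) (hs₁₀ : smallSet a₁ P₁ ⊆ F₁₀)
    (hs₃ : smallSet a₃ P ⊆ F₃) (hs₃₀ : smallSet a₃ P₂ ⊆ F₃₀)
    {L₁ L₁₀ L₂ L₂₀ : PreAbstractSimplicialComplex X}
    (hL₁ : cech a₀ P ≤ L₁) (hL₁' : L₁ ≤ cech a₁ P) (hL₁₀ : cech a₀ P₁ ≤ L₁₀)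
    (hL₁₀' : L₁₀ ≤ cech a₁ P₁) (hL₂ : cech a₂ P ≤ L₂) (hL₂' : L₂ ≤ cech a₃ P)
    (hL₂₀ : cech a₂ P₂ ≤ L₂₀) (hL₂₀' : L₂₀ ≤ cech a₃ P₂) (hL : L₁ ≤ L₂) (hL₀ : L₁₀ ≤ L₂₀)
    (hinj : Function.Injective (HHmap cellDeg cellD l (hAF.trans (hF.trans hF'))
      (hAF₀.trans (hF₀.trans hF₀'))))
    (hrange : ∀ u : HH (B := Cell X) cellDeg cellD l F₁ F₁₀, ∃ z,
      HHmap cellDeg cellD l hF hF₀ u =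
        HHmap cellDeg cellD l (hAF.trans hF) (hAF₀.trans hF₀) z) :
    ∃ θ : HH (B := Cell X) cellDeg cellD l A A₀ →ₗ[ℤ]
        HH (B := Cell X) cellDeg cellD l (nerveSet L₁) (nerveSet L₁₀),
      Function.Injective (fun z =>
        HHmap cellDeg cellD l (nerveSet_mono hL) (nerveSet_mono hL₀) (θ z)) ∧
      ∀ n, ∃ z, HHmap cellDeg cellD l (nerveSet_mono hL) (nerveSet_mono hL₀) n =
        HHmap cellDeg cellD l (nerveSet_mono hL) (nerveSet_mono hL₀) (θ z) := by
  obtain ⟨φ₁, hφ₁⟩ := exists_toNerve (l := l) (hP₁.trans hP₂) hA hA₀ hAA hη hAη hAη₀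
  obtain ⟨φ₂, hφ₂⟩ := exists_toNerve (l := l) hP₂ hF₂ hF₂₀ hFF hη hFη hFη₀
  obtain ⟨ψ₁, hψ₁⟩ := exists_toSmall (l := l) (hP₁.trans hP₂) hc₁
  obtain ⟨ψ₃, hψ₃⟩ := exists_toSmall (l := l) hP₂ hc₃
  -- The inclusion of complexes factors through the pairs `F₁` and `F₂` of subspaces.
  have incl : ∀ n, HHmap cellDeg cellD l (nerveSet_mono hL) (nerveSet_mono hL₀) n =
      HHmap cellDeg cellD l (nerveSet_mono hL₂) (nerveSet_mono hL₂₀)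
        (φ₂ (HHmap cellDeg cellD l (hs₁.trans hF) (hs₁₀.trans hF₀)
          (ψ₁ (HHmap cellDeg cellD l (nerveSet_mono hL₁') (nerveSet_mono hL₁₀') n)))) := by
    intro n
    rw [toNerve_toSmall (hP₁.trans hP₂) hP₂ hP₁ hη hφ₂ hψ₁ h12, HHmap_HHmap, HHmap_HHmap]
  have comp : ∀ z, HHmap cellDeg cellD l (hs₁.trans hF) (hs₁₀.trans hF₀)
      (ψ₁ (HHmap cellDeg cellD l (nerveSet_mono hL₁') (nerveSet_mono hL₁₀')
        (HHmap cellDeg cellD l (nerveSet_mono hL₁) (nerveSet_mono hL₁₀) (φ₁ z)))) =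
      HHmap cellDeg cellD l (hAF.trans hF) (hAF₀.trans hF₀) z := by
    intro z
    rw [HHmap_HHmap]
    exact toSmall_toNerve (hP₁.trans hP₂) hA hA₀ hAA hη hφ₁ hψ₁ hc₁ h01 _ _ _ _ z
  refine ⟨HHmap cellDeg cellD l (nerveSet_mono hL₁) (nerveSet_mono hL₁₀) ∘ₗ φ₁, ?_, ?_⟩
  · intro z z' h
    apply hinj
    simp only [LinearMap.comp_apply] at h
    rw [incl, incl, comp, comp] at h
    have h' := congrArg (fun m => HHmap cellDeg cellD l hs₃ hs₃₀ (ψ₃ (HHmap cellDeg cellD l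
      (nerveSet_mono hL₂') (nerveSet_mono hL₂₀') m))) h
    -- Continuing from `L₂` to `F₃` turns the map from `A` into the inclusion of `A` in `F₃`, which
    -- is injective.
    have comp' : ∀ f, HHmap cellDeg cellD l hs₃ hs₃₀ (ψ₃ (HHmap cellDeg cellD l
        (nerveSet_mono hL₂') (nerveSet_mono hL₂₀') (HHmap cellDeg cellD l (nerveSet_mono hL₂)
          (nerveSet_mono hL₂₀) (φ₂ f)))) = HHmap cellDeg cellD l hF' hF₀' f := by
      intro f
      rw [HHmap_HHmap]
      exact toSmall_toNerve hP₂ hF₂ hF₂₀ hFF hη hφ₂ hψ₃ hc₃ h23 _ _ _ _ f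
    simp only [comp'] at h'
    rwa [HHmap_HHmap, HHmap_HHmap] at h'
  · intro n
    obtain ⟨z, hz⟩ := hrange (HHmap cellDeg cellD l hs₁ hs₁₀
      (ψ₁ (HHmap cellDeg cellD l (nerveSet_mono hL₁') (nerveSet_mono hL₁₀') n)))
    refine ⟨z, ?_⟩
    rw [HHmap_HHmap] at hz
    rw [LinearMap.comp_apply, incl, incl, comp, hz]

end Interleaving

/-! ## Samples -/

section Samples

theorem noise_nonneg {X : Type u} (K P : Set X) : 0 ≤ noise K P := by
  unfold noise
  split_ifs <;> norm_num

variable {X : Type u} [MetricSpace X]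

/-- A single point with slack `η` suffices, since the simplex has diameter less than `η`. -/
theorem singSet_inter_fineSet_subset [Nonempty X] {Y P : Set X} {a η : ℝ}
    (h : ∀ y ∈ Y, ∃ q ∈ P, dist y q ≤ a - η) : singSet Y ∩ fineSet η ⊆ coverSet a P := by
  rintro ⟨σ, s⟩ ⟨⟨h1, h2⟩, -, h3⟩
  obtain rfl : σ = [] := h1
  refine (mem_smallSet.2 ⟨rfl, ?_⟩ : _ ∈ smallSet a P).1
  by_cases h0 : s.1 = 0
  · exact Or.inl h0
  · obtain ⟨y, hy⟩ := carrier_nonempty h0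
    obtain ⟨q, hq, hyq⟩ := h y (h2 hy)
    refine Or.inr ⟨q, hq, fun z hz => ?_⟩
    have h4 := h3 z hz y hy
    rw [mem_closedBall]
    linarith [dist_triangle z y q]

theorem smallSet_subset_singSet [Nonempty X] {Y P : Set X} {a : ℝ}
    (h : ∀ q ∈ P, closedBall q a ⊆ Y) : smallSet a P ⊆ singSet Y := by
  intro b hb
  obtain ⟨h1, h2⟩ := mem_smallSet.1 hb
  refine ⟨h1, ?_⟩
  rcases h2 with h2 | ⟨q, hq, h2⟩
  · rw [carrier_eq_empty h2]
    exact empty_subset _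
  · exact h2.trans (h q hq)

/-- The strict bound on the Hausdorff distance leaves a uniform slack; a sample point in K is its
own nearest point. -/
theorem IsSample.exists_dist_le {K P : Set X} {ε : ℝ} (h : IsSample K P ε) :
    ∃ η > 0, (∀ y ∈ K, ∃ q ∈ P, dist y q ≤ ε - η) ∧
      ∀ q ∈ P, ∃ y ∈ K, dist q y ≤ noise K P * ε := by
  obtain ⟨r, hr0, hr, hrε⟩ := ENNReal.lt_iff_exists_real_btwn.1 h.2
  have hrε' := (ENNReal.ofReal_lt_ofReal_iff_of_nonneg hr0).1 hrε
  have hle : ∀ {a b : X} {e : ℝ}, 0 ≤ e → edist a b < ENNReal.ofReal e → dist a b ≤ e := by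
    intro a b e he hab
    rw [edist_dist] at hab
    exact ((ENNReal.ofReal_lt_ofReal_iff_of_nonneg dist_nonneg).1 hab).le
  refine ⟨ε - r, sub_pos.2 hrε', fun y hy => ?_, fun q hq => ?_⟩
  · obtain ⟨q, hq, hyq⟩ := exists_edist_lt_of_hausdorffEDist_lt hy hr
    exact ⟨q, hq, (hle hr0 hyq).trans (by linarith)⟩
  · unfold noise
    split_ifs with hPK
    · exact ⟨q, hPK hq, by simp⟩
    · have h2 := h.2
      rw [hausdorffEDist_comm] at h2
      obtain ⟨y, hy, hyq⟩ := exists_edist_lt_of_hausdorffEDist_lt hq h2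
      exact ⟨y, hy, by simpa using hle (hr0.trans hrε'.le) hyq⟩

/-- Without noise `p` lies in K, so its closest point `x` is `p` itself. -/
theorem Corresponds.dist_le {K P : Set X} {ε : ℝ} {x p : X} (h : Corresponds K P ε x p)
    (hp : p ∈ P) : dist x p ≤ noise K P * ε := by
  unfold noise
  split_ifs with hPK
  · have := h.1 hPK p (hPK hp)
    rw [dist_self, dist_comm] at this
    simpa using this
  · simpa using (h.2 hPK).le

theorem sdiff_ball_subset_sdiff_ball_of_dist {x p y q : X} {a b ρ ρ' : ℝ} (hxp : dist x p ≤ b)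
    (hyq : dist y q ≤ a) (hρ : ρ' + a + b ≤ ρ) (hy : y ∉ ball x ρ) : q ∉ ball p ρ' := by
  rw [mem_ball, not_lt] at hy ⊢
  linarith [dist_triangle4 y q p x, dist_comm x p]

end Samples

/-! ## Admissible scales -/

section Scales

variable {A : ℝ → Set (ℝ × ℝ × ℝ)} (D : SeemlyData A)

/-- The strict inequality excludes an infinite gap and leaves room for a real number above the
infimum that still admits γ. -/
theorem SeemlyData.exists_triangle_subset {ε β γ R r : ℝ}
    (h : (R, r) ∈ D.triangle ε β (D.gap ε β + (γ : EReal))) :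
    ∃ d > 0, d + γ < R - r ∧ D.triangle ε β d ⊆ D.slab ε β := by
  obtain ⟨-, -, h⟩ := h
  have h0 : 0 ≤ D.gap ε β := by
    refine le_sInf ?_
    rintro _ ⟨d, hd, rfl, -⟩
    exact_mod_cast hd.le
  have h1 : D.gap ε β < ((R - r - γ : ℝ) : EReal) := by
    change (r : EReal) + (D.gap ε β + (γ : EReal)) < (R : EReal) at h
    induction hg : D.gap ε β with
    | bot => rw [hg] at h0; simp at h0
    | top => rw [hg] at h; simp at h
    | coe e =>
      rw [hg] at h
      have h : r + (e + γ) < R := by exact_mod_cast h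
      have : e < R - r - γ := by linarith
      exact_mod_cast this
  obtain ⟨_, ⟨d, hd, rfl, hsub⟩, hlt⟩ := sInf_lt_iff.1 h1
  have hlt : d < R - r - γ := by exact_mod_cast hlt
  exact ⟨d, hd, by linarith, hsub⟩

/-- The section at the smallest α is nonempty, and its triples satisfy ε ≤ α. -/
theorem SeemlyData.le_lower {K : Set X} [MetricSpace X] {S : Set (Set X)} {L : Set X}
    (D : SeemlyData (scales K S L)) {e : ℝ} (he : e ∈ Icc 0 D.bound) : e ≤ D.lower e := by
  obtain ⟨q, hq⟩ := D.nonempty e he _ ⟨le_rfl, D.lower_le_upper e he⟩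
  exact hq.2.2.1

end Scales

/-! ### The homological condition in terms of cells. -/

section Homology

variable {X : Type u} [MetricSpace X] {K : Set X} {x : X} {ε R r α : ℝ}

theorem HomologicalCondition.injective (h : HomologicalCondition K x ε R r α) (l : ℕ)
    (hK : K ⊆ cthickening α K) (hr : ball x r ⊆ ball x R) :
    Function.Injective (HHmap (B := Cell X) cellDeg cellD l (singSet_mono hK)
      (singSet_mono (sdiff_subset_sdiff hK hr))) := by
  obtain ⟨-, hα, hr', h⟩ := h
  have h1 := (h l).1
  intro z z' hz
  apply (singEquiv l K (ball x R)).injective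
  apply h1
  rw [ModuleCat.comp_apply, ModuleCat.comp_apply, HRelMap_singEquiv, HRelMap_singEquiv,
    HRelMap_singEquiv, HRelMap_singEquiv, HHmap_HHmap, HHmap_HHmap]
  exact congrArg _ hz

theorem HomologicalCondition.exists_eq (h : HomologicalCondition K x ε R r α) (l : ℕ)
    (hK : K ⊆ cthickening ε K) (hα : cthickening ε K ⊆ cthickening α K)
    (hr : ball x r ⊆ ball x R)
    (u : HH (B := Cell X) cellDeg cellD l (singSet (cthickening ε K))
      (singSet (cthickening ε K \ ball x R))) :
    ∃ z : HH (B := Cell X) cellDeg cellD l (singSet K) (singSet (K \ ball x R)),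
      HHmap cellDeg cellD l (singSet_mono hα) (singSet_mono (sdiff_subset_sdiff hα hr)) u =
        HHmap cellDeg cellD l (singSet_mono (hK.trans hα))
          (singSet_mono (sdiff_subset_sdiff (hK.trans hα) hr)) z := by
  obtain ⟨-, hα', hr', h⟩ := h
  have h1 : HRelMap l hα hr (singEquiv l _ _ u) ∈
      LinearMap.range (HRelMap l hα hr).hom := ⟨_, rfl⟩
  have h2 := (h l).2
  rw [← h2] at h1
  obtain ⟨y, hy⟩ := h1
  obtain ⟨z, rfl⟩ := (singEquiv l K (ball x R)).surjective y
  refine ⟨z, (singEquiv l (cthickening α K) (ball x r)).injective ?_⟩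
  rw [← HRelMap_singEquiv l hα hr, ← hy]
  refine (ModuleCat.comp_apply _ _ _).trans ?_
  rw [HRelMap_singEquiv, HRelMap_singEquiv, HHmap_HHmap]

theorem HHmap_surjective_of_isIso {l : ℕ} {Y U U' : Set X} (hU : U' ⊆ U)
    (h : IsIso (HRelMap l (subset_refl Y) hU)) :
    Function.Surjective (HHmap (B := Cell X) cellDeg cellD l (subset_refl (singSet Y))
      (singSet_mono (sdiff_subset_sdiff (subset_refl Y) hU))) := by
  intro z
  obtain ⟨y, hy⟩ := (ModuleCat.epi_iff_surjective (HRelMap l (subset_refl Y) hU)).1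
    inferInstance (singEquiv l Y U' z)
  obtain ⟨w, rfl⟩ := (singEquiv l Y U).surjective y
  exact ⟨w, (singEquiv l Y U').injective ((HRelMap_singEquiv l _ hU w).symm.trans hy)⟩

end Homology

/-- An additive equivalence is linear over `ℤ`, for all module structures. -/
def intLinearEquiv {M N : Type*} [AddCommGroup M] [AddCommGroup N] [Module ℤ M] [Module ℤ N]
    (e : M ≃+ N) : M ≃ₗ[ℤ] N :=
  { e with map_smul' := fun n x => by simpa using map_intCast_smul e ℤ ℤ n x }

theorem nonempty_addEquiv_range {M N L : Type*} [AddCommGroup M] [AddCommGroup N]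
    [AddCommGroup L] [Module ℤ M] [Module ℤ N] (f : M →ₗ[ℤ] N) (g : L →+ N)
    (hg : Function.Injective g) (h : ∀ y, y ∈ LinearMap.range f ↔ y ∈ g.range) :
    Nonempty (LinearMap.range f ≃+ L) := by
  have hr : (LinearMap.range f).toAddSubgroup = g.range := AddSubgroup.ext h
  exact ⟨(AddEquiv.addSubgroupCongr hr).trans (AddMonoidHom.ofInjective hg).symm⟩

theorem nonempty_range_simplicialHMap {X : Type u} [TopologicalSpace X] (l : ℕ)
    {C₀ C D₀ D : PreAbstractSimplicialComplex X} (hC : C₀ ≤ C) (hD : D₀ ≤ D) (h₀ : C₀ ≤ D₀)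
    (h : C ≤ D) {V V₀ : Set (Cell X)} (θ : HH (B := Cell X) cellDeg cellD l V V₀ →ₗ[ℤ]
      HH (B := Cell X) cellDeg cellD l (nerveSet C) (nerveSet C₀))
    (hinj : Function.Injective (fun z =>
      HHmap cellDeg cellD l (nerveSet_mono h) (nerveSet_mono h₀) (θ z)))
    (hrange : ∀ n, ∃ z, HHmap cellDeg cellD l (nerveSet_mono h) (nerveSet_mono h₀) n =
      HHmap cellDeg cellD l (nerveSet_mono h) (nerveSet_mono h₀) (θ z)) :
    Nonempty (LinearMap.range (simplicialHMap l hC hD h₀ h).hom ≃+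
      HH (B := Cell X) cellDeg cellD l V V₀) := by
  have he := simplicialHMap_nerveEquiv l hC hD h₀ h
  refine nonempty_addEquiv_range (simplicialHMap l hC hD h₀ h).hom
    ((nerveEquiv l hD).toAddMonoidHom.comp (HHmap cellDeg cellD l (nerveSet_mono h)
      (nerveSet_mono h₀) ∘ₗ θ).toAddMonoidHom) ((nerveEquiv l hD).injective.comp hinj) ?_
  intro y
  constructor
  · rintro ⟨m, rfl⟩
    obtain ⟨n, rfl⟩ := (nerveEquiv l hC).surjective m
    obtain ⟨z, hz⟩ := hrange n
    exact ⟨z, ((he n).trans (congrArg _ hz)).symm⟩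
  · rintro ⟨z, rfl⟩
    exact ⟨nerveEquiv l hC (θ z), he (θ z)⟩

end LocalHomology

end

/-! ### The recovery theorem. -/

open LocalHomology in
theorem mainTheorem2 {X : Type u} [MetricSpace X] [CompleteSpace X] [LocallyCompactSpace X]
    (hmid : ∀ x y : X, ∃ z : X, dist x y = 2 * dist x z ∧ dist x y = 2 * dist y z)
    (hconvex : LocallyStronglyConvex X)
    {K : Set X} (hK : IsCompact K) (hretract : IsNeighborhoodRetract K)
    {S : Set (Set X)} (hS : IsHomologyStratification K S)
    (hseemly : WeaklyLocallySeemly K S)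
    (choice : ScaleChoice K S)
    {P : Set X} {ε : ℝ} (hε : 0 < ε) (hP : IsSample K P ε)
    (k : ComplexKind) (t c : ℝ) (ht : t = noise K P) (hc : c = k.const X)
    (w : LowerStratum S → ℝ≥0) (hw : w ∈ Omega choice ε (fFun t c) (gFun t c))
    (ε' β γ : ℝ) (hε' : ε' = (scaleData choice hw).lower (gFun t c 0 ε))
    (hβ : β = gFun t c ε' ε) (hγ : γ = fFun t c 0 ε + fFun t c ε' ε)
    (hconv : ENNReal.ofReal (c * (ε' + ε)) < convRadiusSet P)
    (R' r' : ℝ)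
    (hR'r' : (R', r') ∈
      (scaleData choice hw).triangle ε' β ((scaleData choice hw).gap ε' β + (γ : EReal)))
    (R r : ℝ) (hR : R = R' - gFun t 1 0 ε) (hr : r = r' + gFun t c ε' ε)
    (p : X) (hp : p ∈ P) (x : X) (hx : x ∈ shrunk S w) (hxp : Corresponds K P ε x p) :
    ∃ (hscale : ε ≤ ε' + ε) (hlocal : r ≤ R), ∀ l : ℕ,
      Nonempty (LinearMap.range (complexHMap k l P p hscale hlocal).hom ≃ₗ[ℤ] HRel l K {x}) := by
  set D := scaleData choice hw
  have hgood : ε ∈ D.goodScales (fFun t c) (gFun t c) := Exists.snd hw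
  obtain ⟨-, hg, hε'D, -⟩ := hgood
  rw [← hε'] at hε'D
  have hgε' : gFun t c 0 ε ≤ ε' := hε' ▸ D.le_lower hg
  have hc1 : 1 ≤ c := hc ▸ k.one_le_const
  have ht0 : 0 ≤ t := ht ▸ noise_nonneg K P
  obtain ⟨d, hd, hdR, hsub⟩ := D.exists_triangle_subset hR'r'
  obtain ⟨hrbar, hRbar, -⟩ := hR'r'
  have hg0 := hg.1
  have hcε : ε ≤ c * ε := le_mul_of_one_le_left hε.le hc1
  have htε : 0 ≤ t * ε := mul_nonneg ht0 hε.le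
  have hε'0 : 0 ≤ ε' := hg0.trans hgε'
  have hcε' : ε' ≤ c * ε' := le_mul_of_one_le_left hε'0 hc1
  simp only [gFun, fFun] at hβ hγ hR hr hg0 hgε' hg hε'
  set g := c * 0 + (c + t) * ε with hgdef
  -- The radius of `F₁`: from R' to R costs a cover radius ε and the noise twice, from R to `RC` a
  -- ball radius cε and the noise twice. The radius `r₁` of `F₂` arises likewise from r', with ε' +
  -- ε for ε. The total loss is γ.
  set RC := R' - ((c * 0 + (c + t) * ε) + (1 * 0 + (1 + t) * ε)) with hRC
  set r₁ := r' + ((c * ε' + (c + t) * ε) + (1 * ε' + (1 + t) * ε)) with hr₁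
  have hβε' : ε' ≤ β := by linarith
  have hdRC : d < RC - r₁ := by linarith
  have hslab : ∀ {q : ℝ × ℝ}, q ∈ D.triangle ε' β d → q ∈ D.slab ε' β := fun hq => hsub hq
  -- The slab at scale 0, where α may be any value from 0 to β.
  have h1 : HomologicalCondition K x 0 R' r' β := by
    have : (R', r') ∈ D.slab ε' β := by
      refine hslab ⟨hrbar, hRbar, ?_⟩
      change (r' : EReal) + (d : EReal) < (R' : EReal)
      exact_mod_cast (by linarith : r' + d < R')
    have := this 0 ⟨le_rfl, hε'0⟩ β ⟨by rw [D.lower_zero]; exact hε'0.trans hβε', le_rfl⟩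
    exact (this.2.2.2 x hx).2.2
  -- The loss γ was reserved in the triangle, so the shrunk pair of radii is still admissible. At
  -- scale `g` the least α is ε' by definition.
  have h2 : (RC, r₁, ε') ∈ scales K S (shrunk S w) g := by
    have : (RC, r₁) ∈ D.slab ε' β := by
      refine hslab ⟨hrbar.trans_le ?_, lt_of_le_of_lt ?_ hRbar, ?_⟩
      · exact_mod_cast (by linarith : r' ≤ r₁)
      · exact_mod_cast (by linarith : RC ≤ R')
      · change (r₁ : EReal) + (d : EReal) < (RC : EReal)
        exact_mod_cast (by linarith : r₁ + d < RC)
    exact this g ⟨hg0, hgε'⟩ ε' ⟨hε'.ge, hβε'⟩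
  have hRC0 : RC ∈ Ioc 0 R' := by
    have := h2.2.1
    have := h2.1
    simp only at *
    exact ⟨by linarith, by linarith⟩
  have hrR : r ≤ R := by linarith
  refine ⟨by linarith, hrR, fun l => ?_⟩
  have : Nonempty X := ⟨x⟩
  obtain ⟨η, hη, hKP, hPK⟩ := hP.exists_dist_le
  have hxp' := hxp.dist_le hp
  rw [← ht] at hPK hxp'
  have hconv' : ∀ a ∈ Icc 0 (c * (ε' + ε)), ∀ q ∈ P, ConvexBeyond a q := fun a ha q hq =>
    convexBeyond_of_lt ha.1 hq ((ENNReal.ofReal_le_ofReal ha.2).trans_lt hconv)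
  have hKe : ∀ e, K ⊆ cthickening e K := fun e => self_subset_cthickening K
  have hthick : ∀ y ∈ cthickening ε' K, ∃ q ∈ P, dist y q ≤ ε' + ε - η := by
    intro y hy
    rw [hK.cthickening_eq_biUnion_closedBall hε'0] at hy
    obtain ⟨z, hz, hyz⟩ := mem_iUnion₂.1 hy
    obtain ⟨q, hq, hzq⟩ := hKP z hz
    exact ⟨q, hq, (dist_triangle y z q).trans (by linarith [mem_closedBall.1 hyz])⟩
  have hball : ∀ {a δ : ℝ}, a + t * ε ≤ δ → ∀ q ∈ P, closedBall q a ⊆ cthickening δ K := by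
    intro a δ h q hq y hy
    obtain ⟨z, hz, hqz⟩ := hPK q hq
    exact mem_cthickening_of_dist_le _ z _ _ hz
      ((dist_triangle y q z).trans (by linarith [mem_closedBall.1 hy]))
  have hcover : ∀ {Y : Set X} {a ρ ρ' : ℝ}, (∀ y ∈ Y, ∃ q ∈ P, dist y q ≤ a - η) →
      ρ' + a + t * ε ≤ ρ → ∀ y ∈ Y \ ball x ρ, ∃ q ∈ P \ ball p ρ', dist y q ≤ a - η := by
    rintro Y a ρ ρ' h hρ y ⟨hy, hyρ⟩
    obtain ⟨q, hq, hyq⟩ := h y hy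
    exact ⟨q, ⟨hq, sdiff_ball_subset_sdiff_ball_of_dist hxp' hyq (by linarith) hyρ⟩, hyq⟩
  have hball' : ∀ {a δ ρ ρ' : ℝ}, a + t * ε ≤ δ → ρ' + a + t * ε ≤ ρ →
      ∀ q ∈ P \ ball p ρ, closedBall q a ⊆ cthickening δ K \ ball x ρ' := by
    rintro a δ ρ ρ' h hρ q ⟨hq, hqρ⟩ y hy
    refine ⟨hball h q hq hy, sdiff_ball_subset_sdiff_ball_of_dist (x := p) (p := x) ?_ ?_ hρ hqρ⟩
    · rwa [dist_comm]
    · rw [dist_comm]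
      exact hy
  have hcthick : cthickening g K ⊆ cthickening ε' K := cthickening_mono hgε' K
  have hcthick' : cthickening ε' K ⊆ cthickening β K := cthickening_mono hβε' K
  have hRCR' : ball x RC ⊆ ball x R' := ball_subset_ball hRC0.2
  have hrRC : ball x r₁ ⊆ ball x RC := ball_subset_ball h2.1
  have hrr : ball x r' ⊆ ball x r₁ := ball_subset_ball (by linarith)
  have hP₁ : P \ ball p R ⊆ P \ ball p r :=
    sdiff_subset_sdiff_right (ball_subset_ball hrR)
  obtain ⟨θ, hθ, hθ'⟩ := exists_injective_range_eq (l := l) (a₀ := ε) (a₁ := c * ε)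
    (a₂ := ε' + ε) (a₃ := c * (ε' + ε)) hcε (by linarith) (by linarith) hP₁ sdiff_subset
    (hconv' _ ⟨by linarith, by linarith⟩) (hconv' _ ⟨by linarith, le_rfl⟩)
    (hereditary_singSet K) (hereditary_singSet (K \ ball x R'))
    (hereditary_singSet (cthickening ε' K)) (hereditary_singSet (cthickening ε' K \ ball x r₁))
    (singSet_mono sdiff_subset) (singSet_mono sdiff_subset)
    (singSet_mono (hKe g)) (singSet_mono (sdiff_subset_sdiff (hKe g) hRCR'))
    (singSet_mono hcthick) (singSet_mono (sdiff_subset_sdiff hcthick hrRC))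
    (singSet_mono hcthick') (singSet_mono (sdiff_subset_sdiff hcthick' hrr)) hη
    (singSet_inter_fineSet_subset hKP)
    (singSet_inter_fineSet_subset (hcover hKP (by linarith)))
    (singSet_inter_fineSet_subset hthick)
    (singSet_inter_fineSet_subset (hcover hthick (by linarith)))
    (smallSet_subset_singSet (hball (by linarith)))
    (smallSet_subset_singSet (hball' (by linarith) (by linarith)))
    (smallSet_subset_singSet (hball (by linarith)))
    (smallSet_subset_singSet (hball' (by linarith) (by linarith)))
    (k.cech_le _ _) (hc ▸ k.le_cech _ _) (k.cech_le _ _) (hc ▸ k.le_cech _ _)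
    (k.cech_le _ _) (hc ▸ k.le_cech _ _) (k.cech_le _ _) (hc ▸ k.le_cech _ _)
    (k.complex_mono (by linarith) subset_rfl) (k.complex_mono (by linarith) hP₁)
    (h1.injective l (hKe β) (hrr.trans (hrRC.trans hRCR'))) (by
      intro u
      obtain ⟨z, hz⟩ := (h2.2.2.2 x hx).2.2.exists_eq l (hKe g) hcthick hrRC u
      -- The class found lives on the complement of the ball of radius `RC`; local constancy moves
      -- it to R'.
      obtain ⟨z', rfl⟩ := HHmap_surjective_of_isIso hRCR' (h1.1 RC hRC0 l).1 z
      exact ⟨z', hz.trans (HHmap_HHmap _ _ _ _ z')⟩)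
  have := (h1.1 R' ⟨hRC0.1.trans_le hRC0.2, le_rfl⟩ l).2
  obtain ⟨f⟩ := nonempty_range_simplicialHMap l _ _ _ _ θ hθ hθ'
  exact ⟨intLinearEquiv (f.trans ((singEquiv l K (ball x R')).trans
    (asIso (HRelMap l (subset_refl K) _)).toLinearEquiv.toAddEquiv))⟩
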